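/- Let $\mathbb F$ be a field of characteristic $0$ and $N\ge 1$. Let $I=\{i\in\mathbb Z\mid i\ge -N\}$ or $I=\{-N,\dots,-1\}$, and let $\mathcal V=\mathcal R_I=\mathbb F\langle u_i^{(n)}\mid i\in I,\ n\ge 0\rangle$ be the algebra of non-commutative differential polynomials, with the derivation $\partial u_i^{(n)}=u_i^{(n+1)}$. A $2$-fold $\lambda$-bracket on $\mathcal V$ is a bilinear map $(a,b)\mapsto\{\!\{a_\lambda b\}\!\}\in(\mathcal V\otimes\mathcal V)[\lambda]$ such that $\{\!\{\partial a_\lambda b\}\!\}=-\lambda\{\!\{a_\lambda b\}\!\}$, $\{\!\{a_\lambda\partial b\}\!\}=(\lambda+\partial)\{\!\{a_\lambda b\}\!\}$, $\{\!\{a_\lambda bc\}\!\}=\{\!\{a_\lambda b\}\!\}c+b\{\!\{a_\lambda c\}\!\}$ (outer bimodule structure) and $\{\!\{ab_\lambda c\}\!\}=\{\!\{a_{\lambda+\partial}c\}\!\}_\to\star_1 b+(e^{\partial\partial_\lambda}a)\star_1\{\!\{b_\lambda c\}\!\}$, where $(x\otimes y)\star_1 b=xb\otimes y$, $a\star_1(x\otimes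 y)=x\otimes ay$, and the arrow means that $\partial$ acts on $b$. Put $u_i=u_i^{(0)}$ and $L(z)=z^N+\sum_{i\in I}u_iz^{-i-1}$, the symbol of $L(\partial)\in\mathcal V((\partial^{-1}))$, and let $L^*$ be the formal adjoint. Let $H$ and $K$ be the $2$-fold $\lambda$-brackets on $\mathcal V$ whose values $\{\!\{u_i{}_\lambda u_j\}\!\}$ on generators are the coefficients of $z^{-i-1}w^{-j-1}$ in $$\{\!\{L(z)_\lambda L(w)\}\!\}_H=L(z)\otimes i_z(z-w-\lambda-\partial)^{-1}L(w)-L(w+\lambda+\partial)\otimes i_z(z-w-\lambda-\partial)^{-1}L^*(-z+\lambda),$$ $$\{\!\{L(z)_\lambda L(w)\}\!\}_K=i_z(z-w-\lambda)^{-1}\bigl(L(z)-L(w+\lambda)\bigr)\otimes 1+1\otimes i_z(z-w-\lambda-\partial)^{-1}\bigl(L(w)-L^*(-z+\lambda)\bigr),$$ where $i_z$ is expansion for large $|z|$, powers of $w+\lambda+\partial$ are expanded in non-negative powers of $\lambda+\partial$, and $\partial$ acts to the right. (This is the Adler–Gelfand–Dickey pair of double Poisson vertex algebra structures; that $H$ and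 $K$ satisfy skewsymmetry and the Jacobi identity is not part of the present statement.) Write $\int$ for the quotient map $\mathcal V\to\overline{\mathcal V}=\mathcal V/([\mathcal V,\mathcal V]+\partial\mathcal V)$; each bracket induces $\{\int f,g\}=\mathrm m\{\!\{f_\lambda g\}\!\}|_{\lambda=0}\in\mathcal V$ and $\{\int f,\int g\}=\int\{\int f,g\}\in\overline{\mathcal V}$, where $\mathrm m$ is multiplication. Then the two displayed identities hold for all coefficients in $z$ and $w$; there is a unique monic $L^{1/N}(\partial)\in\mathcal V((\partial^{-1}))$ of order $1$ with $(L^{1/N})^N=L$; and, with $h_k=\frac Nk\operatorname{res}_zL^{k/N}(z)$ for $k\ge1$ (where $\operatorname{res}_z$ is the coefficient of $z^{-1}$): (a) $\{\int h_\varepsilon,u\}_K=0$ for all $1\le\varepsilon\le N$ and all $u\in\mathcal V$. (b) $\{\int h_k,u\}_H=\{\int h_{k+N},u\}_K$ for all $k\ge1$ and all $u\in\mathcal V$ (Lenard–Magri recursion). (c) (Integrability of the non-commutative KP and Gelfand–Dickey hierarchies.) The Hamiltonian equations of the $\int h_k$ for $H$ are the Lax equations, $\{\int h_k,L(w)\}_H=[(L^{k/N})_+,L](w)$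 for $k\ge1$; the functionals $\int h_k$ are in involution, $\{\int h_k,\int h_l\}_H=\{\int h_k,\int h_l\}_K=0$ for all $k,l\ge1$; and the derivations $\{\int h_k,\cdot\}_H$ and $\{\int h_l,\cdot\}_H$ of $\mathcal V$ commute for all $k,l\ge1$. -/

import Mathlib

open scoped TensorProduct Polynomial

noncomputable section

namespace NCPoisson

/-! ### Differential algebras and operations on `(V ⊗ V)[λ]` -/

/-- A derivation of a (not necessarily commutative) associative algebra. -/
structure NCDerivation (F V : Type*) [Field F] [Ring V] [Algebra F V] extends V →ₗ[F] V where
  leibniz' : ∀ a b : V, toFun (a * b) = toFun a * b + a * toFun b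

section General

variable {F V : Type*} [Field F] [Ring V] [Algebra F V]

/-- The `j`-th power of a derivation, as a linear map. -/
def NCDerivation.iter (D : NCDerivation F V) (j : ℕ) : V →ₗ[F] V := D.toLinearMap ^ j

/-- `a ↦ (x ⊗ y ↦ a x ⊗ y)`: outer left multiplication. -/
def outL : V →ₗ[F] Module.End F (V ⊗[F] V) :=
  (LinearMap.rTensorHom V).comp (LinearMap.mul F V)

/-- `c ↦ (x ⊗ y ↦ x ⊗ y c)`: outer right multiplication. -/
def outR : V →ₗ[F] Module.End F (V ⊗[F] V) :=
  (LinearMap.lTensorHom V).comp (LinearMap.mul F V).flip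

/-- `a ↦ (x ⊗ y ↦ x ⊗ a y)`: the left product `a ⋆₁ (x ⊗ y)`. -/
def starL : V →ₗ[F] Module.End F (V ⊗[F] V) :=
  (LinearMap.lTensorHom V).comp (LinearMap.mul F V)

/-- `b ↦ (x ⊗ y ↦ x b ⊗ y)`: the right product `(x ⊗ y) ⋆₁ b`. -/
def starR : V →ₗ[F] Module.End F (V ⊗[F] V) :=
  (LinearMap.rTensorHom V).comp (LinearMap.mul F V).flip

/-- The derivation `∂ ⊗ 1 + 1 ⊗ ∂` of `V ⊗ V`. -/
def tensorD (D : NCDerivation F V) : Module.End F (V ⊗[F] V) :=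
  LinearMap.rTensor V D.toLinearMap + LinearMap.lTensor V D.toLinearMap

/-- The monomial map `p ↦ p λ^k`. -/
def lamMonomial (M : Type*) [Ring M] [Algebra F M] (k : ℕ) : M →ₗ[F] M[X] :=
  (Polynomial.monomial k).restrictScalars F

/-- Apply a linear map to every coefficient of a polynomial in `λ`. -/
def coeffwise {M N : Type*} [Ring M] [Algebra F M] [Ring N] [Algebra F N] (f : M →ₗ[F] N) :
    M[X] →ₗ[F] N[X] :=
  Polynomial.lsum fun k => (lamMonomial N k).comp f

/-- Multiplication by `λ`. -/
def lam : Module.End F (V ⊗[F] V)[X] :=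
  LinearMap.mulLeft F (Polynomial.X : (V ⊗[F] V)[X])

/-- The operator `λ + ∂` on `(V ⊗ V)[λ]`. -/
def lamD (D : NCDerivation F V) : Module.End F (V ⊗[F] V)[X] :=
  lam + coeffwise (tensorD D)

/-- `P(λ + ∂)_→ ⋆₁ b`: for `P = ∑ p_k λ^k` this is
`∑_k ∑_{j ≤ k} binom(k, j) (p_k ⋆₁ ∂^j b) λ^{k-j}`. -/
def arrowR (D : NCDerivation F V) (b : V) : Module.End F (V ⊗[F] V)[X] :=
  Polynomial.lsum fun k => ∑ j ∈ Finset.range (k + 1),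
    (k.choose j) • (lamMonomial (V ⊗[F] V) (k - j)).comp (starR (D.iter j b))

/-- `(e^{∂ ∂_λ} a) ⋆₁ P`: for `P = ∑ p_k λ^k` this is
`∑_k ∑_{j ≤ k} binom(k, j) ((∂^j a) ⋆₁ p_k) λ^{k-j}`. -/
def arrowL (D : NCDerivation F V) (a : V) : Module.End F (V ⊗[F] V)[X] :=
  Polynomial.lsum fun k => ∑ j ∈ Finset.range (k + 1),
    (k.choose j) • (lamMonomial (V ⊗[F] V) (k - j)).comp (starL (D.iter j a))

/-- A `2`-fold `λ`-bracket `{{a_λ b}} ∈ (V ⊗ V)[λ]` on the differential algebra `(V, ∂)`: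
a bilinear map with the sesquilinearity properties and the two Leibniz rules. -/
structure TwoFoldLambdaBracket (D : NCDerivation F V) where
  br : V →ₗ[F] V →ₗ[F] (V ⊗[F] V)[X]
  sesq_left : ∀ a b, br (D.toLinearMap a) b = -lam (F := F) (br a b)
  sesq_right : ∀ a b, br a (D.toLinearMap b) = lamD D (br a b)
  leibniz_left : ∀ a b c,
    br a (b * c) = coeffwise (outR (F := F) c) (br a b) + coeffwise (outL (F := F) b) (br a c)
  leibniz_right : ∀ a b c, br (a * b) c = arrowR D b (br a c) + arrowL D a (br b c)

/-! ### Elementary identities -/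

lemma iter_zero (D : NCDerivation F V) (b : V) : D.iter 0 b = b := rfl

lemma iter_succ (D : NCDerivation F V) (j : ℕ) (b : V) :
    D.iter (j + 1) b = D.iter j (D.toLinearMap b) := by
  simp [NCDerivation.iter, pow_succ]

lemma D_mul (D : NCDerivation F V) (a b : V) :
    D.toLinearMap (a * b) = D.toLinearMap a * b + a * D.toLinearMap b := D.leibniz' a b

lemma D_one (D : NCDerivation F V) : D.toLinearMap 1 = 0 := by
  have h := D_mul D 1 1
  simpa using h

@[simp] lemma outL_tmul (a x y : V) : outL (F := F) a (x ⊗ₜ y) = (a * x) ⊗ₜ y := by simp [outL]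
@[simp] lemma outR_tmul (a x y : V) : outR (F := F) a (x ⊗ₜ y) = x ⊗ₜ (y * a) := by simp [outR]
@[simp] lemma starL_tmul (a x y : V) : starL (F := F) a (x ⊗ₜ y) = x ⊗ₜ (a * y) := by simp [starL]
@[simp] lemma starR_tmul (a x y : V) : starR (F := F) a (x ⊗ₜ y) = (x * a) ⊗ₜ y := by simp [starR]
@[simp] lemma tensorD_tmul (D : NCDerivation F V) (x y : V) :
    tensorD D (x ⊗ₜ y) = D.toLinearMap x ⊗ₜ y + x ⊗ₜ D.toLinearMap y := by simp [tensorD]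

@[simp] lemma coeffwise_monomial {M N : Type*} [Ring M] [Algebra F M] [Ring N] [Algebra F N]
    (f : M →ₗ[F] N) (k : ℕ) (p : M) :
    coeffwise f (Polynomial.monomial k p) = Polynomial.monomial k (f p) := by
  simp [coeffwise, lamMonomial]

@[simp] lemma lam_monomial (k : ℕ) (p : V ⊗[F] V) :
    lam (F := F) (Polynomial.monomial k p) = Polynomial.monomial (k + 1) p := by
  simp [lam, Polynomial.X_mul_monomial]

lemma arrowR_monomial (D : NCDerivation F V) (b : V) (k : ℕ) (p : V ⊗[F] V) :
    arrowR D b (Polynomial.monomial k p) = ∑ j ∈ Finset.range (k + 1),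
      (k.choose j) • Polynomial.monomial (k - j) (starR (F := F) (D.iter j b) p) := by
  simp [arrowR, lamMonomial]

lemma arrowL_monomial (D : NCDerivation F V) (b : V) (k : ℕ) (p : V ⊗[F] V) :
    arrowL D b (Polynomial.monomial k p) = ∑ j ∈ Finset.range (k + 1),
      (k.choose j) • Polynomial.monomial (k - j) (starL (F := F) (D.iter j b) p) := by
  simp [arrowL, lamMonomial]

/-- Pascal recursion for the binomial shifts. -/
lemma shift_succ {M : Type*} [Ring M] (t : ℕ → M) (k : ℕ) :
    ∑ j ∈ Finset.range (k + 1 + 1), ((k + 1).choose j) • Polynomial.monomial (k + 1 - j) (t j)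
      = Polynomial.X * (∑ j ∈ Finset.range (k + 1),
          (k.choose j) • Polynomial.monomial (k - j) (t j))
        + ∑ j ∈ Finset.range (k + 1),
          (k.choose j) • Polynomial.monomial (k - j) (t (j + 1)) := by
  have h1 : ∀ j, ((k + 1).choose (j + 1)) • Polynomial.monomial (k + 1 - (j + 1)) (t (j + 1))
      = (k.choose j) • Polynomial.monomial (k - j) (t (j + 1))
        + (k.choose (j + 1)) • Polynomial.monomial (k - j) (t (j + 1)) := by
    intro j
    rw [Nat.choose_succ_succ, add_smul, Nat.add_sub_add_right]
  rw [Finset.sum_range_succ', Finset.sum_congr rfl fun j _ => h1 j, Finset.sum_add_distrib,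
    Finset.sum_range_succ (fun j => (k.choose (j + 1)) • Polynomial.monomial (k - j) (t (j + 1))),
    Finset.sum_range_succ' (fun j => (k.choose j) • Polynomial.monomial (k - j) (t j)), mul_add,
    Finset.mul_sum]
  have h2 : ∀ j ∈ Finset.range k,
      Polynomial.X * ((k.choose (j + 1)) • Polynomial.monomial (k - (j + 1)) (t (j + 1)))
      = (k.choose (j + 1)) • Polynomial.monomial (k - j) (t (j + 1)) := by
    intro j hj
    have : k - j = k - (j + 1) + 1 := by have := Finset.mem_range.1 hj; omega
    rw [mul_smul_comm, Polynomial.X_mul_monomial, this]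
  rw [Finset.sum_congr rfl h2]
  simp [Polynomial.X_mul_monomial]
  abel

lemma arrowR_lam (D : NCDerivation F V) (b : V) (P : (V ⊗[F] V)[X]) :
    arrowR D b (lam (F := F) P) = lam (F := F) (arrowR D b P) + arrowR D (D.toLinearMap b) P := by
  induction P using Polynomial.induction_on' with
  | add P Q hP hQ => simp only [map_add, hP, hQ]; abel
  | monomial k p =>
    rw [lam_monomial, arrowR_monomial, arrowR_monomial, arrowR_monomial, shift_succ]
    simp only [iter_succ]
    rfl

lemma arrowL_lam (D : NCDerivation F V) (b : V) (P : (V ⊗[F] V)[X]) :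
    arrowL D b (lam (F := F) P) = lam (F := F) (arrowL D b P) + arrowL D (D.toLinearMap b) P := by
  induction P using Polynomial.induction_on' with
  | add P Q hP hQ => simp only [map_add, hP, hQ]; abel
  | monomial k p =>
    rw [lam_monomial, arrowL_monomial, arrowL_monomial, arrowL_monomial, shift_succ]
    simp only [iter_succ]
    rfl

lemma arrowR_const (D : NCDerivation F V) (b : V) (p : V ⊗[F] V) :
    arrowR D b (Polynomial.monomial 0 p) = Polynomial.monomial 0 (starR (F := F) b p) := by
  rw [arrowR_monomial]; simp [iter_zero]

lemma arrowL_const (D : NCDerivation F V) (b : V) (p : V ⊗[F] V) :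
    arrowL D b (Polynomial.monomial 0 p) = Polynomial.monomial 0 (starL (F := F) b p) := by
  rw [arrowL_monomial]; simp [iter_zero]

lemma coeffwise_lam (f : Module.End F (V ⊗[F] V)) (P : (V ⊗[F] V)[X]) :
    coeffwise f (lam (F := F) P) = lam (F := F) (coeffwise f P) := by
  induction P using Polynomial.induction_on' with
  | add P Q hP hQ => simp only [map_add, hP, hQ]
  | monomial k p => simp

/-- Induction on polynomials: constants, sums, multiplication by `λ`. -/
lemma poly_ind {C : (V ⊗[F] V)[X] → Prop}
    (hadd : ∀ P Q, C P → C Q → C (P + Q)) (hzero : C 0)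
    (hconst : ∀ x y : V, C (Polynomial.monomial 0 (x ⊗ₜ y)))
    (hlam : ∀ P, C P → C (lam (F := F) P)) (P : (V ⊗[F] V)[X]) : C P := by
  induction P using Polynomial.induction_on' with
  | add P Q hP hQ => exact hadd _ _ hP hQ
  | monomial k p =>
    induction k with
    | zero =>
      induction p using TensorProduct.induction_on with
      | zero => simpa using hzero
      | tmul x y => exact hconst x y
      | add p q hp hq => rw [map_add]; exact hadd _ _ hp hq
    | succ k ih => rw [← lam_monomial (F := F)]; exact hlam _ ih

lemma arrowR_add (D : NCDerivation F V) (a b : V) : arrowR D (a + b) = arrowR D a + arrowR D b := by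
  ext1 P
  induction P using Polynomial.induction_on' with
  | add P Q hP hQ => simp only [map_add, hP, hQ]
  | monomial k p => simp [arrowR_monomial, Finset.sum_add_distrib]

lemma arrowL_add (D : NCDerivation F V) (a b : V) : arrowL D (a + b) = arrowL D a + arrowL D b := by
  ext1 P
  induction P using Polynomial.induction_on' with
  | add P Q hP hQ => simp only [map_add, hP, hQ]
  | monomial k p => simp [arrowL_monomial, Finset.sum_add_distrib]

lemma arrowR_smul (D : NCDerivation F V) (c : F) (b : V) : arrowR D (c • b) = c • arrowR D b := by
  ext1 P
  induction P using Polynomial.induction_on' with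
  | add P Q hP hQ => simp only [map_add, hP, hQ]
  | monomial k p =>
    simp only [arrowR_monomial, map_smul, LinearMap.smul_apply, Finset.smul_sum]
    exact Finset.sum_congr rfl fun j _ => by rw [← Polynomial.smul_monomial, smul_comm]

lemma arrowL_smul (D : NCDerivation F V) (c : F) (b : V) : arrowL D (c • b) = c • arrowL D b := by
  ext1 P
  induction P using Polynomial.induction_on' with
  | add P Q hP hQ => simp only [map_add, hP, hQ]
  | monomial k p =>
    simp only [arrowL_monomial, map_smul, LinearMap.smul_apply, Finset.smul_sum]
    exact Finset.sum_congr rfl fun j _ => by rw [← Polynomial.smul_monomial, smul_comm]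

/-- `arrowR` as a linear map in `b`. -/
def arrowRHom (D : NCDerivation F V) : V →ₗ[F] Module.End F (V ⊗[F] V)[X] where
  toFun := arrowR D
  map_add' := arrowR_add D
  map_smul' := arrowR_smul D

/-- `arrowL` as a linear map in `a`. -/
def arrowLHom (D : NCDerivation F V) : V →ₗ[F] Module.End F (V ⊗[F] V)[X] where
  toFun := arrowL D
  map_add' := arrowL_add D
  map_smul' := arrowL_smul D

lemma arrowR_mul (D : NCDerivation F V) (a b : V) (P : (V ⊗[F] V)[X]) :
    arrowR D (a * b) P = arrowR D b (arrowR D a P) := by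
  revert a b
  induction P using poly_ind (F := F) with
  | hadd P Q hP hQ => intro a b; simp only [map_add, hP, hQ]
  | hzero => simp
  | hconst x y => intro a b; simp only [arrowR_const, starR_tmul, mul_assoc]
  | hlam P hP =>
    intro a b
    simp only [arrowR_lam, map_add, hP, D_mul, arrowR_add, LinearMap.add_apply]
    abel

lemma arrowL_mul (D : NCDerivation F V) (a b : V) (P : (V ⊗[F] V)[X]) :
    arrowL D (a * b) P = arrowL D a (arrowL D b P) := by
  revert a b
  induction P using poly_ind (F := F) with
  | hadd P Q hP hQ => intro a b; simp only [map_add, hP, hQ]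
  | hzero => simp
  | hconst x y => intro a b; simp only [arrowL_const, starL_tmul, mul_assoc]
  | hlam P hP =>
    intro a b
    simp only [arrowL_lam, map_add, hP, D_mul, arrowL_add, LinearMap.add_apply]
    abel

lemma arrowL_arrowR (D : NCDerivation F V) (a b : V) (P : (V ⊗[F] V)[X]) :
    arrowL D a (arrowR D b P) = arrowR D b (arrowL D a P) := by
  revert a b
  induction P using poly_ind (F := F) with
  | hadd P Q hP hQ => intro a b; simp only [map_add, hP, hQ]
  | hzero => simp
  | hconst x y => intro a b; simp only [arrowL_const, arrowR_const, starL_tmul, starR_tmul]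
  | hlam P hP =>
    intro a b
    simp only [arrowL_lam, arrowR_lam, map_add, hP]
    abel

lemma arrowR_one (D : NCDerivation F V) (P : (V ⊗[F] V)[X]) : arrowR D 1 P = P := by
  induction P using poly_ind (F := F) with
  | hadd P Q hP hQ => simp only [map_add, hP, hQ]
  | hzero => simp
  | hconst x y => simp only [arrowR_const, starR_tmul, mul_one]
  | hlam P hP =>
    have h0 : arrowR D 0 = 0 := (arrowRHom D).map_zero
    rw [arrowR_lam, hP, D_one, h0]; simp

lemma arrowL_one (D : NCDerivation F V) (P : (V ⊗[F] V)[X]) : arrowL D 1 P = P := by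
  induction P using poly_ind (F := F) with
  | hadd P Q hP hQ => simp only [map_add, hP, hQ]
  | hzero => simp
  | hconst x y => simp only [arrowL_const, starL_tmul, one_mul]
  | hlam P hP =>
    have h0 : arrowL D 0 = 0 := (arrowLHom D).map_zero
    rw [arrowL_lam, hP, D_one, h0]; simp

lemma lamD_lam (D : NCDerivation F V) (P : (V ⊗[F] V)[X]) :
    lamD D (lam (F := F) P) = lam (F := F) (lamD D P) := by
  simp [lamD, coeffwise_lam]

lemma lamD_arrowR (D : NCDerivation F V) (b : V) (P : (V ⊗[F] V)[X]) :
    lamD D (arrowR D b P) = arrowR D b (lamD D P) := by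
  revert b
  induction P using poly_ind (F := F) with
  | hadd P Q hP hQ => intro b; simp only [map_add, hP, hQ]
  | hzero => simp
  | hconst x y =>
    intro b
    simp only [lamD, LinearMap.add_apply, map_add, arrowR_lam, arrowR_const, coeffwise_monomial,
      starR_tmul, tensorD_tmul, D_mul, TensorProduct.add_tmul]
    abel
  | hlam P hP =>
    intro b
    rw [arrowR_lam, map_add, lamD_lam, lamD_lam, arrowR_lam, hP, hP]

lemma lamD_arrowL (D : NCDerivation F V) (b : V) (P : (V ⊗[F] V)[X]) :
    lamD D (arrowL D b P) = arrowL D b (lamD D P) := by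
  revert b
  induction P using poly_ind (F := F) with
  | hadd P Q hP hQ => intro b; simp only [map_add, hP, hQ]
  | hzero => simp
  | hconst x y =>
    intro b
    simp only [lamD, LinearMap.add_apply, map_add, arrowL_lam, arrowL_const, coeffwise_monomial,
      starL_tmul, tensorD_tmul, D_mul, TensorProduct.tmul_add]
    abel
  | hlam P hP =>
    intro b
    rw [arrowL_lam, map_add, lamD_lam, lamD_lam, arrowL_lam, hP, hP]

lemma coeffwise_add (f g : Module.End F (V ⊗[F] V)) :
    coeffwise (f + g) = coeffwise f + coeffwise g := by
  ext1 P
  induction P using Polynomial.induction_on' with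
  | add P Q hP hQ => rw [map_add, hP, hQ, map_add]
  | monomial k p => rw [LinearMap.add_apply, coeffwise_monomial, coeffwise_monomial,
      coeffwise_monomial, LinearMap.add_apply, map_add]

lemma coeffwise_smul (c : F) (f : Module.End F (V ⊗[F] V)) :
    coeffwise (c • f) = c • coeffwise f := by
  ext1 P
  induction P using Polynomial.induction_on' with
  | add P Q hP hQ => rw [map_add, hP, hQ, map_add]
  | monomial k p => rw [LinearMap.smul_apply, coeffwise_monomial,
      coeffwise_monomial, LinearMap.smul_apply, Polynomial.smul_monomial]

/-- Outer right multiplication on `(V ⊗ V)[λ]`. -/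
def outRHom : V →ₗ[F] Module.End F (V ⊗[F] V)[X] where
  toFun c := coeffwise (outR (F := F) c)
  map_add' a b := by rw [map_add, coeffwise_add]
  map_smul' c a := by rw [map_smul, coeffwise_smul]; rfl

/-- Outer left multiplication on `(V ⊗ V)[λ]`. -/
def outLHom : V →ₗ[F] Module.End F (V ⊗[F] V)[X] where
  toFun c := coeffwise (outL (F := F) c)
  map_add' a b := by rw [map_add, coeffwise_add]
  map_smul' c a := by rw [map_smul, coeffwise_smul]; rfl

lemma outRHom_const (c x y : V) : outRHom (F := F) c (Polynomial.monomial 0 (x ⊗ₜ y))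
    = Polynomial.monomial 0 (x ⊗ₜ (y * c)) := by
  change coeffwise (outR (F := F) c) _ = _
  rw [coeffwise_monomial, outR_tmul]

lemma outLHom_const (c x y : V) : outLHom (F := F) c (Polynomial.monomial 0 (x ⊗ₜ y))
    = Polynomial.monomial 0 ((c * x) ⊗ₜ y) := by
  change coeffwise (outL (F := F) c) _ = _
  rw [coeffwise_monomial, outL_tmul]

lemma outRHom_lam (c : V) (P : (V ⊗[F] V)[X]) :
    outRHom (F := F) c (lam (F := F) P) = lam (F := F) (outRHom (F := F) c P) :=
  coeffwise_lam _ P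

lemma outLHom_lam (c : V) (P : (V ⊗[F] V)[X]) :
    outLHom (F := F) c (lam (F := F) P) = lam (F := F) (outLHom (F := F) c P) :=
  coeffwise_lam _ P

lemma outRHom_mul (a b : V) (P : (V ⊗[F] V)[X]) :
    outRHom (F := F) (a * b) P = outRHom (F := F) b (outRHom (F := F) a P) := by
  induction P using poly_ind (F := F) with
  | hadd P Q hP hQ => simp only [map_add, hP, hQ]
  | hzero => simp
  | hconst x y => simp only [outRHom_const, mul_assoc]
  | hlam P hP => simp only [outRHom_lam, hP]

lemma outLHom_mul (a b : V) (P : (V ⊗[F] V)[X]) :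
    outLHom (F := F) (a * b) P = outLHom (F := F) a (outLHom (F := F) b P) := by
  induction P using poly_ind (F := F) with
  | hadd P Q hP hQ => simp only [map_add, hP, hQ]
  | hzero => simp
  | hconst x y => simp only [outLHom_const, mul_assoc]
  | hlam P hP => simp only [outLHom_lam, hP]

lemma outRHom_one (P : (V ⊗[F] V)[X]) : outRHom (F := F) 1 P = P := by
  induction P using poly_ind (F := F) with
  | hadd P Q hP hQ => simp only [map_add, hP, hQ]
  | hzero => simp
  | hconst x y => simp only [outRHom_const, mul_one]
  | hlam P hP => simp only [outRHom_lam, hP]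

lemma outLHom_one (P : (V ⊗[F] V)[X]) : outLHom (F := F) 1 P = P := by
  induction P using poly_ind (F := F) with
  | hadd P Q hP hQ => simp only [map_add, hP, hQ]
  | hzero => simp
  | hconst x y => simp only [outLHom_const, one_mul]
  | hlam P hP => simp only [outLHom_lam, hP]

lemma outL_outR (a b : V) (P : (V ⊗[F] V)[X]) :
    outLHom (F := F) a (outRHom (F := F) b P) = outRHom (F := F) b (outLHom (F := F) a P) := by
  induction P using poly_ind (F := F) with
  | hadd P Q hP hQ => simp only [map_add, hP, hQ]
  | hzero => simp
  | hconst x y => simp only [outLHom_const, outRHom_const]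
  | hlam P hP => simp only [outLHom_lam, outRHom_lam, hP]

lemma arrowR_outR (D : NCDerivation F V) (a b : V) (P : (V ⊗[F] V)[X]) :
    arrowR D a (outRHom (F := F) b P) = outRHom (F := F) b (arrowR D a P) := by
  revert a
  induction P using poly_ind (F := F) with
  | hadd P Q hP hQ => intro a; simp only [map_add, hP, hQ]
  | hzero => simp
  | hconst x y => intro a; simp only [outRHom_const, arrowR_const, starR_tmul]
  | hlam P hP => intro a; simp only [arrowR_lam, outRHom_lam, hP, map_add]

lemma arrowR_outL (D : NCDerivation F V) (a b : V) (P : (V ⊗[F] V)[X]) :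
    arrowR D a (outLHom (F := F) b P) = outLHom (F := F) b (arrowR D a P) := by
  revert a
  induction P using poly_ind (F := F) with
  | hadd P Q hP hQ => intro a; simp only [map_add, hP, hQ]
  | hzero => simp
  | hconst x y => intro a; simp only [outLHom_const, arrowR_const, starR_tmul, mul_assoc]
  | hlam P hP => intro a; simp only [arrowR_lam, outLHom_lam, hP, map_add]

lemma arrowL_outR (D : NCDerivation F V) (a b : V) (P : (V ⊗[F] V)[X]) :
    arrowL D a (outRHom (F := F) b P) = outRHom (F := F) b (arrowL D a P) := by
  revert a
  induction P using poly_ind (F := F) with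
  | hadd P Q hP hQ => intro a; simp only [map_add, hP, hQ]
  | hzero => simp
  | hconst x y => intro a; simp only [outRHom_const, arrowL_const, starL_tmul, mul_assoc]
  | hlam P hP => intro a; simp only [arrowL_lam, outRHom_lam, hP, map_add]

lemma arrowL_outL (D : NCDerivation F V) (a b : V) (P : (V ⊗[F] V)[X]) :
    arrowL D a (outLHom (F := F) b P) = outLHom (F := F) b (arrowL D a P) := by
  revert a
  induction P using poly_ind (F := F) with
  | hadd P Q hP hQ => intro a; simp only [map_add, hP, hQ]
  | hzero => simp
  | hconst x y => intro a; simp only [outLHom_const, arrowL_const, starL_tmul]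
  | hlam P hP => intro a; simp only [arrowL_lam, outLHom_lam, hP, map_add]

lemma lamD_outR (D : NCDerivation F V) (b : V) (P : (V ⊗[F] V)[X]) :
    lamD D (outRHom (F := F) b P)
      = outRHom (F := F) b (lamD D P) + outRHom (F := F) (D.toLinearMap b) P := by
  induction P using poly_ind (F := F) with
  | hadd P Q hP hQ => simp only [map_add, hP, hQ]; abel
  | hzero => simp
  | hconst x y =>
    simp only [lamD, LinearMap.add_apply, map_add, outRHom_lam, outRHom_const, coeffwise_monomial,
      tensorD_tmul, D_mul, TensorProduct.tmul_add]
    abel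
  | hlam P hP => simp only [lamD_lam, outRHom_lam, hP, map_add]

lemma lamD_outL (D : NCDerivation F V) (b : V) (P : (V ⊗[F] V)[X]) :
    lamD D (outLHom (F := F) b P)
      = outLHom (F := F) b (lamD D P) + outLHom (F := F) (D.toLinearMap b) P := by
  induction P using poly_ind (F := F) with
  | hadd P Q hP hQ => simp only [map_add, hP, hQ]; abel
  | hzero => simp
  | hconst x y =>
    simp only [lamD, LinearMap.add_apply, map_add, outLHom_lam, outLHom_const, coeffwise_monomial,
      tensorD_tmul, D_mul, TensorProduct.add_tmul]
    abel
  | hlam P hP => simp only [lamD_lam, outLHom_lam, hP, map_add]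

end General

/-! ### Derivations of free algebras with values in a bimodule -/

section Free

variable {F X M : Type*} [Field F] [AddCommGroup M] [Module F M]

/-- A pair of commuting left and right actions of `A` on `M`, i.e. an `A`-bimodule. -/
structure BimodActions (F A M : Type*) [Field F] [Ring A] [Algebra F A] [AddCommGroup M]
    [Module F M] where
  l : A →ₗ[F] Module.End F M
  r : A →ₗ[F] Module.End F M
  l_one : ∀ m, l 1 m = m
  r_one : ∀ m, r 1 m = m
  l_mul : ∀ a b m, l (a * b) m = l a (l b m)
  r_mul : ∀ a b m, r (a * b) m = r b (r a m)
  comm : ∀ a b m, l a (r b m) = r b (l a m)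

/-- The block-triangular representation whose corner is the derivation with values `d`
on the generators. -/
def freeDerAux (B : BimodActions F (FreeAlgebra F X) M) (d : X → M) :
    FreeAlgebra F X →ₐ[F] Module.End F (FreeAlgebra F X × M) :=
  FreeAlgebra.lift F fun x =>
    LinearMap.prod
      ((LinearMap.mulLeft F (FreeAlgebra.ι F x)).comp (LinearMap.fst F _ _))
      ((B.l (FreeAlgebra.ι F x)).comp (LinearMap.snd F _ _)
        + (B.r.flip (d x)).comp (LinearMap.fst F _ _))

/-- The unique derivation `FreeAlgebra F X → M` with the given values on the generators. -/
def freeDer (B : BimodActions F (FreeAlgebra F X) M) (d : X → M) : FreeAlgebra F X →ₗ[F] M where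
  toFun f := (freeDerAux B d f (1, 0)).2
  map_add' f g := by simp
  map_smul' c f := by simp

lemma freeDerAux_apply (B : BimodActions F (FreeAlgebra F X) M) (d : X → M)
    (f : FreeAlgebra F X) : ∀ (v : FreeAlgebra F X) (m : M),
    freeDerAux B d f (v, m) = (f * v, B.l f m + B.r v (freeDer B d f)) := by
  induction f using FreeAlgebra.induction with
  | grade0 c =>
    intro v m
    have h1 : freeDer B d (algebraMap F _ c) = 0 := by
      simp [freeDer, Algebra.algebraMap_eq_smul_one]
    have h2 : B.l (algebraMap F _ c) m = c • m := by
      rw [Algebra.algebraMap_eq_smul_one, map_smul, LinearMap.smul_apply, B.l_one]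
    rw [h1, h2, AlgHom.commutes, Module.algebraMap_end_apply]
    simp [Algebra.algebraMap_eq_smul_one]
  | grade1 x =>
    intro v m
    simp [freeDer, freeDerAux, B.r_one]
  | mul f g hf hg =>
    intro v m
    have h : freeDer B d (f * g) = B.l f (freeDer B d g) + B.r g (freeDer B d f) := by
      change (freeDerAux B d (f * g) (1, 0)).2 = _
      rw [map_mul, Module.End.mul_apply, hg, hf]
      simp [B.r_one]
    rw [map_mul, Module.End.mul_apply, hg, hf, h]
    simp only [map_add, B.l_mul, B.r_mul, B.comm, mul_assoc, add_assoc]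
  | add f g hf hg =>
    intro v m
    rw [map_add, LinearMap.add_apply, hf, hg]
    simp only [map_add, LinearMap.add_apply, Prod.mk_add_mk, add_mul]
    congr 1
    abel

lemma freeDer_ι (B : BimodActions F (FreeAlgebra F X) M) (d : X → M) (x : X) :
    freeDer B d (FreeAlgebra.ι F x) = d x := by
  simp [freeDer, freeDerAux, B.r_one]

lemma freeDer_mul (B : BimodActions F (FreeAlgebra F X) M) (d : X → M) (f g : FreeAlgebra F X) :
    freeDer B d (f * g) = B.r g (freeDer B d f) + B.l f (freeDer B d g) := by
  change (freeDerAux B d (f * g) (1, 0)).2 = _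
  rw [map_mul, Module.End.mul_apply, freeDerAux_apply, freeDerAux_apply]
  simp [B.r_one, add_comm]

lemma freeDer_algebraMap (B : BimodActions F (FreeAlgebra F X) M) (d : X → M) (c : F) :
    freeDer B d (algebraMap F _ c) = 0 := by
  simp [freeDer, Algebra.algebraMap_eq_smul_one]

lemma freeDer_add (B : BimodActions F (FreeAlgebra F X) M) (d e : X → M) (f : FreeAlgebra F X) :
    freeDer B (fun x => d x + e x) f = freeDer B d f + freeDer B e f := by
  induction f using FreeAlgebra.induction with
  | grade0 c => simp [freeDer_algebraMap]
  | grade1 x => simp only [freeDer_ι]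
  | mul f g hf hg => simp only [freeDer_mul, hf, hg, map_add]; abel
  | add f g hf hg => simp only [map_add, hf, hg]; abel

lemma freeDer_smul (B : BimodActions F (FreeAlgebra F X) M) (c : F) (d : X → M)
    (f : FreeAlgebra F X) : freeDer B (fun x => c • d x) f = c • freeDer B d f := by
  induction f using FreeAlgebra.induction with
  | grade0 c => simp [freeDer_algebraMap]
  | grade1 x => simp only [freeDer_ι]
  | mul f g hf hg => simp only [freeDer_mul, hf, hg, map_smul, smul_add]
  | add f g hf hg => simp only [map_add, hf, hg, smul_add]

end Free

/-! ### Non-commutative differential polynomials -/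

/-- The algebra `R_I = F⟨u_i^{(n)} | i ∈ I, n ≥ 0⟩`. -/
abbrev DiffPoly (F : Type*) [Field F] (I : Set ℤ) : Type _ := FreeAlgebra F (I × ℕ)

section DiffPolySection

variable (F : Type*) [Field F] (I : Set ℤ)

/-- The generator `u_i^{(n)}`. -/
def gen (i : I) (n : ℕ) : DiffPoly F I := FreeAlgebra.ι F (i, n)

/-- `R_I` as a bimodule over itself. -/
def regularActions : BimodActions F (DiffPoly F I) (DiffPoly F I) where
  l := LinearMap.mul F _
  r := (LinearMap.mul F _).flip
  l_one := by simp
  r_one := by simp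
  l_mul := by simp [mul_assoc]
  r_mul := by simp [mul_assoc]
  comm := by simp [mul_assoc]

/-- The derivation `∂` of `R_I` with `∂ u_i^{(n)} = u_i^{(n+1)}`. -/
def del : NCDerivation F (DiffPoly F I) where
  toLinearMap := freeDer (regularActions F I) fun x => gen F I x.1 (x.2 + 1)
  leibniz' a b := freeDer_mul _ _ a b

lemma del_gen (i : I) (n : ℕ) : (del F I).toLinearMap (gen F I i n) = gen F I i (n + 1) :=
  freeDer_ι _ _ _

lemma del_algebraMap (c : F) : (del F I).toLinearMap (algebraMap F _ c) = 0 :=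
  freeDer_algebraMap _ _ _

variable {F I}

/-- The outer bimodule structure on `(V ⊗ V)[λ]`. -/
def outerActions : BimodActions F (DiffPoly F I) (DiffPoly F I ⊗[F] DiffPoly F I)[X] where
  l := outLHom
  r := outRHom
  l_one := outLHom_one
  r_one := outRHom_one
  l_mul := outLHom_mul
  r_mul := outRHom_mul
  comm := outL_outR

/-- The bimodule structure on `(V ⊗ V)[λ]` that governs the right Leibniz rule. -/
def innerActions : BimodActions F (DiffPoly F I) (DiffPoly F I ⊗[F] DiffPoly F I)[X] where
  l := arrowLHom (del F I)
  r := arrowRHom (del F I)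
  l_one := arrowL_one _
  r_one := arrowR_one _
  l_mul := arrowL_mul _
  r_mul := arrowR_mul _
  comm := arrowL_arrowR _

variable (h : I → I → (DiffPoly F I ⊗[F] DiffPoly F I)[X])

/-- The derivation `g ↦ {{u_i^{(m)} _λ g}}`, where `x = (i, m)`: its value on `u_j^{(n)}` is
`(-λ)^m (λ + ∂)^n {{u_i _λ u_j}}`. -/
def brGen (x : I × ℕ) : DiffPoly F I →ₗ[F] (DiffPoly F I ⊗[F] DiffPoly F I)[X] :=
  freeDer outerActions fun y => ((-lam) ^ x.2) (((lamD (del F I)) ^ y.2) (h x.1 y.1))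

/-- The bilinear extension. -/
def brExt : DiffPoly F I →ₗ[F] DiffPoly F I →ₗ[F] (DiffPoly F I ⊗[F] DiffPoly F I)[X] :=
  LinearMap.mk₂ F (fun f g => freeDer innerActions (fun x => brGen h x g) f)
    (fun f f' g => map_add _ _ _)
    (fun c f g => map_smul _ _ _)
    (fun f g g' => by simp only [map_add]; exact freeDer_add _ _ _ _)
    (fun c f g => by simp only [map_smul]; exact freeDer_smul _ _ _ _)

lemma brExt_apply (f g : DiffPoly F I) :
    brExt h f g = freeDer innerActions (fun x => brGen h x g) f := rfl

lemma innerActions_l (a : DiffPoly F I) (P : (DiffPoly F I ⊗[F] DiffPoly F I)[X]) :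
    (innerActions (F := F) (I := I)).l a P = arrowL (del F I) a P := rfl

lemma innerActions_r (a : DiffPoly F I) (P : (DiffPoly F I ⊗[F] DiffPoly F I)[X]) :
    (innerActions (F := F) (I := I)).r a P = arrowR (del F I) a P := rfl

lemma brExt_mul_left (f f' g : DiffPoly F I) :
    brExt h (f * f') g
      = arrowR (del F I) f' (brExt h f g) + arrowL (del F I) f (brExt h f' g) := by
  rw [brExt_apply, brExt_apply, brExt_apply, freeDer_mul, innerActions_l, innerActions_r]

lemma brExt_ι (x : I × ℕ) (g : DiffPoly F I) :
    brExt h (FreeAlgebra.ι F x) g = brGen h x g := by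
  rw [brExt_apply, freeDer_ι]

lemma brExt_algebraMap (c : F) (g : DiffPoly F I) : brExt h (algebraMap F _ c) g = 0 := by
  rw [brExt_apply, freeDer_algebraMap]

lemma brGen_mul (x : I × ℕ) (g g' : DiffPoly F I) :
    brGen h x (g * g')
      = outRHom (F := F) g' (brGen h x g) + outLHom (F := F) g (brGen h x g') :=
  freeDer_mul _ _ _ _

lemma brExt_mul_right (f g g' : DiffPoly F I) :
    brExt h f (g * g')
      = outRHom (F := F) g' (brExt h f g) + outLHom (F := F) g (brExt h f g') := by
  induction f using FreeAlgebra.induction with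
  | grade0 c => simp [brExt_algebraMap]
  | grade1 x => simp only [brExt_ι, brGen_mul]
  | mul f f' hf hf' =>
    simp only [brExt_mul_left, hf, hf', map_add, arrowR_outR, arrowR_outL, arrowL_outR,
      arrowL_outL]
    abel
  | add f f' hf hf' => simp only [map_add, LinearMap.add_apply, hf, hf']; abel

lemma lamD_neg_lam_pow (m : ℕ) (P : (DiffPoly F I ⊗[F] DiffPoly F I)[X]) :
    lamD (del F I) (((-lam) ^ m) P) = ((-lam) ^ m) (lamD (del F I) P) := by
  induction m with
  | zero => rfl
  | succ m ih =>
    rw [pow_succ', Module.End.mul_apply, Module.End.mul_apply, LinearMap.neg_apply, map_neg,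
      lamD_lam, ih, LinearMap.neg_apply]

lemma brGen_del (x : I × ℕ) (g : DiffPoly F I) :
    brGen h x ((del F I).toLinearMap g) = lamD (del F I) (brGen h x g) := by
  induction g using FreeAlgebra.induction with
  | grade0 c => rw [del_algebraMap, map_zero, brGen, freeDer_algebraMap, map_zero]
  | grade1 y =>
    have h1 := del_gen F I y.1 y.2
    simp only [gen, Prod.mk.eta] at h1
    rw [h1, brGen, freeDer_ι, freeDer_ι, lamD_neg_lam_pow, pow_succ', Module.End.mul_apply]
  | mul g g' hg hg' =>
    rw [D_mul, map_add, brGen_mul, brGen_mul, brGen_mul, hg, hg', map_add, lamD_outR, lamD_outL]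
    abel
  | add g g' hg hg' => simp only [map_add, hg, hg']

lemma brExt_del_right (f g : DiffPoly F I) :
    brExt h f ((del F I).toLinearMap g) = lamD (del F I) (brExt h f g) := by
  induction f using FreeAlgebra.induction with
  | grade0 c => simp [brExt_algebraMap]
  | grade1 x => rw [brExt_ι, brExt_ι, brGen_del]
  | mul f f' hf hf' =>
    rw [brExt_mul_left, brExt_mul_left, hf, hf', map_add, lamD_arrowR, lamD_arrowL]
  | add f f' hf hf' => simp only [map_add, LinearMap.add_apply, hf, hf']

lemma outRHom_neg_lam (c : DiffPoly F I) (P : (DiffPoly F I ⊗[F] DiffPoly F I)[X]) :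
    outRHom (F := F) c (-lam (F := F) P) = -lam (F := F) (outRHom (F := F) c P) := by
  rw [map_neg, outRHom_lam]

lemma outLHom_neg_lam (c : DiffPoly F I) (P : (DiffPoly F I ⊗[F] DiffPoly F I)[X]) :
    outLHom (F := F) c (-lam (F := F) P) = -lam (F := F) (outLHom (F := F) c P) := by
  rw [map_neg, outLHom_lam]

lemma brGen_succ (i : I) (m : ℕ) (g : DiffPoly F I) :
    brGen h (i, m + 1) g = -lam (F := F) (brGen h (i, m) g) := by
  induction g using FreeAlgebra.induction with
  | grade0 c => simp [brGen, freeDer_algebraMap]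
  | grade1 y =>
    rw [brGen, freeDer_ι, brGen, freeDer_ι, pow_succ', Module.End.mul_apply,
      LinearMap.neg_apply]
  | mul g g' hg hg' =>
    rw [brGen_mul, brGen_mul, hg, hg', outRHom_neg_lam, outLHom_neg_lam, map_add, neg_add]
  | add g g' hg hg' => simp only [map_add, hg, hg', neg_add]

lemma brExt_del_left (f g : DiffPoly F I) :
    brExt h ((del F I).toLinearMap f) g = -lam (F := F) (brExt h f g) := by
  induction f using FreeAlgebra.induction with
  | grade0 c => rw [del_algebraMap, map_zero, brExt_algebraMap]; simp
  | grade1 x =>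
    have h1 := del_gen F I x.1 x.2
    simp only [gen, Prod.mk.eta] at h1
    rw [h1, brExt_ι, brExt_ι, brGen_succ]
  | mul f f' hf hf' =>
    rw [D_mul, map_add, LinearMap.add_apply, brExt_mul_left, brExt_mul_left, brExt_mul_left, hf,
      hf', map_add, map_neg, map_neg, arrowR_lam, arrowL_lam]
    abel
  | add f f' hf hf' => simp only [map_add, LinearMap.add_apply, hf, hf', neg_add]

/-- The `2`-fold `λ`-bracket on `R_I` with `{{u_i _λ u_j}} = h i j`. -/
def bracketOfGenerators : TwoFoldLambdaBracket (del F I) where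
  br := brExt h
  sesq_left := brExt_del_left h
  sesq_right := brExt_del_right h
  leibniz_left := fun a b c => brExt_mul_right h a b c
  leibniz_right := brExt_mul_left h

lemma bracketOfGenerators_gen (i j : I) :
    (bracketOfGenerators h).br (gen F I i 0) (gen F I j 0) = h i j := by
  change brExt h (FreeAlgebra.ι F (i, 0)) (FreeAlgebra.ι F (j, 0)) = _
  rw [brExt_ι, brGen, freeDer_ι]
  rfl

/-- A `2`-fold `λ`-bracket on `R_I` is determined by its values on the `u_i`. -/
lemma bracket_unique (B C : TwoFoldLambdaBracket (del F I))
    (hBC : ∀ i j : I, B.br (gen F I i 0) (gen F I j 0) = C.br (gen F I i 0) (gen F I j 0)) :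
    B.br = C.br := by
  have arr0R : arrowR (del F I) 0 = 0 := (arrowRHom (del F I)).map_zero
  have oneR : ∀ (E : TwoFoldLambdaBracket (del F I)) (f : DiffPoly F I), E.br f 1 = 0 := by
    intro E f
    have h1 := E.leibniz_left f 1 1
    have h2 : ∀ P : (DiffPoly F I ⊗[F] DiffPoly F I)[X], coeffwise (outR (F := F) 1) P = P :=
      outRHom_one
    have h3 : ∀ P : (DiffPoly F I ⊗[F] DiffPoly F I)[X], coeffwise (outL (F := F) 1) P = P :=
      outLHom_one
    rw [h2, h3, one_mul] at h1
    exact left_eq_add.1 h1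
  have oneL : ∀ (E : TwoFoldLambdaBracket (del F I)) (f : DiffPoly F I), E.br 1 f = 0 := by
    intro E f
    have h1 := E.leibniz_right 1 1 f
    rw [arrowR_one, arrowL_one, one_mul] at h1
    exact left_eq_add.1 h1
  have hg : ∀ (i j : I) (n : ℕ),
      B.br (gen F I i 0) (gen F I j n) = C.br (gen F I i 0) (gen F I j n) := by
    intro i j n
    induction n with
    | zero => exact hBC i j
    | succ n ih => rw [← del_gen, B.sesq_right, C.sesq_right, ih]
  have hgg : ∀ (i j : I) (m n : ℕ),
      B.br (gen F I i m) (gen F I j n) = C.br (gen F I i m) (gen F I j n) := by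
    intro i j m n
    induction m with
    | zero => exact hg i j n
    | succ m ih => rw [← del_gen, B.sesq_left, C.sesq_left, ih]
  have hgf : ∀ (i : I) (m : ℕ) (g : DiffPoly F I),
      B.br (gen F I i m) g = C.br (gen F I i m) g := by
    intro i m g
    induction g using FreeAlgebra.induction with
    | grade0 c => rw [Algebra.algebraMap_eq_smul_one, map_smul, map_smul, oneR, oneR]
    | grade1 y => exact hgg i y.1 m y.2
    | mul g g' hg hg' => rw [B.leibniz_left, C.leibniz_left, hg, hg']
    | add g g' hg hg' => rw [map_add, map_add, hg, hg']
  refine LinearMap.ext fun f => LinearMap.ext fun g => ?_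
  induction f using FreeAlgebra.induction with
  | grade0 c =>
    rw [Algebra.algebraMap_eq_smul_one, map_smul, map_smul, LinearMap.smul_apply,
      LinearMap.smul_apply, oneL, oneL]
  | grade1 y => exact hgf y.1 y.2 g
  | mul f f' hf hf' => rw [B.leibniz_right, C.leibniz_right, hf, hf']
  | add f f' hf hf' => rw [map_add, map_add, LinearMap.add_apply, LinearMap.add_apply, hf, hf']

end DiffPolySection

/-! ### The reduced brackets on `V` and on `V / ([V, V] + ∂V)` -/

section Reduced

variable {F V : Type*} [Field F] [Ring V] [Algebra F V] {D : NCDerivation F V}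

/-- `{a, b} = m {{a_λ b}} |_{λ = 0}`, where `m : V ⊗ V → V` is the multiplication. -/
def TwoFoldLambdaBracket.reduced (B : TwoFoldLambdaBracket D) : V →ₗ[F] V →ₗ[F] V :=
  B.br.compr₂ ((LinearMap.mul' F V).comp ((Polynomial.lcoeff (V ⊗[F] V) 0).restrictScalars F))

lemma TwoFoldLambdaBracket.reduced_apply (B : TwoFoldLambdaBracket D) (a b : V) :
    B.reduced a b = LinearMap.mul' F V ((B.br a b).coeff 0) := rfl

/-- The subspace `[V, V] + ∂V`. -/
def trivialDensities (D : NCDerivation F V) : Submodule F V :=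
  Submodule.span F {x | ∃ a b : V, x = a * b - b * a} ⊔ LinearMap.range D.toLinearMap

/-- The space of local functionals `V / ([V, V] + ∂V)`. -/
abbrev LocalFunctional (D : NCDerivation F V) : Type _ := V ⧸ trivialDensities D

/-- The quotient map `∫ : V → V / ([V, V] + ∂V)`. -/
def integ (D : NCDerivation F V) : V →ₗ[F] LocalFunctional D := (trivialDensities D).mkQ

lemma comm_mem (D : NCDerivation F V) (a b : V) : a * b - b * a ∈ trivialDensities D :=
  Submodule.mem_sup_left (Submodule.subset_span ⟨a, b, rfl⟩)

lemma D_mem (D : NCDerivation F V) (a : V) : D.toLinearMap a ∈ trivialDensities D :=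
  Submodule.mem_sup_right ⟨a, rfl⟩

lemma trivialDensities_le {S : Submodule F V} (h1 : ∀ a b : V, a * b - b * a ∈ S)
    (h2 : ∀ a, D.toLinearMap a ∈ S) : trivialDensities D ≤ S := by
  refine sup_le (Submodule.span_le.2 ?_) ?_
  · rintro _ ⟨a, b, rfl⟩; exact h1 a b
  · rintro _ ⟨a, rfl⟩; exact h2 a

lemma mul_starR (b : V) (p : V ⊗[F] V) :
    LinearMap.mul' F V (starR (F := F) b p) = LinearMap.mul' F V (starL (F := F) b p) := by
  induction p using TensorProduct.induction_on with
  | zero => simp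
  | tmul x y => simp [mul_assoc]
  | add p q hp hq => simp only [map_add, hp, hq]

lemma mul_arrow (b : V) (P : (V ⊗[F] V)[X]) :
    LinearMap.mul' F V ((arrowR D b P).coeff 0) = LinearMap.mul' F V ((arrowL D b P).coeff 0) := by
  induction P using Polynomial.induction_on' with
  | add P Q hP hQ => simp only [map_add, Polynomial.coeff_add, hP, hQ]
  | monomial k p =>
    rw [arrowR_monomial, arrowL_monomial, Polynomial.finsetSum_coeff, Polynomial.finsetSum_coeff,
      map_sum, map_sum]
    refine Finset.sum_congr rfl fun j _ => ?_
    rw [Polynomial.coeff_smul, Polynomial.coeff_smul, Polynomial.coeff_monomial,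
      Polynomial.coeff_monomial, map_nsmul, map_nsmul]
    split_ifs
    · rw [mul_starR]
    · rfl

lemma coeff_coeffwise (f : Module.End F (V ⊗[F] V)) (P : (V ⊗[F] V)[X]) (n : ℕ) :
    (coeffwise f P).coeff n = f (P.coeff n) := by
  induction P using Polynomial.induction_on' with
  | add P Q hP hQ => simp only [map_add, Polynomial.coeff_add, hP, hQ]
  | monomial k p =>
    rw [coeffwise_monomial, Polynomial.coeff_monomial, Polynomial.coeff_monomial]
    split_ifs <;> simp

lemma coeff_zero_lam (P : (V ⊗[F] V)[X]) : (lam (F := F) P).coeff 0 = 0 := by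
  simp [lam]

lemma mul_outR (c : V) (p : V ⊗[F] V) :
    LinearMap.mul' F V (outR (F := F) c p) = LinearMap.mul' F V p * c := by
  induction p using TensorProduct.induction_on with
  | zero => simp
  | tmul x y => simp [mul_assoc]
  | add p q hp hq => simp only [map_add, hp, hq, add_mul]

lemma mul_outL (c : V) (p : V ⊗[F] V) :
    LinearMap.mul' F V (outL (F := F) c p) = c * LinearMap.mul' F V p := by
  induction p using TensorProduct.induction_on with
  | zero => simp
  | tmul x y => simp [mul_assoc]
  | add p q hp hq => simp only [map_add, hp, hq, mul_add]

lemma mul_tensorD (p : V ⊗[F] V) :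
    LinearMap.mul' F V (tensorD D p) = D.toLinearMap (LinearMap.mul' F V p) := by
  induction p using TensorProduct.induction_on with
  | zero => simp
  | tmul x y => simp [D_mul]
  | add p q hp hq => simp only [map_add, hp, hq]

lemma reduced_mul_left_comm (B : TwoFoldLambdaBracket D) (a b c : V) :
    B.reduced (a * b) c = B.reduced (b * a) c := by
  rw [B.reduced_apply, B.reduced_apply, B.leibniz_right, B.leibniz_right, Polynomial.coeff_add,
    Polynomial.coeff_add, map_add, map_add, mul_arrow, mul_arrow, add_comm]

lemma reduced_D_left (B : TwoFoldLambdaBracket D) (a c : V) :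
    B.reduced (D.toLinearMap a) c = 0 := by
  rw [B.reduced_apply, B.sesq_left, Polynomial.coeff_neg, coeff_zero_lam, neg_zero, map_zero]

lemma reduced_mul_right (B : TwoFoldLambdaBracket D) (a b c : V) :
    B.reduced a (b * c) = B.reduced a b * c + b * B.reduced a c := by
  simp only [B.reduced_apply]
  rw [B.leibniz_left, Polynomial.coeff_add, map_add, coeff_coeffwise, coeff_coeffwise, mul_outR,
    mul_outL]

lemma reduced_D_right (B : TwoFoldLambdaBracket D) (a c : V) :
    B.reduced a (D.toLinearMap c) = D.toLinearMap (B.reduced a c) := by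
  simp only [B.reduced_apply]
  rw [B.sesq_right, lamD, LinearMap.add_apply, Polynomial.coeff_add, coeff_zero_lam, zero_add,
    coeff_coeffwise, mul_tensorD]

/-- The action `{∫ f, g} = m {{f_λ g}} |_{λ = 0}` of local functionals on `V`. -/
def TwoFoldLambdaBracket.act (B : TwoFoldLambdaBracket D) :
    LocalFunctional D →ₗ[F] V →ₗ[F] V :=
  (trivialDensities D).liftQ B.reduced <| trivialDensities_le
    (fun a b => by
      rw [LinearMap.mem_ker, map_sub, sub_eq_zero]
      exact LinearMap.ext fun c => reduced_mul_left_comm B a b c)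
    (fun a => by
      rw [LinearMap.mem_ker]
      exact LinearMap.ext fun c => reduced_D_left B a c)

lemma TwoFoldLambdaBracket.act_integ (B : TwoFoldLambdaBracket D) (f g : V) :
    B.act (integ D f) g = LinearMap.mul' F V ((B.br f g).coeff 0) := rfl

lemma act_preserves (B : TwoFoldLambdaBracket D) (f : LocalFunctional D) :
    trivialDensities D ≤ (trivialDensities D).comap (B.act f) := by
  obtain ⟨f, rfl⟩ := (trivialDensities D).mkQ_surjective f
  refine trivialDensities_le (fun a b => ?_) (fun a => ?_)
  · change B.reduced f (a * b - b * a) ∈ trivialDensities D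
    have h : B.reduced f (a * b - b * a)
        = (B.reduced f a * b - b * B.reduced f a) + (a * B.reduced f b - B.reduced f b * a) := by
      rw [map_sub, reduced_mul_right, reduced_mul_right]; abel
    rw [h]
    exact add_mem (comm_mem D _ _) (comm_mem D _ _)
  · change B.reduced f (D.toLinearMap a) ∈ trivialDensities D
    rw [reduced_D_right]
    exact D_mem D _

/-- The bracket `{∫ f, ∫ g} = ∫ m {{f_λ g}} |_{λ = 0}` of local functionals. -/
def TwoFoldLambdaBracket.pairing (B : TwoFoldLambdaBracket D)
    (f g : LocalFunctional D) : LocalFunctional D :=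
  (trivialDensities D).mapQ (trivialDensities D) (B.act f) (act_preserves B f) g

lemma TwoFoldLambdaBracket.pairing_integ (B : TwoFoldLambdaBracket D) (f g : V) :
    B.pairing (integ D f) (integ D g)
      = integ D (LinearMap.mul' F V ((B.br f g).coeff 0)) := rfl

end Reduced

/-! ### Symbols of pseudodifferential operators

A pseudodifferential operator `∑_n A_n ∂^n ∈ V((∂⁻¹))` is given by its coefficients
`A : ℤ → V`, which vanish for large `n`. -/

section Symbols

variable {F V : Type*} [Field F] [Ring V] [Algebra F V]

/-- The identity operator, with symbol `1`. -/
def symOne (V : Type*) [Ring V] : ℤ → V := Pi.single 0 1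

/-- The product of pseudodifferential operators, with symbol `A(z + ∂) B(z)`:
`∂^a ∘ b = ∑_p binom(a, p) (∂^p b) ∂^{a - p}`. For operators (coefficients vanishing in large
degrees) the sum has finitely many nonzero terms. -/
def symMul (D : NCDerivation F V) (A B : ℤ → V) : ℤ → V := fun n =>
  ∑ᶠ q : ℤ × ℕ, Ring.choose q.1 q.2 • (A q.1 * D.iter q.2 (B (n - q.1 + q.2)))

/-- Powers of a pseudodifferential operator. -/
def symPow (D : NCDerivation F V) (A : ℤ → V) : ℕ → ℤ → V
  | 0 => symOne V
  | k + 1 => symMul D (symPow D A k) A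

/-- The differential part `A_+`. -/
def symPlus (A : ℤ → V) : ℤ → V := fun n => if 0 ≤ n then A n else 0

/-- `A` is monic of order `d`. -/
def IsMonicSymbol (d : ℤ) (A : ℤ → V) : Prop := A d = 1 ∧ ∀ n, d < n → A n = 0

/-- `a ⊗ (λ + ∂)^s b`, where `∂` acts on `b` only. -/
def tmulShift (D : NCDerivation F V) (a : V) (s : ℕ) (b : V) : (V ⊗[F] V)[X] :=
  ∑ t ∈ Finset.range (s + 1), (s.choose t) • Polynomial.monomial (s - t) (a ⊗ₜ[F] D.iter t b)

/-- The coefficient of `z^m w^n` in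
`A(z) ⊗ i_z(z - w - λ - ∂)⁻¹ B(w) - A(w + λ + ∂) ⊗ i_z(z - w - λ - ∂)⁻¹ B^*(-z + λ)`,
where `A` and `B` have order at most `N`.

Put `x = λ + ∂`, acting on the coefficients of `B`. One has
`i_z(z - w - x)⁻¹ = ∑_k z^{-k-1} (w + x)^k` and `B^*(-z + λ) = ∑_b i_z(z - x)^b B_b`.
In the first term `z^m w^n` arises from `A_{m+k+1} ⊗ binom(k, l) x^l B_{n-k+l}`. In the second
it arises from `A_{n-k+p} ⊗ binom(n + p, p) x^p · (-1)^s binom(b, s) x^s B_b`, `b = m + k + 1 + s`,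
where `binom(n + p, p) x^p` is the coefficient of `w^n` in `i_w(w + x)^{n+p}`.
The finite ranges are exactly those for which `A_{…}` and `B_b` have index at most `N`. -/
def adlerCoeff (D : NCDerivation F V) (N : ℕ) (A B : ℤ → V) (m n : ℤ) : (V ⊗[F] V)[X] :=
  ∑ k ∈ Finset.range (N - m).toNat,
    ((∑ l ∈ Finset.range (k + 1),
        (k.choose l) • tmulShift D (A (m + k + 1)) l (B (n - k + l)))
      - ∑ s ∈ Finset.range (N - m - k).toNat, ∑ p ∈ Finset.range (N - n + k + 1).toNat,
          ((-1 : ℤ) ^ s * Ring.choose (m + k + 1 + s : ℤ) s * Ring.choose (n + p : ℤ) p) •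
            tmulShift D (A (n - k + p)) (p + s) (B (m + k + 1 + s)))

end Symbols

/-! ### The Adler–Gelfand–Dickey brackets -/

section AGD

variable (F : Type*) [Field F] (N : ℕ) (I : Set ℤ)

open Classical in
/-- The generic operator `L(z) = z^N + ∑_{i ∈ I} u_i z^{-i-1}` with coefficients in `R_I`
(where `I` contains no integer below `-N`). -/
def genericL : ℤ → DiffPoly F I := fun n =>
  if n = N then 1 else if h : -n - 1 ∈ I then gen F I ⟨-n - 1, h⟩ 0 else 0

/-- The right-hand side of the formula for `{{L(z)_λ L(w)}}_H`, coefficient of `z^m w^n`. -/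
def rhsH (m n : ℤ) : (DiffPoly F I ⊗[F] DiffPoly F I)[X] :=
  adlerCoeff (del F I) N (genericL F N I) (genericL F N I) m n

/-- The coefficient of `z^m w^n` in the right-hand side of the formula for `{{L(z)_λ L(w)}}_K`,
`i_z(z - w - λ)⁻¹ (L(z) - L(w + λ)) ⊗ 1 + 1 ⊗ i_z(z - w - λ - ∂)⁻¹ (L(w) - L^*(-z + λ))`.
Its two summands are the expression of `adlerCoeff` for the pairs `(L, 1)` and `(1, L)`,
as `∂ 1 = 0` and `1^* = 1`. -/
def rhsK (m n : ℤ) : (DiffPoly F I ⊗[F] DiffPoly F I)[X] :=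
  adlerCoeff (del F I) N (genericL F N I) (symOne _) m n
    + adlerCoeff (del F I) N (symOne _) (genericL F N I) m n

/-- The bracket `H`: `{{u_i _λ u_j}}_H` is the coefficient of `z^{-i-1} w^{-j-1}`. -/
def bracketH : TwoFoldLambdaBracket (del F I) :=
  bracketOfGenerators fun i j => rhsH F N I (-(i : ℤ) - 1) (-(j : ℤ) - 1)

/-- The bracket `K`: `{{u_i _λ u_j}}_K` is the coefficient of `z^{-i-1} w^{-j-1}`. -/
def bracketK : TwoFoldLambdaBracket (del F I) :=
  bracketOfGenerators fun i j => rhsK F N I (-(i : ℤ) - 1) (-(j : ℤ) - 1)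

/-- `A = L^{1/N}`: the operator `A` is monic of order one and `A^N = L`. -/
def IsRootOfL (A : ℤ → DiffPoly F I) : Prop :=
  IsMonicSymbol 1 A ∧ symPow (del F I) A N = genericL F N I

variable {F I}

/-- `h_k = (N / k) res_z L^{k/N}(z)`, where `A = L^{1/N}`. -/
def hamiltonian (A : ℤ → DiffPoly F I) (k : ℕ) : DiffPoly F I :=
  ((N : F) / (k : F)) • symPow (del F I) A k (-1)

end AGD

end NCPoisson

end

open NCPoisson

namespace NCPoisson

/-! ### The ring of pseudodifferential operators -/

section Psi

variable {F V : Type*} [Field F] [Ring V] [Algebra F V]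

/-! Everything is translated into the ring `Psi D` of pseudodifferential operators V((∂⁻¹)). There a
monic operator is invertible, and in characteristic 0 a monic operator of order N has exactly one
monic N-th root: perturbing the root changes the leading coefficient of its N-th power by N times
the perturbation (`pow_leibniz_top`). Write A = L^{1/N} and B = A^{k-N}.

The chain rule for h_k comes from the trace property of the residue: the residue of a commutator is
killed by every trace that kills total derivatives (`trace_res_comm`). This is applied over the
square-zero extension of V by (V ⊗ V)[λ], where f ↦ (f, {{f_λ g}}) is a homomorphism of differential
rings. The result, `reduced_res_pow`, is the non-commutative form of δ((N/k) res A^k) = res(B δL):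
the element {∫h_k, g} is the sum over m of {{L_m _λ g}} with ∂^j res(∂^m B) inserted between the
tensor factors in place of λ^j.

Inserting these residues in the Adler expression of a pair (P, Q) and summing over m produces the
Adler map (PB)_+ Q - P (BQ)_+ (`sum_evAt_adlerCoeff`). For H the pair is (L, L) and the outcome is
[(A^k)_+, L]. For K the pairs are (L, 1) and (1, L) and the outcome is [B_+, L]. Replacing k by k +
N in the second gives the first, which is the Lenard–Magri recursion; for k < N the operator B has
negative order and for k = N it is 1, so the first N Hamiltonians act trivially. Equalities on the
coefficients of L extend to V because the flows are derivations commuting with ∂ (`derivation_ext`).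

A Lax equation for L passes to A and its powers (`mapDer_pow_of_lax`), so the flow of h_l is a
residue of a commutator and the functionals are in involution. Commutation of the flows follows from
the zero curvature equation, without the Jacobi identity of the brackets.

The defining identities hold by construction where both coefficients of L are generators. Elsewhere
a coefficient of L is 0 or 1, and the Adler expression has to vanish; this is a cancellation between
its two halves (`adlerCoeff_eq_zero`). -/

lemma iter_add (D : NCDerivation F V) (i j : ℕ) (a : V) :
    D.iter (i + j) a = D.iter i (D.iter j a) := by
  simp [NCDerivation.iter, pow_add]

lemma iter_succ' (D : NCDerivation F V) (j : ℕ) (a : V) :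
    D.iter (j + 1) a = D.toLinearMap (D.iter j a) := by
  simp [NCDerivation.iter, pow_succ']

lemma iter_one (D : NCDerivation F V) {j : ℕ} (hj : j ≠ 0) : D.iter j 1 = 0 := by
  obtain ⟨j, rfl⟩ := Nat.exists_eq_succ_of_ne_zero hj
  rw [Nat.succ_eq_add_one, iter_succ, D_one, map_zero]

open Finset in
lemma iter_mul (D : NCDerivation F V) (r : ℕ) (a b : V) :
    D.iter r (a * b) = ∑ p ∈ antidiagonal r, (r.choose p.1) • (D.iter p.1 a * D.iter p.2 b) := by
  induction r with
  | zero => simp [iter_zero]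
  | succ r ih =>
    rw [sum_antidiagonal_choose_succ_nsmul (fun i j => D.iter i a * D.iter j b), iter_succ', ih,
      map_sum, ← sum_add_distrib]
    refine sum_congr rfl fun p hp => ?_
    rw [map_nsmul, D_mul, smul_add, ← iter_succ', ← iter_succ', add_comm]
    congr 2
    exact Nat.choose_symm_of_eq_add (HasAntidiagonal.mem_antidiagonal.1 hp).symm

open Finset in
-- The combinatorial core of associativity: the two sides are the contributions of ∂^i ∘ (x ∂^j ∘ y)
-- and (∂^i ∘ x ∂^j) ∘ y with u derivatives in all. Leibniz expands the left side, Vandermonde the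
-- right, and the terms agree by binom(i, a+b) binom(a+b, a) = binom(i, a) binom(i-a, b).
lemma choose_iter_assoc (D : NCDerivation F V) (i j : ℤ) (u : ℕ) (x y : V) :
    ∑ r ∈ antidiagonal u, (Ring.choose i r.1 * Ring.choose j r.2) • D.iter r.1 (x * D.iter r.2 y)
      = ∑ p ∈ antidiagonal u, (Ring.choose i p.1 * Ring.choose (i + j - p.1) p.2) •
          (D.iter p.1 x * D.iter p.2 y) := by
  have h1 : ∀ p ∈ antidiagonal u,
      (Ring.choose i p.1 * Ring.choose (i + j - p.1) p.2) • (D.iter p.1 x * D.iter p.2 y)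
      = ∑ t ∈ antidiagonal p.2, (Ring.choose i p.1 * (Ring.choose (i - p.1) t.1 *
          Ring.choose j t.2)) • (D.iter p.1 x * D.iter p.2 y) := by
    intro p _
    rw [show i + j - (p.1 : ℤ) = (i - p.1) + j by ring, Ring.add_choose_eq _ (Commute.all _ _),
      mul_sum, sum_smul]
  have h2 : ∀ r ∈ antidiagonal u,
      (Ring.choose i r.1 * Ring.choose j r.2) • D.iter r.1 (x * D.iter r.2 y)
      = ∑ t ∈ antidiagonal r.1, ((Ring.choose i r.1 * Ring.choose j r.2) * (r.1.choose t.1 : ℤ)) •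
          (D.iter t.1 x * D.iter (t.2 + r.2) y) := by
    intro r _
    rw [iter_mul, smul_sum]
    refine sum_congr rfl fun t _ => ?_
    rw [← natCast_zsmul, smul_smul, iter_add]
  rw [sum_congr rfl h1, sum_congr rfl h2, sum_sigma', sum_sigma']
  refine sum_nbij' (fun z => ⟨(z.2.1, z.2.2 + z.1.2), (z.2.2, z.1.2)⟩)
    (fun z => ⟨(z.1.1 + z.2.1, z.2.2), (z.1.1, z.2.1)⟩) ?_ ?_ ?_ ?_ ?_
  · rintro ⟨⟨r, s⟩, ⟨a, b⟩⟩ h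
    simp only [mem_sigma, HasAntidiagonal.mem_antidiagonal, and_true] at h ⊢
    omega
  · rintro ⟨⟨r, s⟩, ⟨a, b⟩⟩ h
    simp only [mem_sigma, HasAntidiagonal.mem_antidiagonal, and_true] at h ⊢
    omega
  · rintro ⟨⟨r, s⟩, ⟨a, b⟩⟩ h
    simp only [mem_sigma, HasAntidiagonal.mem_antidiagonal] at h
    obtain ⟨h, rfl⟩ := h
    rfl
  · rintro ⟨⟨r, s⟩, ⟨a, b⟩⟩ h
    simp only [mem_sigma, HasAntidiagonal.mem_antidiagonal] at h
    obtain ⟨h, rfl⟩ := h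
    rfl
  · rintro ⟨⟨r, s⟩, ⟨a, b⟩⟩ h
    simp only [mem_sigma, HasAntidiagonal.mem_antidiagonal] at h
    obtain ⟨h, rfl⟩ := h
    have h3 := Ring.choose_smul_choose i (Nat.le_add_right a b)
    rw [Nat.add_sub_cancel_left, nsmul_eq_mul] at h3
    congr 1
    linear_combination Ring.choose j s * h3

/-- `A` has order at most `d`. -/
def OrdLE (d : ℤ) (A : ℤ → V) : Prop := ∀ n, d < n → A n = 0

lemma OrdLE.mono {d e : ℤ} {A : ℤ → V} (h : OrdLE d A) (hde : d ≤ e) : OrdLE e A :=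
  fun n hn => h n (by omega)

/-- A nonzero term needs q ≤ d and n - q + p ≤ e, which force n - e ≤ q and p ≤ d + e - n. The box
is left adjustable so that different products can be summed over a common range. -/
lemma symMul_support {D : NCDerivation F V} {A B : ℤ → V} {d e : ℤ} (hA : OrdLE d A)
    (hB : OrdLE e B) {n lo hi : ℤ} {P : ℕ} (hlo : lo ≤ n - e) (hhi : d ≤ hi)
    (hP : d + e - n < P) :
    (Function.support fun q : ℤ × ℕ =>
      Ring.choose q.1 q.2 • (A q.1 * D.iter q.2 (B (n - q.1 + q.2))))
      ⊆ (Finset.Icc lo hi ×ˢ Finset.range P : Finset (ℤ × ℕ)) := by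
  rintro ⟨q, p⟩ h
  rw [Function.mem_support] at h
  have h1 : q ≤ d := by
    by_contra hq
    exact h (by rw [hA q (by omega)]; simp)
  have h2 : n - q + p ≤ e := by
    by_contra hq
    exact h (by dsimp only; rw [hB (n - q + p) (by omega)]; simp)
  simp only [Finset.coe_product, Set.mem_prod, Finset.mem_coe, Finset.mem_Icc, Finset.mem_range]
  omega

lemma symMul_hasFiniteSupport {D : NCDerivation F V} {A B : ℤ → V} {d e : ℤ} (hA : OrdLE d A)
    (hB : OrdLE e B) (n : ℤ) :
    (fun q : ℤ × ℕ => Ring.choose q.1 q.2 •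
      (A q.1 * D.iter q.2 (B (n - q.1 + q.2)))).HasFiniteSupport :=
  (Finset.finite_toSet _).subset
    (symMul_support hA hB (P := (d + e - n + 1).toNat) le_rfl le_rfl (by omega))

lemma symMul_eq_sum {D : NCDerivation F V} {A B : ℤ → V} {d e : ℤ} (hA : OrdLE d A)
    (hB : OrdLE e B) {n lo hi : ℤ} {P : ℕ} (hlo : lo ≤ n - e) (hhi : d ≤ hi)
    (hP : d + e - n < P) :
    symMul D A B n = ∑ q ∈ Finset.Icc lo hi, ∑ p ∈ Finset.range P,
      Ring.choose q p • (A q * D.iter p (B (n - q + p))) := by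
  rw [symMul, finsum_eq_sum_of_support_subset _ (symMul_support hA hB hlo hhi hP),
    Finset.sum_product]

lemma OrdLE.mul {D : NCDerivation F V} {A B : ℤ → V} {d e : ℤ} (hA : OrdLE d A)
    (hB : OrdLE e B) : OrdLE (d + e) (symMul D A B) := by
  intro n hn
  -- Above degree d + e the range of p may be taken empty.
  rw [symMul_eq_sum hA hB (n := n) (P := 0) le_rfl le_rfl (by push_cast; omega)]
  simp

lemma symMul_top {D : NCDerivation F V} {A B : ℤ → V} {d e : ℤ} (hA : OrdLE d A)
    (hB : OrdLE e B) : symMul D A B (d + e) = A d * B e := by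
  rw [symMul_eq_sum hA hB (n := d + e) (P := 1) (lo := d) (hi := d) (by omega) le_rfl (by simp)]
  simp [iter_zero]

lemma symMul_add_left {D : NCDerivation F V} {A A' B : ℤ → V} {d d' e : ℤ} (hA : OrdLE d A)
    (hA' : OrdLE d' A') (hB : OrdLE e B) :
    symMul D (A + A') B = symMul D A B + symMul D A' B := by
  funext n
  rw [Pi.add_apply, symMul, symMul, symMul,
    ← finsum_add_distrib (symMul_hasFiniteSupport hA hB n) (symMul_hasFiniteSupport hA' hB n)]
  exact finsum_congr fun q => by rw [Pi.add_apply, add_mul, smul_add]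

lemma symMul_add_right {D : NCDerivation F V} {A B B' : ℤ → V} {d e e' : ℤ} (hA : OrdLE d A)
    (hB : OrdLE e B) (hB' : OrdLE e' B') :
    symMul D A (B + B') = symMul D A B + symMul D A B' := by
  funext n
  rw [Pi.add_apply, symMul, symMul, symMul,
    ← finsum_add_distrib (symMul_hasFiniteSupport hA hB n) (symMul_hasFiniteSupport hA hB' n)]
  exact finsum_congr fun q => by rw [Pi.add_apply, map_add, mul_add, smul_add]

lemma finsum_antidiagonal {f : ℕ × ℕ → V} (hf : f.HasFiniteSupport) :
    ∑ᶠ p, f p = ∑ᶠ u, ∑ p ∈ Finset.HasAntidiagonal.antidiagonal u, f p := by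
  classical
  have hf : (Function.support f).Finite := hf
  rw [finsum_eq_sum_of_support_subset f (s := hf.toFinset) (by rw [Set.Finite.coe_toFinset])]
  rw [finsum_eq_sum_of_support_subset (s := hf.toFinset.image fun p => p.1 + p.2)]
  · rw [← Finset.sum_fiberwise_of_maps_to (g := fun p : ℕ × ℕ => p.1 + p.2)
      (fun p hp => Finset.mem_image_of_mem _ hp)]
    refine Finset.sum_congr rfl fun u _ => Finset.sum_subset ?_ ?_
    · intro p hp
      rw [Finset.HasAntidiagonal.mem_antidiagonal]
      exact (Finset.mem_filter.1 hp).2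
    · intro p hp hp'
      by_contra h
      exact hp' (Finset.mem_filter.2 ⟨(Set.Finite.mem_toFinset _).2 h, Finset.HasAntidiagonal.mem_antidiagonal.1 hp⟩)
  · intro u hu
    rw [Function.mem_support] at hu
    obtain ⟨p, hp, hp'⟩ := Finset.exists_ne_zero_of_sum_ne_zero hu
    exact Finset.mem_coe.2 (Finset.mem_image.2
      ⟨p, by simpa using hp', Finset.HasAntidiagonal.mem_antidiagonal.1 hp⟩)

lemma tripleBox_finite {T : (ℤ × ℤ) × ℕ × ℕ → V} (a b c : ℤ)
    (hT : ∀ i j p q, T ((i, j), p, q) ≠ 0 → i ≤ a ∧ j ≤ b ∧ (p : ℤ) + q ≤ c + i + j) :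
    T.HasFiniteSupport := by
  refine (Finset.finite_toSet ((Finset.Icc (-c - b) a ×ˢ Finset.Icc (-c - a) b) ×ˢ
    (Finset.range (c + a + b + 1).toNat ×ˢ Finset.range (c + a + b + 1).toNat))).subset ?_
  rintro ⟨⟨i, j⟩, p, q⟩ h
  have := hT i j p q h
  simp only [Finset.coe_product, Set.mem_prod, Finset.mem_coe, Finset.mem_Icc, Finset.mem_range]
  omega

/-- Both sides become sums over the degrees (i, j) of the coefficients of A and B and the derivative
orders (p, q). For fixed (i, j) the coefficient of C depends on p + q only, so summing along
antidiagonals reduces the claim to `choose_iter_assoc`. -/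
lemma symMul_assoc {D : NCDerivation F V} {A B C : ℤ → V} {a b c : ℤ} (hA : OrdLE a A)
    (hB : OrdLE b B) (hC : OrdLE c C) :
    symMul D (symMul D A B) C = symMul D A (symMul D B C) := by
  funext n
  set T : (ℤ × ℤ) × ℕ × ℕ → V := fun z =>
    (Ring.choose z.1.1 z.2.1 * Ring.choose (z.1.1 + z.1.2 - z.2.1) z.2.2) •
      (A z.1.1 * (D.iter z.2.1 (B z.1.2) *
        D.iter z.2.2 (C (n - z.1.1 - z.1.2 + (z.2.1 + z.2.2 : ℕ))))) with hTdef
  set S : (ℤ × ℤ) × ℕ × ℕ → V := fun z =>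
    (Ring.choose z.1.1 z.2.1 * Ring.choose z.1.2 z.2.2) •
      (A z.1.1 * D.iter z.2.1 (B z.1.2 *
        D.iter z.2.2 (C (n - z.1.1 - z.1.2 + (z.2.1 + z.2.2 : ℕ))))) with hSdef
  have hT : T.HasFiniteSupport := by
    refine tripleBox_finite a b (c - n) fun i j p q h => ⟨?_, ?_, ?_⟩ <;> by_contra h'
    · exact h (by simp only [hTdef]; rw [hA i (by omega)]; simp)
    · exact h (by simp only [hTdef]; rw [hB j (by omega)]; simp)
    · exact h (by simp only [hTdef]; rw [hC _ (by push_cast; omega)]; simp)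
  have hS : S.HasFiniteSupport := by
    refine tripleBox_finite a b (c - n) fun i j p q h => ⟨?_, ?_, ?_⟩ <;> by_contra h'
    · exact h (by simp only [hSdef]; rw [hA i (by omega)]; simp)
    · exact h (by simp only [hSdef]; rw [hB j (by omega)]; simp)
    · exact h (by simp only [hSdef]; rw [hC _ (by push_cast; omega)]; simp)
  have hST : ∑ᶠ z, S z = ∑ᶠ z, T z := by
    rw [finsum_curry _ hS, finsum_curry _ hT]
    refine finsum_congr fun ij => ?_
    rw [finsum_antidiagonal (hS.fun_comp_of_injective (Prod.mk_right_injective ij)),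
      finsum_antidiagonal (hT.fun_comp_of_injective (Prod.mk_right_injective ij))]
    refine finsum_congr fun u => ?_
    have h := congrArg (fun v => A ij.1 * v)
      (choose_iter_assoc D ij.1 ij.2 u (B ij.2) (C (n - ij.1 - ij.2 + u)))
    simp only [Finset.mul_sum, mul_smul_comm] at h
    rw [Finset.sum_congr rfl fun p hp => ?_, h, Finset.sum_congr rfl fun p hp => ?_]
    · simp only [hTdef]; rw [Finset.HasAntidiagonal.mem_antidiagonal.1 hp]
    · simp only [hSdef]; rw [Finset.HasAntidiagonal.mem_antidiagonal.1 hp]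
  -- The coefficient of AB in degree m consists of the terms A_i ∂^p B_j with j = m - i + p.
  let e₁ : (ℤ × ℕ) × (ℤ × ℕ) ≃ (ℤ × ℤ) × ℕ × ℕ :=
    { toFun := fun z => ((z.2.1, z.1.1 - z.2.1 + z.2.2), z.2.2, z.1.2)
      invFun := fun z => ((z.1.1 + z.1.2 - z.2.1, z.2.2), z.1.1, z.2.1)
      left_inv := fun z => by (ext <;> simp); ring
      right_inv := fun z => by (ext <;> simp); ring }
  have hl : symMul D (symMul D A B) C n = ∑ᶠ z, T z := by
    rw [← finsum_comp_equiv e₁, finsum_curry _ (hT.fun_comp_of_injective e₁.injective), symMul]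
    refine finsum_congr fun mq => ?_
    let φ : V →+ V := (AddMonoidHom.mulRight (D.iter mq.2 (C (n - mq.1 + mq.2))))
    change Ring.choose mq.1 mq.2 • φ (symMul D A B mq.1) = _
    rw [symMul, AddMonoidHom.map_finsum _ (symMul_hasFiniteSupport hA hB _),
      smul_finsum' _ (Function.HasFiniteSupport.fun_comp (symMul_hasFiniteSupport hA hB _) (map_zero φ))]
    refine finsum_congr fun ip => ?_
    simp only [hTdef, e₁, φ, Equiv.coe_fn_mk, AddMonoidHom.coe_mulRight]
    rw [smul_mul_assoc, smul_smul, mul_assoc]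
    congr 1
    · rw [mul_comm]; congr 2; omega
    · congr 3; refine congrArg C ?_; push_cast; ring
  let e₂ : (ℤ × ℕ) × (ℤ × ℕ) ≃ (ℤ × ℤ) × ℕ × ℕ :=
    { toFun := fun z => ((z.1.1, z.2.1), z.1.2, z.2.2)
      invFun := fun z => ((z.1.1, z.2.1), z.1.2, z.2.2)
      left_inv := fun z => rfl
      right_inv := fun z => rfl }
  have hr : symMul D A (symMul D B C) n = ∑ᶠ z, S z := by
    rw [← finsum_comp_equiv e₂, finsum_curry _ (hS.fun_comp_of_injective e₂.injective), symMul]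
    refine finsum_congr fun ir => ?_
    let φ : V →+ V := (AddMonoidHom.mulLeft (A ir.1)).comp (D.iter ir.2).toAddMonoidHom
    change Ring.choose ir.1 ir.2 • φ (symMul D B C _) = _
    rw [symMul, AddMonoidHom.map_finsum _ (symMul_hasFiniteSupport hB hC _),
      smul_finsum' _ (Function.HasFiniteSupport.fun_comp (symMul_hasFiniteSupport hB hC _) (map_zero φ))]
    refine finsum_congr fun js => ?_
    simp only [hSdef, e₂, φ, Equiv.coe_fn_mk, AddMonoidHom.comp_apply, AddMonoidHom.coe_mulLeft,
      LinearMap.toAddMonoidHom_coe]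
    rw [map_zsmul, mul_smul_comm, smul_smul]
    congr 4; refine congrArg (fun m => D.iter js.2 (C m)) ?_; push_cast; ring
  rw [hl, hr, hST]

lemma ordLE_single (i : ℤ) (a : V) : OrdLE i (Pi.single i a : ℤ → V) :=
  fun _ hn => Pi.single_eq_of_ne (by omega) _

lemma single_symMul (D : NCDerivation F V) (i : ℤ) (a : V) {B : ℤ → V} {e : ℤ} (hB : OrdLE e B)
    {n : ℤ} {P : ℕ} (hP : i + e - n < P) :
    symMul D (Pi.single i a) B n
      = ∑ p ∈ Finset.range P, Ring.choose i p • (a * D.iter p (B (n - i + p))) := by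
  rw [symMul_eq_sum (ordLE_single i a) hB (lo := min (n - e) i) (hi := i) (by omega) le_rfl hP,
    Finset.sum_eq_single_of_mem i (by simp)]
  · simp
  · intro q _ hq
    simp [Pi.single_eq_of_ne hq]

lemma symMul_single (D : NCDerivation F V) (j : ℤ) (b : V) {A : ℤ → V} {d : ℤ} (hA : OrdLE d A)
    {n : ℤ} {P : ℕ} (hP : d + j - n < P) :
    symMul D A (Pi.single j b) n
      = ∑ p ∈ Finset.range P, Ring.choose (n - j + p) p • (A (n - j + p) * D.iter p b) := by
  rw [symMul_eq_sum hA (ordLE_single j b) (lo := n - j) (hi := max d (n - j + P)) le_rfl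
    (by omega) hP, Finset.sum_comm]
  refine Finset.sum_congr rfl fun p hp => ?_
  have := Finset.mem_range.1 hp
  rw [Finset.sum_eq_single_of_mem (n - j + p) (by rw [Finset.mem_Icc]; omega)]
  · rw [show n - (n - j + p) + p = j by ring, Pi.single_eq_same]
  · intro q _ hq
    rw [Pi.single_eq_of_ne (by omega)]
    simp

/-- The symbols that vanish in large degrees. -/
def boundedSymbols (V : Type*) [Ring V] : AddSubgroup (ℤ → V) where
  carrier := {A | ∃ d, OrdLE d A}
  zero_mem' := ⟨0, fun _ _ => rfl⟩
  add_mem' := by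
    rintro A B ⟨d, hA⟩ ⟨e, hB⟩
    refine ⟨max d e, fun n hn => ?_⟩
    rw [Pi.add_apply, hA n (by omega), hB n (by omega), add_zero]
  neg_mem' := by
    rintro A ⟨d, hA⟩
    exact ⟨d, fun n hn => by rw [Pi.neg_apply, hA n hn, neg_zero]⟩

/-- The ring `V((∂⁻¹))` of pseudodifferential operators. -/
def Psi (_ : NCDerivation F V) : Type _ := boundedSymbols V

namespace Psi

variable {D : NCDerivation F V}

instance : AddCommGroup (Psi D) := inferInstanceAs (AddCommGroup (boundedSymbols V))

/-- The coefficients of a pseudodifferential operator. -/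
def sym : Psi D →+ (ℤ → V) := (boundedSymbols V).subtype

/-- The operator with a given symbol. -/
def mk (A : ℤ → V) {d : ℤ} (h : OrdLE d A) : Psi D := ⟨A, d, h⟩

lemma bdd (A : Psi D) : ∃ d, OrdLE d (sym A) := A.2

@[ext] lemma ext {A B : Psi D} (h : ∀ n, sym A n = sym B n) : A = B := Subtype.ext (funext h)

/-- The operator `a ∂^i`. -/
def mono (i : ℤ) (a : V) : Psi D := mk _ (ordLE_single i a)

@[simp] lemma sym_mono (i : ℤ) (a : V) : sym (mono i a : Psi D) = Pi.single i a := rfl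

lemma ord_mono (i : ℤ) (a : V) : OrdLE i (sym (mono i a : Psi D)) := ordLE_single i a

noncomputable instance : Mul (Psi D) := ⟨fun A B => ⟨symMul D (sym A) (sym B), by
  obtain ⟨d, hA⟩ := A.bdd
  obtain ⟨e, hB⟩ := B.bdd
  exact ⟨d + e, hA.mul hB⟩⟩⟩

lemma sym_mul (A B : Psi D) : sym (A * B) = symMul D (sym A) (sym B) := rfl

instance : One (Psi D) := ⟨mono 0 1⟩

lemma sym_one : sym (1 : Psi D) = symOne V := rfl

noncomputable instance : Ring (Psi D) :=
  { (inferInstance : AddCommGroup (Psi D)) with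
    mul := (· * ·)
    one := 1
    left_distrib := fun A B C => by
      obtain ⟨a, hA⟩ := A.bdd
      obtain ⟨b, hB⟩ := B.bdd
      obtain ⟨c, hC⟩ := C.bdd
      exact Subtype.ext (symMul_add_right hA hB hC)
    right_distrib := fun A B C => by
      obtain ⟨a, hA⟩ := A.bdd
      obtain ⟨b, hB⟩ := B.bdd
      obtain ⟨c, hC⟩ := C.bdd
      exact Subtype.ext (symMul_add_left hA hB hC)
    zero_mul := fun A => by
      obtain ⟨a, hA⟩ := A.bdd
      refine Subtype.ext (funext fun n => ?_)
      change symMul D 0 (sym A) n = 0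
      simp [symMul]
    mul_zero := fun A => by
      refine Subtype.ext (funext fun n => ?_)
      change symMul D (sym A) 0 n = 0
      simp [symMul]
    mul_assoc := fun A B C => by
      obtain ⟨a, hA⟩ := A.bdd
      obtain ⟨b, hB⟩ := B.bdd
      obtain ⟨c, hC⟩ := C.bdd
      exact Subtype.ext (symMul_assoc hA hB hC)
    one_mul := fun A => by
      obtain ⟨a, hA⟩ := A.bdd
      refine Subtype.ext (funext fun n => ?_)
      change symMul D (Pi.single 0 1) (sym A) n = sym A n
      rw [single_symMul D 0 1 hA (n := n) (P := (a - n).toNat + 1) (by omega),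
        Finset.sum_eq_single_of_mem 0 (by simp)]
      · simp [iter_zero]
      · intro p _ hp
        rw [Ring.choose_zero_ite, if_neg hp, zero_smul]
    mul_one := fun A => by
      obtain ⟨a, hA⟩ := A.bdd
      refine Subtype.ext (funext fun n => ?_)
      change symMul D (sym A) (Pi.single 0 1) n = sym A n
      rw [symMul_single D 0 1 hA (n := n) (P := (a - n).toNat + 1) (by omega),
        Finset.sum_eq_single_of_mem 0 (by simp)]
      · simp [iter_zero]
      · intro p _ hp
        rw [iter_one D hp]
        simp
    zsmul := (inferInstance : AddCommGroup (Psi D)).zsmul }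

lemma sym_pow (A : Psi D) (k : ℕ) : sym (A ^ k) = symPow D (sym A) k := by
  induction k with
  | zero => rfl
  | succ k ih => rw [pow_succ, sym_mul, ih]; rfl

lemma ord_mul {A B : Psi D} {d e : ℤ} (hA : OrdLE d (sym A)) (hB : OrdLE e (sym B)) :
    OrdLE (d + e) (sym (A * B)) := hA.mul hB

lemma sym_mul_top {A B : Psi D} {d e : ℤ} (hA : OrdLE d (sym A)) (hB : OrdLE e (sym B)) :
    sym (A * B) (d + e) = sym A d * sym B e := symMul_top hA hB

lemma mono_mul_apply (i : ℤ) (a : V) {B : Psi D} {e : ℤ} (hB : OrdLE e (sym B))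
    {n : ℤ} {P : ℕ} (hP : i + e - n < P) : sym (mono i a * B) n
      = ∑ p ∈ Finset.range P, Ring.choose i p • (a * D.iter p (sym B (n - i + p))) :=
  single_symMul D i a hB hP

lemma mul_mono_apply (j : ℤ) (b : V) {A : Psi D} {d : ℤ} (hA : OrdLE d (sym A))
    {n : ℤ} {P : ℕ} (hP : d + j - n < P) : sym (A * mono j b) n
      = ∑ p ∈ Finset.range P, Ring.choose (n - j + p) p • (sym A (n - j + p) * D.iter p b) :=
  symMul_single D j b hA hP

end Psi

end Psi

end NCPoisson

namespace NCPoisson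

/-! ### Leading coefficients, inverses, roots and differential parts -/

namespace Psi

variable {F V : Type*} [Field F] [Ring V] [Algebra F V] {D : NCDerivation F V}

lemma sym_add_apply (A B : Psi D) (n : ℤ) : sym (A + B) n = sym A n + sym B n := by
  rw [map_add, Pi.add_apply]

lemma sym_sub_apply (A B : Psi D) (n : ℤ) : sym (A - B) n = sym A n - sym B n := by
  rw [map_sub, Pi.sub_apply]

lemma sym_zero_apply (n : ℤ) : sym (0 : Psi D) n = 0 := by
  rw [map_zero, Pi.zero_apply]

lemma sym_one_zero : sym (1 : Psi D) 0 = 1 := by rw [sym_one, symOne, Pi.single_eq_same]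

lemma sym_one_of_ne {n : ℤ} (hn : n ≠ 0) : sym (1 : Psi D) n = 0 := by
  rw [sym_one, symOne, Pi.single_eq_of_ne hn]

lemma ord_add {A B : Psi D} {d : ℤ} (hA : OrdLE d (sym A)) (hB : OrdLE d (sym B)) :
    OrdLE d (sym (A + B)) := fun n hn => by
  rw [sym_add_apply, hA n hn, hB n hn, add_zero]

lemma ord_sub {A B : Psi D} {d : ℤ} (hA : OrdLE d (sym A)) (hB : OrdLE d (sym B)) :
    OrdLE d (sym (A - B)) := fun n hn => by
  rw [sym_sub_apply, hA n hn, hB n hn, sub_zero]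

/-- The operator `A` is monic of order `d`. -/
def Monic (d : ℤ) (A : Psi D) : Prop := IsMonicSymbol d (sym A)

lemma Monic.ord {d : ℤ} {A : Psi D} (h : Monic d A) : OrdLE d (sym A) := h.2

lemma Monic.one : Monic 0 (1 : Psi D) := ⟨sym_one_zero, ord_mono 0 1⟩

lemma Monic.mul {d e : ℤ} {A B : Psi D} (hA : Monic d A) (hB : Monic e B) :
    Monic (d + e) (A * B) :=
  ⟨by rw [sym_mul_top hA.ord hB.ord, hA.1, hB.1, one_mul], ord_mul hA.ord hB.ord⟩

lemma Monic.pow {d : ℤ} {A : Psi D} (hA : Monic d A) (n : ℕ) : Monic (n * d) (A ^ n) := by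
  induction n with
  | zero => simpa using Monic.one
  | succ n ih =>
    have h := ih.mul hA
    rw [pow_succ]
    convert h using 1
    push_cast
    ring

/-- The order of Z has some bound, and the hypothesis lowers any bound by one, indefinitely. This
reduces vanishing to a comparison of leading coefficients. -/
lemma eq_zero_of_top {Z : Psi D} (h : ∀ e, OrdLE e (sym Z) → sym Z e = 0) : Z = 0 := by
  obtain ⟨d, hd⟩ := Z.bdd
  have hk : ∀ k : ℕ, OrdLE (d - k) (sym Z) := by
    intro k
    induction k with
    | zero => simpa using hd
    | succ k ih =>
      intro n hn
      rcases eq_or_ne n (d - k) with rfl | hne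
      · exact h _ ih
      · exact ih n (by push_cast at hn; omega)
  ext n
  rw [sym_zero_apply]
  exact hk (d - n + 1).toNat n (by omega)

/-- The recursion covers both f n = X^n - Y^n with δ = X - Y, and f n = Θ(X^n) with Y = X and δ = Θ
X for a derivation Θ. Multiplication by monic operators preserves leading coefficients, so each of
the n terms X^i δ Y^{n-1-i} contributes that of δ. -/
lemma pow_leibniz_top {X Y δ : Psi D} (hX : Monic 1 X) (hY : Monic 1 Y) {f : ℕ → Psi D}
    (h0 : f 0 = 0) (hf : ∀ n, f (n + 1) = X ^ n * δ + f n * Y) {e : ℤ} (hδ : OrdLE e (sym δ))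
    (n : ℕ) : OrdLE (n - 1 + e) (sym (f n)) ∧ sym (f n) (n - 1 + e) = n • sym δ e := by
  induction n with
  | zero => rw [h0, map_zero]; exact ⟨fun _ _ => rfl, by simp⟩
  | succ n ih =>
    have h1 := (hX.pow n)
    rw [mul_one] at h1
    have e1 : ((n + 1 : ℕ) : ℤ) - 1 + e = n + e := by push_cast; ring
    have e2 : (n : ℤ) + e = (n - 1 + e) + 1 := by ring
    have h3 := ord_mul ih.1 hY.ord
    have h4 := sym_mul_top ih.1 hY.ord
    rw [← e2] at h3 h4
    rw [e1, hf]
    refine ⟨ord_add (ord_mul h1.ord hδ) h3, ?_⟩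
    rw [sym_add_apply, sym_mul_top h1.ord hδ, h4, ih.2, h1.1, hY.1, one_mul, mul_one, succ_nsmul,
      add_comm]

/-- The operator `∑_i x_i ∂^{d - i}`. -/
def ofSeq (d : ℤ) (x : ℕ → V) : Psi D :=
  mk (fun n => if n ≤ d then x (d - n).toNat else 0) (d := d) fun n hn => if_neg (by omega)

lemma ord_ofSeq (d : ℤ) (x : ℕ → V) : OrdLE d (sym (ofSeq d x : Psi D)) :=
  fun _ hn => if_neg (by omega)

lemma sym_ofSeq (d : ℤ) (x : ℕ → V) (i : ℕ) : sym (ofSeq d x : Psi D) (d - i) = x i := by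
  change (if d - i ≤ d then x (d - (d - i)).toNat else 0) = x i
  simp

lemma ord_ofSeq_sub {d : ℤ} {x y : ℕ → V} {i : ℕ} (h : ∀ j < i, x j = y j) :
    OrdLE (d - i) (sym (ofSeq d x - ofSeq d y : Psi D)) := by
  intro n hn
  rw [sym_sub_apply]
  rcases le_or_gt n d with hnd | hnd
  · obtain ⟨j, rfl⟩ : ∃ j : ℕ, n = d - j := ⟨(d - n).toNat, by omega⟩
    rw [sym_ofSeq, sym_ofSeq, h j (by omega), sub_self]
  · rw [ord_ofSeq d x n hnd, ord_ofSeq d y n hnd, sub_self]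

/-- Course-of-values recursion, phrased as a fixed point so that the unknown coefficients can be
found without writing the equations in solved form. -/
lemma exists_recursive {W : Type*} [Zero W] (H : (ℕ → W) → ℕ → W)
    (hH : ∀ x y i, (∀ j < i, x j = y j) → H x i = H y i) : ∃ x, ∀ i, x i = H x i := by
  let x : ℕ → W := WellFounded.fix Nat.lt_wfRel.wf
    fun i r => H (fun j => if h : j < i then r j h else 0) i
  refine ⟨x, fun i => ?_⟩
  have h1 : x i = H (fun j => if j < i then x j else 0) i := by
    simp only [x]
    rw [WellFounded.fix_eq]
    simp
  rw [h1]
  exact hH _ _ i fun j hj => if_pos hj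

/-- The coefficient of ∂^{-i} in A ∘ ∑ x_j ∂^{-d-j} is x_i plus an expression in the earlier x_j.
Subtracting it from x_i therefore leaves a function of the earlier unknowns, and a fixed point
solves A U = 1. -/
lemma Monic.exists_right_inv {d : ℤ} {A : Psi D} (hA : Monic d A) :
    ∃ U : Psi D, Monic (-d) U ∧ A * U = 1 := by
  obtain ⟨x, hx⟩ := exists_recursive
    (fun (x : ℕ → V) i => x i - (sym (A * ofSeq (-d) x) (-i) - sym (1 : Psi D) (-i))) (by
      intro x y i h
      have h2 := sym_mul_top hA.ord (ord_ofSeq_sub (D := D) (d := -d) h)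
      rw [mul_sub, sym_sub_apply, hA.1, one_mul, sym_sub_apply, sym_ofSeq, sym_ofSeq,
        show d + (-d - (i : ℤ)) = -i by ring] at h2
      rw [← sub_eq_zero, sub_sub_sub_comm, ← h2, sub_sub_sub_cancel_right, sub_self])
  have hU : A * ofSeq (-d) x = 1 := by
    ext n
    rcases le_or_gt n 0 with hn | hn
    · obtain ⟨i, rfl⟩ : ∃ i : ℕ, n = -i := ⟨(-n).toNat, by omega⟩
      have := hx i
      exact sub_eq_zero.1 (sub_eq_self.1 this.symm)
    · rw [ord_mul hA.ord (ord_ofSeq (-d) x) n (by omega), sym_one_of_ne (by omega)]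
  refine ⟨_, ⟨?_, ord_ofSeq _ _⟩, hU⟩
  have h := sym_mul_top hA.ord (ord_ofSeq (D := D) (-d) x)
  rw [hU, hA.1, one_mul, add_neg_cancel, sym_one_zero] at h
  exact h.symm

lemma Monic.exists_inv {d : ℤ} {A : Psi D} (hA : Monic d A) :
    ∃ U : Psi D, Monic (-d) U ∧ A * U = 1 ∧ U * A = 1 := by
  obtain ⟨U, hU, h⟩ := hA.exists_right_inv
  obtain ⟨W, -, hW⟩ := hU.exists_right_inv
  have : A = W := by rw [← mul_one A, ← hW, ← mul_assoc, h, one_mul]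
  exact ⟨U, hU, h, this ▸ hW⟩

lemma nsmul_eq_zero [CharZero F] {N : ℕ} (hN : 0 < N) {v : V} (h : N • v = 0) : v = 0 := by
  rw [← Nat.cast_smul_eq_nsmul F] at h
  exact (smul_eq_zero_iff_right (Nat.cast_ne_zero.2 hN.ne')).1 h

/-- For the ansatz ∂ + ∑ x_i ∂^{-i}, the coefficient of ∂^{N-1-i} in the N-th power is N x_i plus an
expression in the earlier x_j, so the x_i are found successively after division by N. -/
lemma Monic.exists_root [CharZero F] {N : ℕ} (hN : 0 < N) {L : Psi D} (hL : Monic N L) :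
    ∃ A : Psi D, Monic 1 A ∧ A ^ N = L := by
  have hm : ∀ x : ℕ → V, Monic 1 (mono 1 1 + ofSeq 0 x : Psi D) := fun x => by
    refine ⟨?_, ord_add (ord_mono _ _) ((ord_ofSeq 0 x).mono (by omega))⟩
    rw [sym_add_apply, ord_ofSeq 0 x 1 (by omega), sym_mono, Pi.single_eq_same, add_zero]
  obtain ⟨x, hx⟩ := exists_recursive
    -- The degree is written as N - 1 plus the degree 0 - i of the perturbation, the form delivered
    -- by `pow_leibniz_top`.
    (fun (x : ℕ → V) i => x i - (N : F)⁻¹ • (sym ((mono 1 1 + ofSeq 0 x : Psi D) ^ N) (N - 1 + (0 - i))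
      - sym L (N - 1 + (0 - i)))) (by
      intro x y i h
      have h2 := (pow_leibniz_top (hm x) (hm y)
        (f := fun n => (mono 1 1 + ofSeq 0 x : Psi D) ^ n - (mono 1 1 + ofSeq 0 y : Psi D) ^ n)
        (δ := ofSeq 0 x - ofSeq 0 y) (by simp) (fun n => by
          simp only [pow_succ]; noncomm_ring) (ord_ofSeq_sub h) N).2
      have hN' : (N : F) ≠ 0 := Nat.cast_ne_zero.2 hN.ne'
      rw [sym_sub_apply, sym_sub_apply, sym_ofSeq, sym_ofSeq, ← Nat.cast_smul_eq_nsmul F] at h2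
      have h3 := congrArg (fun v => (N : F)⁻¹ • v) h2
      rw [inv_smul_smul₀ hN'] at h3
      rw [← sub_eq_zero, sub_sub_sub_comm, ← h3, ← smul_sub, ← smul_sub]
      rw [sub_sub_sub_cancel_right, sub_self, smul_zero])
  refine ⟨_, hm x, ?_⟩
  have hp := (hm x).pow N
  rw [mul_one] at hp
  ext n
  rcases lt_trichotomy n N with hn | rfl | hn
  · obtain ⟨i, rfl⟩ : ∃ i : ℕ, n = N - 1 + (0 - i) := ⟨(N - 1 - n).toNat, by omega⟩
    have h := sub_eq_self.1 (hx i).symm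
    rw [smul_eq_zero_iff_right (inv_ne_zero (Nat.cast_ne_zero.2 hN.ne'))] at h
    exact sub_eq_zero.1 h
  · rw [hp.1, hL.1]
  · rw [hp.2 n hn, hL.2 n hn]

lemma Monic.root_unique [CharZero F] {N : ℕ} (hN : 0 < N) {A B : Psi D} (hA : Monic 1 A)
    (hB : Monic 1 B) (h : A ^ N = B ^ N) : A = B := by
  rw [← sub_eq_zero]
  refine eq_zero_of_top fun e he => ?_
  have h2 := (pow_leibniz_top hA hB (f := fun n => A ^ n - B ^ n) (δ := A - B) (by simp)
    (fun n => by simp only [pow_succ]; noncomm_ring) he N).2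
  rw [h, sub_self, sym_zero_apply] at h2
  exact nsmul_eq_zero (F := F) hN h2.symm

/-- A nonzero Θ A would have a nonzero leading coefficient, and N times it would be that of Θ(A^N).
-/
lemma derivation_root [CharZero F] {N : ℕ} (hN : 0 < N) {A : Psi D} (hA : Monic 1 A)
    (Θ : Psi D →+ Psi D) (hΘ : ∀ X Y, Θ (X * Y) = Θ X * Y + X * Θ Y) (h : Θ (A ^ N) = 0) :
    Θ A = 0 := by
  have h1 : Θ 1 = 0 := by simpa using hΘ 1 1
  refine eq_zero_of_top fun e he => ?_
  have h2 := (pow_leibniz_top hA hA (f := fun n => Θ (A ^ n)) (δ := Θ A) (by simpa using h1)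
    (fun n => by rw [pow_succ, hΘ, add_comm]) he N).2
  rw [h, sym_zero_apply] at h2
  exact nsmul_eq_zero (F := F) hN h2.symm

/-- The differential part. -/
def plus : Psi D →+ Psi D where
  toFun A := ⟨symPlus (sym A), by
    obtain ⟨d, hd⟩ := A.bdd
    refine ⟨d, fun n hn => ?_⟩
    rw [symPlus, hd n hn, ite_self]⟩
  map_zero' := by
    refine Subtype.ext (funext fun n => ?_)
    change symPlus (sym 0) n = 0
    rw [map_zero]
    exact ite_self _
  map_add' A B := by
    refine Subtype.ext (funext fun n => ?_)
    change symPlus (sym (A + B)) n = symPlus (sym A) n + symPlus (sym B) n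
    simp only [symPlus, sym_add_apply]
    split_ifs <;> simp

lemma sym_plus (A : Psi D) : sym (plus A) = symPlus (sym A) := rfl

/-- `A` is a differential operator. -/
def IsDiff (A : Psi D) : Prop := ∀ n, n < 0 → sym A n = 0

lemma isDiff_plus (A : Psi D) : IsDiff (plus A) := fun n hn => by
  rw [sym_plus, symPlus, if_neg (by omega)]

lemma IsDiff.plus_eq {A : Psi D} (h : IsDiff A) : plus A = A := by
  ext n
  rw [sym_plus, symPlus]
  split_ifs with hn
  · rfl
  · exact (h n (by omega)).symm

lemma plus_eq_zero {A : Psi D} {d : ℤ} (h : OrdLE d (sym A)) (hd : d < 0) : plus A = 0 := by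
  ext n
  rw [sym_plus, symPlus, sym_zero_apply]
  split_ifs with hn
  · exact h n (by omega)
  · rfl

lemma plus_one : plus (1 : Psi D) = 1 := IsDiff.plus_eq fun _ hn => sym_one_of_ne (by omega)

lemma ord_sub_plus (A : Psi D) : OrdLE (-1) (sym (A - plus A)) := fun n hn => by
  rw [sym_sub_apply, sym_plus, symPlus, if_pos (by omega), sub_self]

lemma choose_eq_zero {q : ℤ} {p : ℕ} (h0 : 0 ≤ q) (h : q < p) : Ring.choose q p = 0 := by
  lift q to ℕ using h0
  rw [Ring.choose_natCast, Nat.choose_eq_zero_of_lt (by omega), Nat.cast_zero]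

/-- In negative degree n, a term with both indices q and n - q + p non-negative has p > q, and then
binom(q, p) = 0. -/
lemma IsDiff.mul {A B : Psi D} (hA : IsDiff A) (hB : IsDiff B) : IsDiff (A * B) := by
  intro n hn
  rw [sym_mul, symMul]
  refine finsum_eq_zero_of_forall_eq_zero fun q => ?_
  by_cases h1 : q.1 < 0
  · rw [hA _ h1]; simp
  by_cases h2 : n - q.1 + q.2 < 0
  · rw [hB _ h2]; simp
  rw [choose_eq_zero (by omega) (by omega), zero_smul]

end Psi

end NCPoisson

namespace NCPoisson

/-! ### Residues -/

section Residues

variable {F V : Type*} [Field F] [Ring V] [Algebra F V] {D : NCDerivation F V}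

lemma choose_neg_int (r : ℤ) (n : ℕ) :
    Ring.choose (-r) n = (-1) ^ n * Ring.choose (r + n - 1) n := by
  rw [Ring.choose_neg, Int.negOnePow_def, zpow_natCast, Units.smul_def]
  simp

lemma trace_iter {G : Type*} [AddCommGroup G] (τ : V →+ G) (hD : ∀ a, τ (D.toLinearMap a) = 0)
    (p : ℕ) (a b : V) : τ (a * D.iter p b) = (-1 : ℤ) ^ p • τ (D.iter p a * b) := by
  induction p generalizing a b with
  | zero => simp [iter_zero]
  | succ p ih =>
    have h := hD (D.iter p a * b)
    rw [D_mul, map_add] at h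
    rw [iter_succ, ih, iter_succ', pow_succ, mul_smul, eq_neg_of_add_eq_zero_right h]
    simp

namespace Psi

/-- The residue of a commutator is a sum of commutators and of a total derivative. -/
lemma trace_res_comm {G : Type*} [AddCommGroup G] (τ : V →+ G) (hτ : ∀ a b, τ (a * b) = τ (b * a))
    (hD : ∀ a, τ (D.toLinearMap a) = 0) (A B : Psi D) :
    τ (sym (A * B) (-1)) = τ (sym (B * A) (-1)) := by
  obtain ⟨d, hA⟩ := A.bdd
  obtain ⟨e, hB⟩ := B.bdd
  -- This involution exchanges the degrees i and j = p - 1 - i of the two coefficients in a residue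
  -- term. The sign in binom(j, p) = (-1)^p binom(i, p) cancels the sign from p integrations by
  -- parts.
  let E : ℤ × ℕ ≃ ℤ × ℕ :=
    { toFun := fun q => (q.2 - q.1 - 1, q.2)
      invFun := fun q => (q.2 - q.1 - 1, q.2)
      left_inv := fun q => by (ext <;> simp); ring
      right_inv := fun q => by (ext <;> simp); ring }
  rw [sym_mul, sym_mul, symMul, symMul, AddMonoidHom.map_finsum _ (symMul_hasFiniteSupport hA hB _),
    AddMonoidHom.map_finsum _ (symMul_hasFiniteSupport hB hA _), ← finsum_comp_equiv E]
  refine finsum_congr fun q => ?_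
  have h1 : (-1 : ℤ) - q.1 + q.2 = q.2 - q.1 - 1 := by ring
  have h2 : (-1 : ℤ) - (q.2 - q.1 - 1) + q.2 = q.1 := by ring
  have h3 : (q.2 : ℤ) - q.1 - 1 = -(q.1 + 1 - q.2) := by ring
  simp only [E, Equiv.coe_fn_mk]
  rw [map_zsmul, map_zsmul, trace_iter τ hD, hτ, smul_smul, h1, h2, h3, choose_neg_int]
  rw [show q.1 + 1 - (q.2 : ℤ) + q.2 - 1 = q.1 by ring, mul_right_comm, ← mul_pow]
  simp

lemma mono_mul_one (i j : ℤ) (a : V) : (mono i a * mono j 1 : Psi D) = mono (i + j) a := by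
  ext n
  rw [mul_mono_apply j 1 (ord_mono i a) (P := (i + j - n).toNat + 1) (by omega),
    Finset.sum_eq_single_of_mem 0 (by simp)]
  · simp only [Ring.choose_zero_right, Nat.cast_zero, add_zero, one_smul, iter_zero, mul_one,
      sym_mono, Pi.single_apply]
    exact if_congr (by omega) rfl rfl
  · intro p _ hp
    rw [iter_one D hp]
    simp

lemma mul_mono_one_apply (A : Psi D) (j n : ℤ) : sym (A * mono j 1) n = sym A (n - j) := by
  obtain ⟨d, hA⟩ := A.bdd
  rw [mul_mono_apply j 1 hA (P := (d + j - n).toNat + 1) (by omega),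
    Finset.sum_eq_single_of_mem 0 (by simp)]
  · simp [iter_zero]
  · intro p _ hp
    rw [iter_one D hp]
    simp

lemma const_mul_apply (a : V) (B : Psi D) (n : ℤ) : sym (mono 0 a * B) n = a * sym B n := by
  obtain ⟨e, hB⟩ := B.bdd
  rw [mono_mul_apply 0 a hB (P := (e - n).toNat + 1) (by omega),
    Finset.sum_eq_single_of_mem 0 (by simp)]
  · simp [iter_zero]
  · intro p _ hp
    rw [Ring.choose_zero_ite, if_neg hp, zero_smul]

/-- The corrections with p ≥ 1 carry binom(p - 1, p) = 0: the residue is linear for right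
multiplication by functions. -/
lemma res_mul_const (A : Psi D) (b : V) : sym (A * mono 0 b) (-1) = sym A (-1) * b := by
  obtain ⟨d, hA⟩ := A.bdd
  rw [mul_mono_apply 0 b hA (P := (d + 1).toNat + 1) (by omega),
    Finset.sum_eq_single_of_mem 0 (by simp)]
  · simp [iter_zero]
  · intro p _ hp
    rw [choose_eq_zero (by omega) (by omega), zero_smul]

lemma isDiff_mono {i : ℤ} (hi : 0 ≤ i) (a : V) : IsDiff (mono i a : Psi D) :=
  fun _ hn => Pi.single_eq_of_ne (by omega) _

lemma natMono_mul_apply (k : ℕ) (B : Psi D) (n : ℤ) : sym (mono k 1 * B) n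
    = ∑ l ∈ Finset.range (k + 1), (k.choose l) • D.iter l (sym B (n - k + l)) := by
  obtain ⟨e, hB⟩ := B.bdd
  rw [mono_mul_apply k 1 hB (P := (k + e - n).toNat + (k + 1)) (by omega)]
  symm
  refine (Finset.sum_congr rfl fun l _ => ?_).trans
    (Finset.sum_subset (Finset.range_mono (by omega)) fun l _ hl => ?_)
  · rw [Ring.choose_natCast, one_mul, natCast_zsmul]
  · rw [Finset.mem_range, not_lt] at hl
    rw [choose_eq_zero (by omega) (by omega), zero_smul]

/-- The residue of `∂^m B`. -/
noncomputable def leftRes (B : Psi D) (m : ℤ) : V := sym (mono m 1 * B) (-1)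

lemma leftRes_mono_mul (B : Psi D) (m j : ℤ) :
    leftRes (mono j 1 * B) m = leftRes B (m + j) := by
  rw [leftRes, ← mul_assoc, mono_mul_one, leftRes]

lemma leftRes_mul_const (B : Psi D) (m : ℤ) (c : V) :
    leftRes (B * mono 0 c) m = leftRes B m * c := by
  rw [leftRes, ← mul_assoc, res_mul_const, leftRes]

lemma leftRes_sub (B B' : Psi D) (m : ℤ) : leftRes (B - B') m = leftRes B m - leftRes B' m := by
  rw [leftRes, mul_sub, sym_sub_apply, leftRes, leftRes]

/-- Writing the coefficients to the right of the powers of ∂ makes them residues of ∂^{-k-1} X. The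
induction strips off the leading term ∂^K c. -/
lemma plus_eq_sum {X : Psi D} {K : ℕ} (hX : OrdLE (K - 1) (sym X)) :
    plus X = ∑ k ∈ Finset.range K, mono k 1 * mono 0 (leftRes X (-k - 1)) := by
  induction K generalizing X with
  | zero => simpa using plus_eq_zero hX (by simp)
  | succ K ih =>
    set c := sym X K with hc
    set M : Psi D := mono K 1 * mono 0 c with hM
    have hXo : OrdLE K (sym X) := hX.mono (by push_cast; omega)
    have hMo : OrdLE K (sym M) := by simpa using ord_mul (ord_mono (D := D) K 1) (ord_mono 0 c)
    have hMtop : sym M K = c := by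
      simpa using sym_mul_top (ord_mono (D := D) K 1) (ord_mono 0 c)
    have hMd : IsDiff M := (isDiff_mono (by omega) 1).mul (isDiff_mono le_rfl c)
    have hX' : OrdLE (K - 1) (sym (X - M)) := by
      intro n hn
      rcases eq_or_ne n K with rfl | hne
      · rw [sym_sub_apply, hMtop, sub_self]
      · exact ord_sub hXo hMo n (by omega)
    have hlast : leftRes X (-K - 1) = c := by
      have h := sym_mul_top (ord_mono (D := D) (-K - 1) 1) hXo
      rw [sym_mono, Pi.single_eq_same, one_mul, show -(K : ℤ) - 1 + K = -1 by ring] at h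
      exact h
    have hsplit : plus X = plus (X - M) + M := by
      rw [map_sub, hMd.plus_eq, sub_add_cancel]
    rw [hsplit, ih hX', Finset.sum_range_succ, hlast]
    congr 1
    refine Finset.sum_congr rfl fun k hk => ?_
    have := Finset.mem_range.1 hk
    -- The stripped term does not affect the lower residues: for k < K, ∂^{-k-1} ∂^K c is a
    -- differential operator.
    have h0 : leftRes (mono 0 c : Psi D) (-k - 1 + K) = 0 :=
      ((isDiff_mono (by omega) 1).mul (isDiff_mono le_rfl c)) _ (by omega)
    rw [leftRes_sub, hM, leftRes_mono_mul, h0, sub_zero]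

lemma sum_choose_alternating (b : ℤ) (u : ℕ) :
    ∑ s ∈ Finset.range (u + 1), (-1) ^ s * Ring.choose b s * Ring.choose (b - s) (u - s)
      = if u = 0 then 1 else 0 := by
  have h : ∀ s ∈ Finset.range (u + 1),
      (-1) ^ s * Ring.choose b s * Ring.choose (b - s) (u - s)
        = Ring.choose b u * ((-1) ^ s * (u.choose s : ℤ)) := by
    intro s hs
    have := Ring.choose_smul_choose b (Nat.lt_succ_iff.1 (Finset.mem_range.1 hs))
    rw [nsmul_eq_mul] at this
    linear_combination (-(-1) ^ s) * this
  rw [Finset.sum_congr rfl h, ← Finset.mul_sum, Int.alternating_sum_range_choose]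
  split_ifs with hu
  · rw [hu, Ring.choose_zero_right, mul_one]
  · rw [mul_zero]

/-- Binomial inversion of the formula for res(∂^m W) in terms of the coefficients of W: after
regrouping by the total derivative order u, `sum_choose_alternating` leaves only u = 0. The bound on
S makes all discarded coefficients lie above the order of W. -/
lemma sym_eq_sum_leftRes {W : Psi D} {w : ℤ} (hW : OrdLE w (sym W)) (b : ℤ) {S : ℕ}
    (hS : b + w + 1 < S) : sym W (-1 - b)
      = ∑ s ∈ Finset.range S, ((-1) ^ s * Ring.choose b s) • D.iter s (leftRes W (b - s)) := by
  have h : ∀ s ∈ Finset.range S,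
      ((-1) ^ s * Ring.choose b s) • D.iter s (leftRes W (b - s))
        = ∑ t ∈ Finset.range (S - s), ((-1) ^ s * Ring.choose b s * Ring.choose (b - s) t) •
            D.iter (s + t) (sym W (-1 - b + (s + t : ℕ))) := by
    intro s hs
    have := Finset.mem_range.1 hs
    rw [leftRes, mono_mul_apply _ 1 hW (P := S - s) (by omega), map_sum, Finset.smul_sum]
    refine Finset.sum_congr rfl fun t _ => ?_
    rw [one_mul, map_zsmul, smul_smul, iter_add]
    congr 1
    refine congrArg (fun m => D.iter s (D.iter t (sym W m))) ?_
    push_cast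
    ring
  rw [Finset.sum_congr rfl h, ← Finset.sum_range_diag_flip S fun s t =>
    ((-1) ^ s * Ring.choose b s * Ring.choose (b - s) t) •
      D.iter (s + t) (sym W (-1 - b + (s + t : ℕ)))]
  have h2 : ∀ u ∈ Finset.range S, ∑ s ∈ Finset.range (u + 1),
      ((-1) ^ s * Ring.choose b s * Ring.choose (b - s) (u - s)) •
        D.iter (s + (u - s)) (sym W (-1 - b + (s + (u - s) : ℕ)))
      = (if u = 0 then (1 : ℤ) else 0) • D.iter u (sym W (-1 - b + u)) := by
    intro u _
    rw [← sum_choose_alternating b u, Finset.sum_smul]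
    refine Finset.sum_congr rfl fun s hs => ?_
    rw [Nat.add_sub_cancel' (Nat.lt_succ_iff.1 (Finset.mem_range.1 hs))]
  rw [Finset.sum_congr rfl h2]
  rcases Nat.eq_zero_or_pos S with rfl | hS0
  · rw [hW _ (by simp at hS; omega)]
    simp
  · rw [Finset.sum_eq_single_of_mem 0 (Finset.mem_range.2 hS0)]
    · simp [iter_zero]
    · intro u _ hu
      rw [if_neg hu, zero_smul]

lemma ord_sub_sum_mono {C : Psi D} {hi : ℤ} (hC : OrdLE hi (sym C)) (lo : ℤ) :
    OrdLE (lo - 1) (sym (C - ∑ b ∈ Finset.Icc lo hi, mono b (sym C b))) := by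
  intro n hn
  rw [sym_sub_apply, map_sum, Finset.sum_apply]
  simp only [sym_mono]
  rw [Finset.sum_pi_single]
  split_ifs with h
  · rw [sub_self]
  · rw [hC n (by simp only [Finset.mem_Icc, not_and, not_le] at h; exact h (by omega)), sub_zero]

/-- Cutting C off below degree `lo` changes Y C only below degree n. -/
lemma mul_apply_eq_sum {Y C : Psi D} {d lo hi n : ℤ} (hY : OrdLE d (sym Y))
    (hC : OrdLE hi (sym C)) (hlo : lo ≤ n - d) :
    sym (Y * C) n = ∑ b ∈ Finset.Icc lo hi, sym (Y * mono b (sym C b)) n := by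
  have h := ord_mul hY (ord_sub_sum_mono hC lo) n (by omega)
  rw [mul_sub, sym_sub_apply, sub_eq_zero, Finset.mul_sum, map_sum, Finset.sum_apply] at h
  exact h

lemma sum_triangle (lo hi : ℤ) (f : ℤ → ℕ → V) :
    ∑ m ∈ Finset.Ico lo hi, ∑ s ∈ Finset.range (hi - m).toNat, f m s
      = ∑ b ∈ Finset.Ico lo hi, ∑ s ∈ Finset.range (b - lo + 1).toNat, f (b - s) s := by
  rw [Finset.sum_sigma', Finset.sum_sigma']
  refine Finset.sum_nbij' (fun z => ⟨z.1 + z.2, z.2⟩) (fun z => ⟨z.1 - z.2, z.2⟩) ?_ ?_ ?_ ?_ ?_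
  · rintro ⟨m, s⟩ h
    simp only [Finset.mem_sigma, Finset.mem_Ico, Finset.mem_range] at h ⊢
    omega
  · rintro ⟨m, s⟩ h
    simp only [Finset.mem_sigma, Finset.mem_Ico, Finset.mem_range] at h ⊢
    omega
  · rintro ⟨m, s⟩ _
    simp
  · rintro ⟨m, s⟩ _
    simp
  · rintro ⟨m, s⟩ _
    simp

/-- The residue of `Y C` in terms of the residues of the `∂^m Y`. -/
lemma res_mul_eq_sum {Y C : Psi D} {y lo N : ℤ} (hY : OrdLE y (sym Y)) (hC : OrdLE N (sym C))
    (hlo : lo + y < 0) : sym (Y * C) (-1) = ∑ m ∈ Finset.Ico lo (N + 1),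
      ∑ s ∈ Finset.range (N + 1 - m).toNat, ((-1) ^ s * Ring.choose (m + s : ℤ) s) •
        D.iter s (leftRes Y m * sym C (m + s)) := by
  rw [sum_triangle lo (N + 1) fun m s => ((-1) ^ s * Ring.choose (m + s : ℤ) s) •
        D.iter s (leftRes Y m * sym C (m + s)), mul_apply_eq_sum hY hC (lo := lo) (by omega)]
  refine Finset.sum_congr (by ext; simp) fun b _ => ?_
  have h1 : (mono b (sym C b) : Psi D) = mono 0 (sym C b) * mono b 1 := by
    rw [mono_mul_one, zero_add]
  have h2 : OrdLE y (sym (Y * mono 0 (sym C b))) := by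
    simpa using ord_mul hY (ord_mono 0 (sym C b))
  rw [h1, ← mul_assoc, mul_mono_one_apply,
    sym_eq_sum_leftRes h2 b (S := (b - lo + 1).toNat) (by omega)]
  refine Finset.sum_congr rfl fun s _ => ?_
  rw [leftRes_mul_const, sub_add_cancel]

/-- Taking differential parts commutes with left multiplication by functions, and ∂^j B has negative
order for j < `lo`. -/
lemma plus_mul_eq_sum {A B : Psi D} {N e lo : ℤ} (hA : OrdLE N (sym A)) (hB : OrdLE e (sym B))
    (hlo : lo + e ≤ 0) :
    plus (A * B) = ∑ j ∈ Finset.Icc lo N, mono 0 (sym A j) * plus (mono j 1 * B) := by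
  ext n
  rw [map_sum, Finset.sum_apply, sym_plus, symPlus]
  simp only [const_mul_apply, sym_plus, symPlus]
  split_ifs with hn
  · rw [sym_mul, symMul_eq_sum hA hB (lo := lo) (hi := N) (P := (N + e + 1).toNat + 1) (by omega)
      le_rfl (by omega)]
    refine Finset.sum_congr rfl fun j hj => ?_
    have := Finset.mem_Icc.1 hj
    rw [mono_mul_apply j 1 hB (P := (N + e + 1).toNat + 1) (by omega), Finset.mul_sum]
    refine Finset.sum_congr rfl fun p _ => ?_
    rw [one_mul, mul_smul_comm]
  · simp

/-- The coefficients of `(A B)_+ C` in terms of the residues of the `∂^m B`. -/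
lemma plus_mul_mul_apply {A B : Psi D} (C : Psi D) {N e lo : ℤ} (hA : OrdLE N (sym A))
    (hB : OrdLE e (sym B)) (hlo : lo + e < 0) (n : ℤ) :
    sym (plus (A * B) * C) n = ∑ m ∈ Finset.Ico lo N, ∑ k ∈ Finset.range (N - m).toNat,
      ∑ l ∈ Finset.range (k + 1), (k.choose l) •
        (sym A (m + k + 1) * D.iter l (leftRes B m * sym C (n - k + l))) := by
  rw [sum_triangle lo N fun m k => ∑ l ∈ Finset.range (k + 1), (k.choose l) •
        (sym A (m + k + 1) * D.iter l (leftRes B m * sym C (n - k + l))),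
    plus_mul_eq_sum hA hB (lo := lo + 1) (by omega), Finset.sum_mul, map_sum, Finset.sum_apply]
  -- The degree of the coefficient of A is j = m + k + 1, so the index of the triangular sum is j -
  -- 1.
  refine Finset.sum_nbij' (fun j => j - 1) (fun j => j + 1) ?_ ?_ ?_ ?_ fun j hj => ?_
  · intro j hj; simp only [Finset.mem_Icc, Finset.mem_Ico] at hj ⊢; omega
  · intro j hj; simp only [Finset.mem_Icc, Finset.mem_Ico] at hj ⊢; omega
  · intro j _; ring
  · intro j _; ring
  rw [Finset.mem_Icc] at hj
  have h1 : OrdLE ((j - 1 - lo + 1).toNat - 1) (sym (mono j 1 * B)) :=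
    (ord_mul (ord_mono j 1) hB).mono (by omega)
  rw [plus_eq_sum h1, mul_assoc, const_mul_apply, Finset.sum_mul, map_sum, Finset.sum_apply,
    Finset.mul_sum]
  refine Finset.sum_congr rfl fun k _ => ?_
  rw [mul_assoc, natMono_mul_apply, Finset.mul_sum]
  refine Finset.sum_congr rfl fun l _ => ?_
  rw [const_mul_apply, mul_smul_comm, leftRes_mono_mul,
    show -(k : ℤ) - 1 + j = j - 1 - k by ring, show j - 1 - (k : ℤ) + k + 1 = j by ring]

/-- The coefficients of `A (B C)_+` in terms of the residues of the `∂^m B`. -/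
lemma mul_plus_mul_apply {A B C : Psi D} {N e lo : ℤ} (hA : OrdLE N (sym A))
    (hB : OrdLE e (sym B)) (hC : OrdLE N (sym C)) (hlo : lo + e < 0) (n : ℤ) :
    sym (A * plus (B * C)) n = ∑ m ∈ Finset.Ico lo N, ∑ k ∈ Finset.range (N - m).toNat,
      ∑ s ∈ Finset.range (N - m - k).toNat, ∑ p ∈ Finset.range (N - n + k + 1).toNat,
        ((-1 : ℤ) ^ s * Ring.choose (m + k + 1 + s : ℤ) s * Ring.choose (n + p : ℤ) p) •
          (sym A (n - k + p) * D.iter (p + s) (leftRes B m * sym C (m + k + 1 + s))) := by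
  set K := (N - lo).toNat with hK
  -- The range of k is made independent of m, so that the two sums can be exchanged; the added terms
  -- have an empty range of s.
  have h1 : ∀ m ∈ Finset.Ico lo N, ∑ k ∈ Finset.range (N - m).toNat,
      ∑ s ∈ Finset.range (N - m - k).toNat, ∑ p ∈ Finset.range (N - n + k + 1).toNat,
        ((-1 : ℤ) ^ s * Ring.choose (m + k + 1 + s : ℤ) s * Ring.choose (n + p : ℤ) p) •
          (sym A (n - k + p) * D.iter (p + s) (leftRes B m * sym C (m + k + 1 + s)))
      = ∑ k ∈ Finset.range K, ∑ s ∈ Finset.range (N - m - k).toNat,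
        ∑ p ∈ Finset.range (N - n + k + 1).toNat,
        ((-1 : ℤ) ^ s * Ring.choose (m + k + 1 + s : ℤ) s * Ring.choose (n + p : ℤ) p) •
          (sym A (n - k + p) * D.iter (p + s) (leftRes B m * sym C (m + k + 1 + s))) := by
    intro m hm
    rw [Finset.mem_Ico] at hm
    refine Finset.sum_subset (Finset.range_mono (by omega)) fun k _ hk => ?_
    rw [Finset.mem_range, not_lt] at hk
    rw [show (N - m - k).toNat = 0 by omega, Finset.range_zero, Finset.sum_empty]
  rw [Finset.sum_congr rfl h1, Finset.sum_comm]
  have h2 : OrdLE (K - 1) (sym (B * C)) := (ord_mul hB hC).mono (by omega)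
  rw [plus_eq_sum h2, Finset.mul_sum, map_sum, Finset.sum_apply]
  refine Finset.sum_congr rfl fun k _ => ?_
  rw [← mul_assoc, mul_mono_apply 0 _ (ord_mul hA (ord_mono (D := D) k 1))
    (P := (N - n + k + 1).toNat) (by omega)]
  have h3 : OrdLE (-k - 1 + e) (sym (mono (-k - 1) 1 * B)) := ord_mul (ord_mono _ _) hB
  have hg : leftRes (B * C) (-k - 1) = ∑ m ∈ Finset.Ico lo N,
      ∑ s ∈ Finset.range (N - m - k).toNat, ((-1) ^ s * Ring.choose (m + k + 1 + s : ℤ) s) •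
        D.iter s (leftRes B m * sym C (m + k + 1 + s)) := by
    rw [leftRes, ← mul_assoc, res_mul_eq_sum h3 hC (lo := lo + k + 1) (by omega)]
    have h4 : Finset.Ico lo (N - k) ⊆ Finset.Ico lo N := Finset.Ico_subset_Ico_right (by omega)
    rw [← Finset.sum_subset h4 fun m hm hm' => ?_]
    · refine Finset.sum_nbij' (fun m => m - k - 1) (fun m => m + k + 1) ?_ ?_ ?_ ?_ fun m _ => ?_
      · intro j hj; simp only [Finset.mem_Ico] at hj ⊢; omega
      · intro j hj; simp only [Finset.mem_Ico] at hj ⊢; omega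
      · intro j _; ring
      · intro j _; ring
      rw [show m - k - 1 + (k : ℤ) + 1 = m by ring,
        show N - (m - (k : ℤ) - 1) - k = N + 1 - m by ring]
      refine Finset.sum_congr rfl fun s _ => ?_
      rw [leftRes_mono_mul, show m + (-(k : ℤ) - 1) = m - k - 1 by ring]
    · rw [Finset.mem_Ico] at hm hm'
      rw [show (N - m - k).toNat = 0 by omega, Finset.range_zero, Finset.sum_empty]
  rw [hg]
  simp only [map_sum, Finset.mul_sum, Finset.smul_sum]
  rw [Finset.sum_comm]
  refine Finset.sum_congr rfl fun m _ => ?_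
  rw [Finset.sum_comm]
  refine Finset.sum_congr rfl fun s _ => Finset.sum_congr rfl fun p _ => ?_
  rw [mul_mono_one_apply, map_zsmul, mul_smul_comm, smul_smul, iter_add, sub_zero,
    show n + (p : ℤ) - k = n - k + p by ring, mul_comm (Ring.choose (n + (p : ℤ)) p)]

end Psi

/-! ### Evaluation of the Adler formula -/

/-- The map `x ⊗ y λ^k ↦ x (∂^k b) y`. -/
noncomputable def evAt (D : NCDerivation F V) (b : V) : (V ⊗[F] V)[X] →ₗ[F] V :=
  ((LinearMap.mul' F V).comp ((Polynomial.lcoeff (V ⊗[F] V) 0).restrictScalars F)).comp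
    (arrowR D b)

lemma evAt_apply (b : V) (P : (V ⊗[F] V)[X]) :
    evAt D b P = LinearMap.mul' F V ((arrowR D b P).coeff 0) := rfl

lemma evAt_monomial (b x y : V) (k : ℕ) :
    evAt D b (Polynomial.monomial k (x ⊗ₜ[F] y)) = x * D.iter k b * y := by
  rw [evAt_apply, arrowR_monomial, Polynomial.finsetSum_coeff,
    Finset.sum_eq_single_of_mem k (by simp)]
  · simp
  · intro j hj hjk
    have := Finset.mem_range.1 hj
    rw [Polynomial.coeff_smul, Polynomial.coeff_monomial, if_neg (by omega), smul_zero]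

/-- Under `evAt` the variable λ differentiates b while ∂ differentiates c, so (λ + ∂)^s
differentiates the product b c by the Leibniz rule. -/
lemma evAt_tmulShift (b a c : V) (s : ℕ) :
    evAt D b (tmulShift D a s c) = a * D.iter s (b * c) := by
  rw [tmulShift, map_sum, iter_mul,
    Finset.Nat.sum_antidiagonal_eq_sum_range_succ
      (fun i j => (s.choose i) • (D.iter i b * D.iter j c)) s, Finset.mul_sum,
    ← Finset.sum_range_reflect]
  refine Finset.sum_congr rfl fun t ht => ?_
  have ht := Nat.lt_succ_iff.1 (Finset.mem_range.1 ht)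
  rw [map_nsmul, evAt_monomial, mul_smul_comm, show s + 1 - 1 - t = s - t by omega,
    Nat.sub_sub_self ht, Nat.choose_symm ht, mul_assoc]

open Psi in
/-- The Adler formula, evaluated at the residues of the `∂^m B`. -/
lemma sum_evAt_adlerCoeff {A B C : Psi D} {N : ℕ} {e lo : ℤ} (hA : OrdLE N (sym A))
    (hB : OrdLE e (sym B)) (hC : OrdLE N (sym C)) (hlo : lo + e < 0) (n : ℤ) :
    ∑ m ∈ Finset.Ico lo N, evAt D (leftRes B m) (adlerCoeff D N (sym A) (sym C) m n)
      = sym (plus (A * B) * C - A * plus (B * C)) n := by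
  rw [sym_sub_apply, plus_mul_mul_apply C hA hB hlo, mul_plus_mul_apply hA hB hC hlo,
    ← Finset.sum_sub_distrib]
  refine Finset.sum_congr rfl fun m _ => ?_
  rw [adlerCoeff, map_sum, ← Finset.sum_sub_distrib]
  refine Finset.sum_congr rfl fun k _ => ?_
  simp only [map_sub, map_sum, map_zsmul, map_nsmul, evAt_tmulShift]

end Residues

end NCPoisson

namespace NCPoisson

/-! ### The support of the Adler formula -/

section Adler

variable {F V : Type*} [Field F] [Ring V] [Algebra F V] {D : NCDerivation F V}

lemma tmulShift_zero_left (s : ℕ) (c : V) : tmulShift D 0 s c = 0 := by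
  simp [tmulShift]

lemma tmulShift_zero_right (a : V) (s : ℕ) : tmulShift D a s 0 = 0 := by
  simp [tmulShift]

lemma tmulShift_ne_zero {a c : V} {s : ℕ} (h : tmulShift D a s c ≠ 0) : a ≠ 0 ∧ c ≠ 0 := by
  constructor
  · rintro rfl
    exact h (tmulShift_zero_left s c)
  · rintro rfl
    exact h (tmulShift_zero_right a s)

lemma OrdLE.le_of_ne {d n : ℤ} {A : ℤ → V} (hA : OrdLE d A) (h : A n ≠ 0) : n ≤ d := by
  by_contra hn
  exact h (hA n (by omega))

/-- Vandermonde's identity after binom(n + p, p) = (-1)^p binom(-n - 1, p). It rewrites the binomial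
of the first half of `adlerCoeff` as a sum of coefficients of the shape found in the second half. -/
lemma sum_choose_adler (n : ℤ) (k l : ℕ) :
    ∑ s ∈ Finset.range (l + 1), ((-1 : ℤ) ^ s * Ring.choose (n - k + l : ℤ) s *
      Ring.choose (n + (l - s : ℕ) : ℤ) (l - s)) = k.choose l := by
  have h1 : Ring.choose ((n - k + l) + -(n + 1) : ℤ) l = (-1) ^ l * (k.choose l : ℤ) := by
    rw [show (n - k + l) + -(n + 1) = -((k : ℤ) + 1 - l) by ring, choose_neg_int,
      show (k : ℤ) + 1 - l + l - 1 = k by ring, Ring.choose_natCast]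
  rw [Ring.add_choose_eq _ (Commute.all _ _),
    Finset.Nat.sum_antidiagonal_eq_sum_range_succ
      (fun i j => Ring.choose (n - k + l : ℤ) i * Ring.choose (-(n + 1)) j) l] at h1
  have h2 : (k.choose l : ℤ) = (-1) ^ l * ((-1) ^ l * (k.choose l : ℤ)) := by
    rw [← mul_assoc, ← mul_pow]
    simp
  rw [h2, ← h1, Finset.mul_sum]
  refine Finset.sum_congr rfl fun s hs => ?_
  have hs := Nat.lt_succ_iff.1 (Finset.mem_range.1 hs)
  obtain ⟨p, rfl⟩ := Nat.exists_eq_add_of_le hs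
  rw [Nat.add_sub_cancel_left, choose_neg_int, show n + 1 + (p : ℤ) - 1 = n + p by ring]
  have h3 : (-1 : ℤ) ^ (s + p) * (-1) ^ p = (-1) ^ s := by
    rw [pow_add, mul_assoc, ← mul_pow]
    simp
  linear_combination (-Ring.choose (n - k + (s + p : ℕ)) s * Ring.choose (n + p : ℤ) p) * h3

/-- After `sum_choose_adler` both halves consist of the same terms in A_i and C_j with i + j = m + n
+ 1 + s + p. The first half keeps those with i ≥ m + 1, the second those with i ≤ n + p. The
hypotheses say that each restriction is automatic for the terms present in the other half, so the
halves cancel. -/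
lemma adlerCoeff_eq_zero {N : ℕ} {A C : ℤ → V} {m n : ℤ} (hA : OrdLE N A) (hC : OrdLE N C)
    (h1 : ∀ i j, A i ≠ 0 → C j ≠ 0 → m + n + 1 ≤ i + j → m + 1 ≤ i)
    (h2 : ∀ i j, A i ≠ 0 → C j ≠ 0 → ∀ s p : ℕ, i + j = m + n + 1 + s + p →
      Ring.choose j s ≠ 0 → Ring.choose (n + p) p ≠ 0 → i ≤ n + p) :
    adlerCoeff D N A C m n = 0 := by
  -- A uniform bound for l: it exceeds every k in range, and also s + p, since i + j ≤ 2N.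
  set M : ℕ := (2 * N - m - n).toNat + (N - m).toNat with hM
  have e1 : ∑ k ∈ Finset.range (N - m).toNat, ∑ l ∈ Finset.range (k + 1),
      (k.choose l) • tmulShift D (A (m + k + 1)) l (C (n - k + l))
      = ∑ x ∈ (Finset.range (N - m).toNat).sigma fun _ => (Finset.range M).sigma
          fun l => Finset.range (l + 1),
        ((-1 : ℤ) ^ x.2.2 * Ring.choose (n - x.1 + x.2.1 : ℤ) x.2.2 *
          Ring.choose (n + (x.2.1 - x.2.2 : ℕ) : ℤ) (x.2.1 - x.2.2)) •
            tmulShift D (A (m + x.1 + 1)) x.2.1 (C (n - x.1 + x.2.1)) := by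
    rw [Finset.sum_sigma]
    refine Finset.sum_congr rfl fun k hk => ?_
    have hk := Finset.mem_range.1 hk
    rw [Finset.sum_sigma]
    simp only [← Finset.sum_smul, sum_choose_adler, natCast_zsmul]
    refine Finset.sum_subset (Finset.range_mono (by omega)) fun l _ hl => ?_
    rw [Finset.mem_range] at hl
    rw [Nat.choose_eq_zero_of_lt (by omega), zero_smul]
  have e2 : ∑ k ∈ Finset.range (N - m).toNat, ∑ s ∈ Finset.range (N - m - k).toNat,
      ∑ p ∈ Finset.range (N - n + k + 1).toNat,
          ((-1 : ℤ) ^ s * Ring.choose (m + k + 1 + s : ℤ) s * Ring.choose (n + p : ℤ) p) •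
            tmulShift D (A (n - k + p)) (p + s) (C (m + k + 1 + s))
      = ∑ x ∈ (Finset.range (N - m).toNat).sigma fun k => (Finset.range (N - m - k).toNat).sigma
          fun _ => Finset.range (N - n + k + 1).toNat,
          ((-1 : ℤ) ^ x.2.1 * Ring.choose (m + x.1 + 1 + x.2.1 : ℤ) x.2.1 *
            Ring.choose (n + x.2.2 : ℤ) x.2.2) •
            tmulShift D (A (n - x.1 + x.2.2)) (x.2.2 + x.2.1) (C (m + x.1 + 1 + x.2.1)) := by
    rw [Finset.sum_sigma]
    refine Finset.sum_congr rfl fun k hk => ?_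
    rw [Finset.sum_sigma]
  rw [adlerCoeff, Finset.sum_sub_distrib, e1, e2, sub_eq_zero]
  symm
  refine Finset.sum_bij_ne_zero
    -- The new k is i - m - 1 with i = n - k + p, and l = p + s. The truncation `toNat` is harmless
    -- because nonzero terms have i ≥ m + 1.
    (fun x _ _ => ⟨(n - x.1 + x.2.2 - m - 1).toNat, x.2.2 + x.2.1, x.2.1⟩) ?_ ?_ ?_ ?_
  · rintro ⟨k, s, p⟩ hx hne
    simp only [Finset.mem_sigma, Finset.mem_range] at hx hne ⊢
    obtain ⟨hA', hC'⟩ := tmulShift_ne_zero (right_ne_zero_of_smul hne)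
    have b1 := hA.le_of_ne hA'
    have b2 := hC.le_of_ne hC'
    have b3 := h1 _ _ hA' hC' (by omega)
    omega
  · rintro ⟨k, s, p⟩ hx hne ⟨k', s', p'⟩ hx' hne' h
    simp only [Finset.mem_sigma, Finset.mem_range] at hx hne hx' hne' h
    obtain ⟨hA1, hC1⟩ := tmulShift_ne_zero (right_ne_zero_of_smul hne)
    have b3 := h1 _ _ hA1 hC1 (by omega)
    obtain ⟨hA2, hC2⟩ := tmulShift_ne_zero (right_ne_zero_of_smul hne')
    have b4 := h1 _ _ hA2 hC2 (by omega)
    simp only [Sigma.mk.injEq, heq_eq_eq] at h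
    obtain ⟨c1, c2, c3⟩ := h
    obtain rfl : s = s' := c3
    obtain rfl : p = p' := by omega
    obtain rfl : k = k' := by omega
    rfl
  · rintro ⟨k, l, s⟩ hx hne
    simp only [Finset.mem_sigma, Finset.mem_range] at hx hne
    obtain ⟨hA', hC'⟩ := tmulShift_ne_zero (right_ne_zero_of_smul hne)
    have hc := left_ne_zero_of_smul hne
    have b1 := hA.le_of_ne hA'
    have b2 := hC.le_of_ne hC'
    have b3 := h2 _ _ hA' hC' s (l - s) (by omega) (right_ne_zero_of_mul (left_ne_zero_of_mul hc))
      (right_ne_zero_of_mul hc)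
    have f1 : (((n + (l - s : ℕ) - m - k - 1).toNat : ℕ) : ℤ) = n + (l - s : ℕ) - m - k - 1 := by
      omega
    have g1 : m + (n + (l - s : ℕ) - m - k - 1) + 1 + s = n - k + l := by omega
    have g2 : n - (n + (l - s : ℕ) - m - k - 1) + (l - s : ℕ) = m + k + 1 := by omega
    have g3 : l - s + s = l := by omega
    refine ⟨⟨(n + (l - s : ℕ) - m - k - 1).toNat, s, l - s⟩, ?_, ?_, ?_⟩
    · simp only [Finset.mem_sigma, Finset.mem_range]
      omega
    · simp only [f1, g1, g2, g3]
      exact hne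
    · simp only [f1, g2, g3]
      congr 1
      omega
  · rintro ⟨k, s, p⟩ hx hne
    simp only [Finset.mem_sigma, Finset.mem_range] at hx hne ⊢
    obtain ⟨hA', hC'⟩ := tmulShift_ne_zero (right_ne_zero_of_smul hne)
    have b3 := h1 _ _ hA' hC' (by omega)
    have f1 : (((n - k + p - m - 1).toNat : ℕ) : ℤ) = n - k + p - m - 1 := by omega
    have g1 : m + (n - k + p - m - 1) + 1 = n - k + p := by omega
    have g2 : n - (n - k + p - m - 1) + ((p + s : ℕ) : ℤ) = m + k + 1 + s := by omega
    rw [f1, g1, g2, Nat.add_sub_cancel]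

lemma adlerCoeff_of_le_left {N : ℕ} (A C : ℤ → V) {m : ℤ} (hm : N ≤ m) (n : ℤ) :
    adlerCoeff D N A C m n = 0 := by
  rw [adlerCoeff, show ((N : ℤ) - m).toNat = 0 by omega, Finset.range_zero, Finset.sum_empty]

lemma adlerCoeff_of_le_right {N : ℕ} {A C : ℤ → V} (hA : OrdLE N A) (hC : OrdLE N C) (m : ℤ)
    {n : ℤ} (hn : N ≤ n) : adlerCoeff D N A C m n = 0 := by
  refine adlerCoeff_eq_zero hA hC (fun i j hi hj h => ?_) fun i j hi hj s p h _ _ => ?_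
  · have := hC.le_of_ne hj
    omega
  · have := hA.le_of_ne hi
    omega

lemma adlerCoeff_of_neg_left {N : ℕ} {A C : ℤ → V} (hA : OrdLE N A) (hC : OrdLE N C)
    (hA0 : ∀ i < 0, A i = 0) (hC0 : ∀ i < 0, C i = 0) {m : ℤ} (hm : m < 0) (n : ℤ) :
    adlerCoeff D N A C m n = 0 := by
  refine adlerCoeff_eq_zero hA hC (fun i j hi hj h => ?_) fun i j hi hj s p h hs _ => ?_
  · have : ¬ i < 0 := fun h => hi (hA0 i h)
    omega
  · have h1 : ¬ j < 0 := fun h => hj (hC0 j h)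
    have h2 : ¬ j < s := fun h => hs (Psi.choose_eq_zero (by omega) h)
    omega

/-- No cancellation is needed here. The first half involves C in negative degree, since l ≤ k. In
the second, either A has negative degree or 0 ≤ n + p < p and the binomial vanishes. -/
lemma adlerCoeff_of_neg_right {N : ℕ} {A C : ℤ → V}
    (hA0 : ∀ i < 0, A i = 0) (hC0 : ∀ i < 0, C i = 0) (m : ℤ) {n : ℤ} (hn : n < 0) :
    adlerCoeff D N A C m n = 0 := by
  rw [adlerCoeff]
  refine Finset.sum_eq_zero fun k _ => ?_
  rw [Finset.sum_eq_zero fun l hl => ?_, zero_sub, neg_eq_zero]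
  · refine Finset.sum_eq_zero fun s _ => Finset.sum_eq_zero fun p _ => ?_
    by_cases h : n - k + p < 0
    · rw [hA0 _ h, tmulShift_zero_left, smul_zero]
    · rw [Psi.choose_eq_zero (q := n + p) (by omega) (by omega), mul_zero, zero_smul]
  · have := Finset.mem_range.1 hl
    rw [hC0 _ (by omega), tmulShift_zero_right, smul_zero]

end Adler

/-! ### The generic operator and the defining identities of the brackets -/

section Generic

variable {F : Type*} [Field F] {N : ℕ} {I : Set ℤ}

lemma ordLE_symOne {V : Type*} [Ring V] (N : ℕ) : OrdLE N (symOne V) :=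
  (ordLE_single 0 1).mono (by omega)

lemma symOne_neg {V : Type*} [Ring V] (i : ℤ) (hi : i < 0) : symOne V i = 0 :=
  Pi.single_eq_of_ne (by omega) _

lemma genericL_top : genericL F N I N = 1 := by rw [genericL, if_pos rfl]

lemma genericL_mem {n : ℤ} (hn : n ≠ N) (h : -n - 1 ∈ I) :
    genericL F N I n = gen F I ⟨-n - 1, h⟩ 0 := by rw [genericL, if_neg hn, dif_pos h]

lemma genericL_notMem {n : ℤ} (hn : n ≠ N) (h : -n - 1 ∉ I) : genericL F N I n = 0 := by
  rw [genericL, if_neg hn, dif_neg h]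

lemma ordLE_genericL (hI : I = Set.Ici (-(N : ℤ)) ∨ I = Set.Ico (-(N : ℤ)) 0) :
    OrdLE N (genericL F N I) := by
  intro n hn
  refine genericL_notMem hn.ne' ?_
  rcases hI with rfl | rfl
  · rw [Set.mem_Ici]; omega
  · rw [Set.mem_Ico]; omega

lemma monic_genericL (hI : I = Set.Ici (-(N : ℤ)) ∨ I = Set.Ico (-(N : ℤ)) 0) :
    IsMonicSymbol N (genericL F N I) := ⟨genericL_top, ordLE_genericL hI⟩

lemma genericL_neg {i : ℤ} (hi : i < 0) : genericL F N (Set.Ico (-(N : ℤ)) 0) i = 0 := by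
  refine genericL_notMem (by omega) ?_
  rw [Set.mem_Ico]; omega

lemma br_one_right {V : Type*} [Ring V] [Algebra F V] {D : NCDerivation F V}
    (B : TwoFoldLambdaBracket D) (f : V) : B.br f 1 = 0 := by
  have h1 := B.leibniz_left f 1 1
  have h2 : ∀ P : (V ⊗[F] V)[X], coeffwise (outR (F := F) 1) P = P := outRHom_one
  have h3 : ∀ P : (V ⊗[F] V)[X], coeffwise (outL (F := F) 1) P = P := outLHom_one
  rw [h2, h3, one_mul] at h1
  exact left_eq_add.1 h1

lemma br_one_left {V : Type*} [Ring V] [Algebra F V] {D : NCDerivation F V}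
    (B : TwoFoldLambdaBracket D) (f : V) : B.br 1 f = 0 := by
  have h1 := B.leibniz_right 1 1 f
  rw [arrowR_one, arrowL_one, one_mul] at h1
  exact left_eq_add.1 h1

/-- A bracket given on the generators by a symbol `R` satisfies the identity
`{{L_m _λ L_n}} = R m n` as soon as `R` is supported on the indices of generators. -/
lemma br_genericL (hI : I = Set.Ici (-(N : ℤ)) ∨ I = Set.Ico (-(N : ℤ)) 0)
    (R : ℤ → ℤ → (DiffPoly F I ⊗[F] DiffPoly F I)[X])
    (h1 : ∀ m n, (N : ℤ) ≤ m → R m n = 0) (h2 : ∀ m n, (N : ℤ) ≤ n → R m n = 0)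
    (h3 : I = Set.Ico (-(N : ℤ)) 0 → ∀ m n, m < 0 → R m n = 0)
    (h4 : I = Set.Ico (-(N : ℤ)) 0 → ∀ m n, n < 0 → R m n = 0) (m n : ℤ) :
    (bracketOfGenerators fun i j => R (-(i : ℤ) - 1) (-(j : ℤ) - 1)).br
      (genericL F N I m) (genericL F N I n) = R m n := by
  rcases eq_or_ne m N with rfl | hm
  · rw [genericL_top, br_one_left, h1 _ _ le_rfl]
  rcases eq_or_ne n N with rfl | hn
  · rw [genericL_top, br_one_right, h2 _ _ le_rfl]
  -- Degrees without a generator are exactly those where the support hypotheses on R apply.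
  have key : ∀ k : ℤ, k ≠ N → -k - 1 ∉ I → (N : ℤ) ≤ k ∨ (I = Set.Ico (-(N : ℤ)) 0 ∧ k < 0) := by
    intro k hk hkI
    rcases hI with rfl | rfl
    · rw [Set.mem_Ici] at hkI
      exact Or.inl (by omega)
    · rw [Set.mem_Ico] at hkI
      by_cases h : k < 0
      · exact Or.inr ⟨rfl, h⟩
      · exact Or.inl (by omega)
  by_cases hmI : -m - 1 ∈ I
  · by_cases hnI : -n - 1 ∈ I
    · rw [genericL_mem hm hmI, genericL_mem hn hnI, bracketOfGenerators_gen]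
      dsimp only
      congr 1 <;> ring
    · rw [genericL_notMem hn hnI, map_zero]
      rcases key n hn hnI with h | ⟨h, h'⟩
      · rw [h2 _ _ h]
      · rw [h4 h _ _ h']
  · rw [genericL_notMem hm hmI, map_zero, LinearMap.zero_apply]
    rcases key m hm hmI with h | ⟨h, h'⟩
    · rw [h1 _ _ h]
    · rw [h3 h _ _ h']

lemma bracketH_genericL (hI : I = Set.Ici (-(N : ℤ)) ∨ I = Set.Ico (-(N : ℤ)) 0) (m n : ℤ) :
    (bracketH F N I).br (genericL F N I m) (genericL F N I n) = rhsH F N I m n := by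
  have hL := ordLE_genericL (F := F) hI
  refine br_genericL hI (rhsH F N I) (fun m n h => adlerCoeff_of_le_left _ _ h n)
    (fun m n h => adlerCoeff_of_le_right hL hL m h) (fun hI' m n h => ?_) (fun hI' m n h => ?_) m n
  · subst hI'
    exact adlerCoeff_of_neg_left hL hL (fun _ => genericL_neg) (fun _ => genericL_neg) h n
  · subst hI'
    exact adlerCoeff_of_neg_right (fun _ => genericL_neg) (fun _ => genericL_neg) m h

lemma bracketK_genericL (hI : I = Set.Ici (-(N : ℤ)) ∨ I = Set.Ico (-(N : ℤ)) 0) (m n : ℤ) :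
    (bracketK F N I).br (genericL F N I m) (genericL F N I n) = rhsK F N I m n := by
  have hL := ordLE_genericL (F := F) hI
  have h1 := ordLE_symOne (V := DiffPoly F I) N
  refine br_genericL hI (rhsK F N I) (fun m n h => ?_) (fun m n h => ?_) (fun hI' m n h => ?_)
    (fun hI' m n h => ?_) m n
  · rw [rhsK, adlerCoeff_of_le_left _ _ h, adlerCoeff_of_le_left _ _ h, add_zero]
  · rw [rhsK, adlerCoeff_of_le_right hL h1 m h, adlerCoeff_of_le_right h1 hL m h, add_zero]
  · subst hI'
    rw [rhsK, adlerCoeff_of_neg_left hL h1 (fun _ => genericL_neg) symOne_neg h,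
      adlerCoeff_of_neg_left h1 hL symOne_neg (fun _ => genericL_neg) h, add_zero]
  · subst hI'
    rw [rhsK, adlerCoeff_of_neg_right (fun _ => genericL_neg) symOne_neg m h,
      adlerCoeff_of_neg_right symOne_neg (fun _ => genericL_neg) m h, add_zero]

end Generic

end NCPoisson

namespace NCPoisson

/-! ### Functoriality of the ring of pseudodifferential operators -/

namespace Psi

variable {F V W : Type*} [Field F] [Ring V] [Algebra F V] [Ring W] [Algebra F W]
  {D : NCDerivation F V} {D' : NCDerivation F W}

/-- A homomorphism of differential rings acts on the coefficients of operators. -/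
def map (f : V →+* W) (hf : ∀ v, f (D.toLinearMap v) = D'.toLinearMap (f v)) :
    Psi D →+* Psi D' where
  toFun A := ⟨fun n => f (sym A n), by
    obtain ⟨d, hd⟩ := A.bdd
    exact ⟨d, fun n hn => by dsimp only; rw [hd n hn, map_zero]⟩⟩
  map_one' := by
    refine Subtype.ext (funext fun n => ?_)
    change f (sym (1 : Psi D) n) = sym (1 : Psi D') n
    rcases eq_or_ne n 0 with rfl | hn
    · rw [sym_one_zero, sym_one_zero, map_one]
    · rw [sym_one_of_ne hn, sym_one_of_ne hn, map_zero]
  map_zero' := by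
    refine Subtype.ext (funext fun n => ?_)
    change f (sym (0 : Psi D) n) = sym (0 : Psi D') n
    rw [sym_zero_apply, sym_zero_apply, map_zero]
  map_add' A B := by
    refine Subtype.ext (funext fun n => ?_)
    change f (sym (A + B) n) = f (sym A n) + f (sym B n)
    rw [sym_add_apply, map_add]
  map_mul' A B := by
    refine Subtype.ext (funext fun n => ?_)
    obtain ⟨d, hA⟩ := A.bdd
    obtain ⟨e, hB⟩ := B.bdd
    have hf' : ∀ (j : ℕ) (v : V), f (D.iter j v) = D'.iter j (f v) := by
      intro j
      induction j with
      | zero => intro v; rfl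
      | succ j ih => intro v; rw [iter_succ, iter_succ, ih, hf]
    change f.toAddMonoidHom (symMul D (sym A) (sym B) n)
      = symMul D' (fun n => f (sym A n)) (fun n => f (sym B n)) n
    rw [symMul, symMul, AddMonoidHom.map_finsum _ (symMul_hasFiniteSupport hA hB n)]
    refine finsum_congr fun q => ?_
    rw [map_zsmul, ← hf', ← map_mul]
    rfl

lemma sym_map (f : V →+* W) (hf : ∀ v, f (D.toLinearMap v) = D'.toLinearMap (f v)) (A : Psi D)
    (n : ℤ) : sym (map f hf A) n = f (sym A n) := rfl

lemma map_mono (f : V →+* W) (hf : ∀ v, f (D.toLinearMap v) = D'.toLinearMap (f v)) (i : ℤ)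
    (a : V) : map f hf (mono i a) = mono i (f a) := by
  ext n
  rw [sym_map, sym_mono, sym_mono]
  exact Pi.apply_single (fun _ => f) (fun _ => map_zero f) i a n

lemma leftRes_map (f : V →+* W) (hf : ∀ v, f (D.toLinearMap v) = D'.toLinearMap (f v)) (B : Psi D)
    (m : ℤ) : leftRes (map f hf B) m = f (leftRes B m) := by
  rw [leftRes, leftRes, ← sym_map f hf, map_mul (map f hf), map_mono, map_one f]

/-- A derivation that commutes with `∂` acts on the coefficients of operators. -/
def mapDer (X : V →ₗ[F] V) : Psi D →+ Psi D where
  toFun A := ⟨fun n => X (sym A n), by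
    obtain ⟨d, hd⟩ := A.bdd
    exact ⟨d, fun n hn => by dsimp only; rw [hd n hn, map_zero]⟩⟩
  map_zero' := by
    refine Subtype.ext (funext fun n => ?_)
    change X (sym (0 : Psi D) n) = sym (0 : Psi D) n
    rw [sym_zero_apply, map_zero]
  map_add' A B := by
    refine Subtype.ext (funext fun n => ?_)
    change X (sym (A + B) n) = X (sym A n) + X (sym B n)
    rw [sym_add_apply, map_add]

lemma sym_mapDer (X : V →ₗ[F] V) (A : Psi D) (n : ℤ) : sym (mapDer X A) n = X (sym A n) := rfl

lemma mapDer_mul {X : V →ₗ[F] V} (hX : ∀ a b, X (a * b) = X a * b + a * X b)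
    (hXD : ∀ a, X (D.toLinearMap a) = D.toLinearMap (X a)) (A B : Psi D) :
    mapDer X (A * B) = mapDer X A * B + A * mapDer X B := by
  ext n
  obtain ⟨d, hA⟩ := A.bdd
  obtain ⟨e, hB⟩ := B.bdd
  have hA' : OrdLE d (sym (mapDer X A)) := fun n hn => by rw [sym_mapDer, hA n hn, map_zero]
  have hB' : OrdLE e (sym (mapDer X B)) := fun n hn => by rw [sym_mapDer, hB n hn, map_zero]
  have h : ∀ (j : ℕ) (v : V), X (D.iter j v) = D.iter j (X v) := by
    intro j
    induction j with
    | zero => intro v; rfl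
    | succ j ih => intro v; rw [iter_succ, iter_succ, ih, hXD]
  rw [sym_mapDer, sym_add_apply, sym_mul, sym_mul, sym_mul, symMul, symMul, symMul,
    ← finsum_add_distrib (symMul_hasFiniteSupport hA' hB n) (symMul_hasFiniteSupport hA hB' n)]
  change X.toAddMonoidHom _ = _
  rw [AddMonoidHom.map_finsum _ (symMul_hasFiniteSupport hA hB n)]
  refine finsum_congr fun q => ?_
  rw [map_zsmul, ← smul_add]
  change _ • X _ = _
  rw [hX, h]
  rfl

lemma mapDer_plus (X : V →ₗ[F] V) (A : Psi D) : mapDer X (plus A) = plus (mapDer X A) := by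
  ext n
  rw [sym_mapDer, sym_plus, sym_plus, symPlus, symPlus, sym_mapDer]
  split_ifs <;> simp

/-- The residue of `A B` in terms of the residues of the `∂^m B`. -/
lemma res_mul_eq_sum_leftRes {A B : Psi D} {e lo hi : ℤ} (hA : OrdLE hi (sym A))
    (hB : OrdLE e (sym B)) (hlo : lo + e < 0) :
    sym (A * B) (-1) = ∑ m ∈ Finset.Icc lo hi, sym A m * leftRes B m := by
  have h := ord_mul (ord_sub_sum_mono hA lo) hB (-1) (by omega)
  rw [sub_mul, sym_sub_apply, sub_eq_zero, Finset.sum_mul, map_sum, Finset.sum_apply] at h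
  rw [h]
  refine Finset.sum_congr rfl fun m _ => ?_
  have h1 : (mono m (sym A m) : Psi D) = mono 0 (sym A m) * mono m 1 := by
    rw [mono_mul_one, zero_add]
  rw [h1, mul_assoc, const_mul_apply, leftRes]

end Psi

/-! ### Square-zero extensions by bimodules -/

section SqZero

variable {F V M : Type*} [Field F] [Ring V] [Algebra F V] [AddCommGroup M] [Module F M]

/-- The square-zero extension of `V` by a bimodule. -/
def SqZero (_ : BimodActions F V M) : Type _ := V × M

namespace SqZero

variable (B : BimodActions F V M)

instance : AddCommGroup (SqZero B) := inferInstanceAs (AddCommGroup (V × M))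

instance : Module F (SqZero B) := inferInstanceAs (Module F (V × M))

instance : Mul (SqZero B) := ⟨fun x y => (x.1 * y.1, B.r y.1 x.2 + B.l x.1 y.2)⟩

instance : One (SqZero B) := ⟨((1 : V), (0 : M))⟩

variable {B}

@[ext] lemma ext {x y : SqZero B} (h1 : x.1 = y.1) (h2 : x.2 = y.2) : x = y := Prod.ext h1 h2

lemma mul_fst (x y : SqZero B) : (x * y).1 = x.1 * y.1 := rfl
lemma mul_snd (x y : SqZero B) : (x * y).2 = B.r y.1 x.2 + B.l x.1 y.2 := rfl
lemma add_fst (x y : SqZero B) : (x + y).1 = x.1 + y.1 := rfl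
lemma add_snd (x y : SqZero B) : (x + y).2 = x.2 + y.2 := rfl
lemma smul_fst (c : F) (x : SqZero B) : (c • x).1 = c • x.1 := rfl
lemma smul_snd (c : F) (x : SqZero B) : (c • x).2 = c • x.2 := rfl
lemma one_fst : (1 : SqZero B).1 = 1 := rfl
lemma one_snd : (1 : SqZero B).2 = 0 := rfl
lemma zero_fst : (0 : SqZero B).1 = 0 := rfl
lemma zero_snd : (0 : SqZero B).2 = 0 := rfl

instance : Ring (SqZero B) :=
  { (inferInstance : AddCommGroup (SqZero B)) with
    mul := (· * ·)
    one := 1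
    left_distrib := fun x y z => by
      ext
      · simp only [mul_fst, add_fst, mul_add]
      · simp only [mul_snd, add_snd, add_fst, map_add, LinearMap.add_apply]; abel
    right_distrib := fun x y z => by
      ext
      · simp only [mul_fst, add_fst, add_mul]
      · simp only [mul_snd, add_snd, add_fst, map_add, LinearMap.add_apply]; abel
    zero_mul := fun x => by
      ext
      · simp only [mul_fst, zero_fst, zero_mul]
      · simp only [mul_snd, zero_snd, zero_fst, map_zero, LinearMap.zero_apply, add_zero]
    mul_zero := fun x => by
      ext
      · simp only [mul_fst, zero_fst, mul_zero]
      · simp only [mul_snd, zero_snd, zero_fst, map_zero, LinearMap.zero_apply, add_zero]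
    mul_assoc := fun x y z => by
      ext
      · simp only [mul_fst, mul_assoc]
      · simp only [mul_snd, mul_fst, map_add, B.r_mul, B.l_mul, B.comm]; abel
    one_mul := fun x => by
      ext
      · simp only [mul_fst, one_fst, one_mul]
      · simp only [mul_snd, one_fst, one_snd, map_zero, B.l_one, zero_add]
    mul_one := fun x => by
      ext
      · simp only [mul_fst, one_fst, mul_one]
      · simp only [mul_snd, one_fst, one_snd, map_zero, B.r_one, add_zero]
    zsmul := (inferInstance : AddCommGroup (SqZero B)).zsmul }

instance : Algebra F (SqZero B) := Algebra.ofModule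
  (fun c x y => by
    ext
    · simp only [mul_fst, smul_fst, smul_mul_assoc]
    · simp only [mul_snd, smul_snd, smul_fst, map_smul, LinearMap.smul_apply, smul_add])
  (fun c x y => by
    ext
    · simp only [mul_fst, smul_fst, mul_smul_comm]
    · simp only [mul_snd, smul_snd, smul_fst, map_smul, LinearMap.smul_apply, smul_add])

/-- The derivation of a square-zero extension given by compatible maps on `V` and `M`. -/
def der (D : NCDerivation F V) (dM : M →ₗ[F] M)
    (hl : ∀ a m, dM (B.l a m) = B.l (D.toLinearMap a) m + B.l a (dM m))
    (hr : ∀ a m, dM (B.r a m) = B.r (D.toLinearMap a) m + B.r a (dM m)) :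
    NCDerivation F (SqZero B) where
  toFun x := (D.toLinearMap x.1, dM x.2)
  map_add' x y := by
    ext
    · exact map_add D.toLinearMap x.1 y.1
    · exact map_add dM x.2 y.2
  map_smul' c x := by
    ext
    · exact map_smul D.toLinearMap c x.1
    · exact map_smul dM c x.2
  leibniz' x y := by
    ext
    · exact D_mul D x.1 y.1
    · change dM (B.r y.1 x.2 + B.l x.1 y.2) = (B.r y.1 (dM x.2) + B.l (D.toLinearMap x.1) y.2)
        + (B.r (D.toLinearMap y.1) x.2 + B.l x.1 (dM y.2))
      rw [map_add, hl, hr]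
      abel

/-- The graph of a derivation. -/
def graph (δ : V →ₗ[F] M) (hδ : ∀ a b, δ (a * b) = B.r b (δ a) + B.l a (δ b)) :
    V →+* SqZero B where
  toFun v := (v, δ v)
  map_one' := by
    have h := hδ 1 1
    rw [mul_one, B.r_one, B.l_one] at h
    ext
    · rfl
    · exact left_eq_add.1 h
  map_mul' a b := by
    ext
    · rfl
    · exact hδ a b
  map_zero' := by
    ext
    · rfl
    · exact map_zero δ
  map_add' a b := by
    ext
    · rfl
    · exact map_add δ a b

/-- The inclusion of `V` in a square-zero extension. -/
def inl : V →+* SqZero B := graph 0 fun a b => by simp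

/-- The projection to the bimodule. -/
def snd : SqZero B →+ M := AddMonoidHom.snd V M

end SqZero

end SqZero

/-! ### Variation of residues of powers -/

namespace Psi

variable {F V M : Type*} [Field F] [Ring V] [Algebra F V] [AddCommGroup M] [Module F M]
  {B : BimodActions F V M} {D : NCDerivation F V} {E : NCDerivation F (SqZero B)}

/-- The coefficients lie in the square-zero ideal M, which E and hence its powers preserve. -/
lemma mul_eq_zero_of_fst {X Y : Psi E} (hX : ∀ n, (sym X n).1 = 0) (hY : ∀ n, (sym Y n).1 = 0)
    (hE : ∀ x : SqZero B, x.1 = 0 → (E.toLinearMap x).1 = 0) : X * Y = 0 := by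
  have h : ∀ (j : ℕ) (x : SqZero B), x.1 = 0 → (E.iter j x).1 = 0 := by
    intro j
    induction j with
    | zero => intro x hx; exact hx
    | succ j ih => intro x hx; rw [iter_succ]; exact ih _ (hE x hx)
  ext1 n
  rw [sym_mul, symMul, sym_zero_apply]
  refine finsum_eq_zero_of_forall_eq_zero fun q => ?_
  have h0 : sym X q.1 * E.iter q.2 (sym Y (n - q.1 + q.2)) = 0 := by
    ext
    · rw [SqZero.mul_fst, hX, zero_mul]; rfl
    · rw [SqZero.mul_snd, hX, h _ _ (hY _), map_zero, map_zero, LinearMap.zero_apply,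
        LinearMap.zero_apply, add_zero]; rfl
  rw [h0, smul_zero]

/-- If `Δ = ι - j` for ring homomorphisms `ι` and `j`, the products of two values of `Δ` vanish, and
`t` is a trace, then `t (j X Δ(A^{n+1})) = (n + 1) t (j (X A^n) Δ A)` for `X` commuting with `A`. -/
lemma trace_variation_pow {P S G : Type*} [Ring P] [Ring S] [AddCommGroup G] (ι j : P →+* S)
    (h0 : ∀ X Y, (ι X - j X) * (ι Y - j Y) = 0) (t : S →+ G) (ht : ∀ x y, t (x * y) = t (y * x))
    (A : P) (n : ℕ) : ∀ X, X * A = A * X →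
      t (j X * (ι (A ^ (n + 1)) - j (A ^ (n + 1)))) = (n + 1) • t (j (X * A ^ n) * (ι A - j A)) := by
  induction n with
  | zero => intro X _; simp
  | succ n ih =>
    intro X hX
    -- The Leibniz rule for Δ, obtained by discarding the product of two values of Δ.
    have h1 : ι (A ^ (n + 1 + 1)) - j (A ^ (n + 1 + 1))
        = (ι (A ^ (n + 1)) - j (A ^ (n + 1))) * j A + j (A ^ (n + 1)) * (ι A - j A) := by
      have h2 := h0 (A ^ (n + 1)) A
      rw [pow_succ A (n + 1), map_mul, map_mul, ← sub_eq_zero, ← h2]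
      noncomm_ring
    -- Cyclicity moves the last factor to the front, where it joins X, which commutes with A.
    have h3 : t (j X * ((ι (A ^ (n + 1)) - j (A ^ (n + 1))) * j A))
        = t (j (X * A) * (ι (A ^ (n + 1)) - j (A ^ (n + 1)))) := by
      rw [← mul_assoc, ht, ← mul_assoc, ← map_mul, hX]
    have h4 : X * A * A ^ n = X * A ^ (n + 1) := by rw [mul_assoc, ← pow_succ']
    rw [h1, mul_add, map_add, h3, ih (X * A) (by rw [hX, mul_assoc, ← hX]), h4, ← mul_assoc,
      ← map_mul, ← succ_nsmul]

end Psi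

/-! ### The action of the Hamiltonians -/

section Variation

variable {F V : Type*} [Field F] [Ring V] [Algebra F V] {D : NCDerivation F V}

/-- The bimodule structure on `(V ⊗ V)[λ]` that governs the right Leibniz rule. -/
noncomputable def arrowActions (D : NCDerivation F V) : BimodActions F V (V ⊗[F] V)[X] where
  l := arrowLHom D
  r := arrowRHom D
  l_one := arrowL_one D
  r_one := arrowR_one D
  l_mul := arrowL_mul D
  r_mul := arrowR_mul D
  comm := arrowL_arrowR D

/-- The derivation `(∂, -λ)` of the square-zero extension of `V` by `(V ⊗ V)[λ]`. -/
noncomputable def arrowDer (D : NCDerivation F V) : NCDerivation F (SqZero (arrowActions D)) :=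
  SqZero.der D (-lam)
    (fun a m => by
      change -lam (F := F) (arrowL D a m)
        = arrowL D (D.toLinearMap a) m + arrowL D a (-lam (F := F) m)
      rw [map_neg, arrowL_lam]
      abel)
    (fun a m => by
      change -lam (F := F) (arrowR D a m)
        = arrowR D (D.toLinearMap a) m + arrowR D a (-lam (F := F) m)
      rw [map_neg, arrowR_lam]
      abel)

/-- The multiplication at `λ = 0`, as a functional on the square-zero extension. -/
noncomputable def arrowTrace (D : NCDerivation F V) : SqZero (arrowActions D) →+ V :=
  ((LinearMap.mul' F V).comp
    ((Polynomial.lcoeff (V ⊗[F] V) 0).restrictScalars F)).toAddMonoidHom.comp SqZero.snd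

lemma arrowTrace_apply (x : SqZero (arrowActions D)) :
    arrowTrace D x = LinearMap.mul' F V (x.2.coeff 0) := rfl

/-- At λ = 0 and after multiplication, the left and right actions on (V ⊗ V)[λ] become equal
(`mul_arrow`). -/
lemma arrowTrace_mul_comm (x y : SqZero (arrowActions D)) :
    arrowTrace D (x * y) = arrowTrace D (y * x) := by
  rw [arrowTrace_apply, arrowTrace_apply, SqZero.mul_snd, SqZero.mul_snd, Polynomial.coeff_add,
    Polynomial.coeff_add, map_add, map_add]
  change LinearMap.mul' F V ((arrowR D y.1 x.2).coeff 0)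
    + LinearMap.mul' F V ((arrowL D x.1 y.2).coeff 0)
    = LinearMap.mul' F V ((arrowR D x.1 y.2).coeff 0)
    + LinearMap.mul' F V ((arrowL D y.1 x.2).coeff 0)
  rw [mul_arrow, mul_arrow, add_comm]

lemma arrowTrace_der (x : SqZero (arrowActions D)) :
    arrowTrace D ((arrowDer D).toLinearMap x) = 0 := by
  change LinearMap.mul' F V ((-lam (F := F) x.2).coeff 0) = 0
  rw [Polynomial.coeff_neg, coeff_zero_lam, neg_zero, map_zero]

open Psi in
/-- The variation of `(N / k) res A^k` is the residue of `B δL`, where `B = A^{k-N}`, `L = A^N`. -/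
lemma reduced_res_pow [CharZero F] (Br : TwoFoldLambdaBracket D) {A B : Psi D} {N k : ℕ} {e lo : ℤ}
    (hN : 0 < N) (hk : 0 < k) (hAB : B * A = A * B) (hBA : B * A ^ (N - 1) = A ^ (k - 1))
    (hL : OrdLE N (sym (A ^ N))) (hB : OrdLE e (sym B)) (hlo : lo + e < 0) (g : V) :
    Br.reduced (((N : F) / (k : F)) • sym (A ^ k) (-1)) g
      = ∑ m ∈ Finset.Icc lo N, evAt D (leftRes B m) (Br.br (sym (A ^ N) m) g) := by
  obtain ⟨N, rfl⟩ := Nat.exists_eq_succ_of_ne_zero hN.ne'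
  obtain ⟨k, rfl⟩ := Nat.exists_eq_succ_of_ne_zero hk.ne'
  let δ : V →ₗ[F] (V ⊗[F] V)[X] := Br.br.flip g
  let i₁ : V →+* SqZero (arrowActions D) := SqZero.graph δ fun a b => Br.leibniz_right a b g
  -- Sesquilinearity in the first argument says that the graph of {{·_λ g}} intertwines ∂ with (∂,
  -- -λ).
  let ι : Psi D →+* Psi (arrowDer D) := Psi.map i₁ fun v => SqZero.ext rfl (Br.sesq_left v g)
  let j : Psi D →+* Psi (arrowDer D) := Psi.map SqZero.inl fun v => SqZero.ext rfl (by
    change 0 = -lam (F := F) 0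
    rw [map_zero, neg_zero])
  let t : Psi (arrowDer D) →+ V :=
    (arrowTrace D).comp ((Pi.evalAddMonoidHom _ (-1 : ℤ)).comp sym)
  have ht : ∀ x y, t (x * y) = t (y * x) :=
    trace_res_comm (arrowTrace D) arrowTrace_mul_comm arrowTrace_der
  have hfst : ∀ (X : Psi D) (n : ℤ), (sym (ι X - j X) n).1 = 0 := by
    intro X n
    rw [sym_sub_apply]
    exact sub_self (sym X n)
  have hsnd : ∀ (X : Psi D) (n : ℤ), (sym (ι X - j X) n).2 = δ (sym X n) := by
    intro X n
    rw [sym_sub_apply]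
    exact sub_zero (δ (sym X n))
  have h0 : ∀ X Y, (ι X - j X) * (ι Y - j Y) = 0 := fun X Y =>
    mul_eq_zero_of_fst (hfst X) (hfst Y) fun x hx => by
      change D.toLinearMap x.1 = 0
      rw [hx, map_zero]
  have hvar := trace_variation_pow ι j h0 t ht A
  -- Here k and N stand for the original ones minus one. The traces of ΔA^{k+1} and of B ΔA^{N+1}
  -- are k + 1 and N + 1 times the same quantity, the trace of A^k ΔA; this is why the normalisation
  -- N/k appears.
  have e1 := hvar k 1 (by rw [one_mul, mul_one])
  have e2 := hvar N B hAB
  rw [map_one, one_mul, one_mul] at e1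
  rw [Nat.succ_eq_add_one, Nat.add_sub_cancel, Nat.succ_eq_add_one, Nat.add_sub_cancel] at hBA
  rw [hBA] at e2
  have e3 : Br.reduced (sym (A ^ (k + 1)) (-1)) g = t (ι (A ^ (k + 1)) - j (A ^ (k + 1))) := by
    change _ = LinearMap.mul' F V ((sym (ι (A ^ (k + 1)) - j (A ^ (k + 1))) (-1)).2.coeff 0)
    rw [hsnd]
    rfl
  have hL' : OrdLE (N + 1 : ℕ) (sym (ι (A ^ (N + 1)) - j (A ^ (N + 1)))) := fun n hn => by
    ext
    · exact hfst _ n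
    · rw [hsnd, hL n hn, map_zero]; rfl
  have hB' : OrdLE e (sym (j B)) := fun n hn => by
    change SqZero.inl (sym B n) = 0
    rw [hB n hn, map_zero]
  have e4 : t (j B * (ι (A ^ (N + 1)) - j (A ^ (N + 1))))
      = ∑ m ∈ Finset.Icc lo (N + 1 : ℕ), evAt D (leftRes B m) (Br.br (sym (A ^ (N + 1)) m) g) := by
    rw [ht]
    change arrowTrace D (sym ((ι (A ^ (N + 1)) - j (A ^ (N + 1))) * j B) (-1)) = _
    rw [res_mul_eq_sum_leftRes hL' hB' hlo, map_sum]
    refine Finset.sum_congr rfl fun m _ => ?_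
    -- In the extension (0, P)(b, 0) = (0, P acted on from the right by b), whose trace is `evAt` at
    -- b.
    rw [leftRes_map, arrowTrace_apply, SqZero.mul_snd, hfst, hsnd, map_zero, LinearMap.zero_apply,
      add_zero]
    rfl
  rw [map_smul, LinearMap.smul_apply, Nat.succ_eq_add_one, Nat.succ_eq_add_one, e3, ← e4, e1, e2,
    ← Nat.cast_smul_eq_nsmul F, ← Nat.cast_smul_eq_nsmul F, smul_smul,
    div_mul_cancel₀ _ (Nat.cast_ne_zero.2 (Nat.succ_ne_zero k))]

end Variation

end NCPoisson

namespace NCPoisson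

/-! ### The Lax equations -/

namespace Psi

variable {F V : Type*} [Field F] [Ring V] [Algebra F V] {D : NCDerivation F V}

/-- For invertible `A`, the action of `(N / k) res A^k` is the variation along `B = A^{k-N}`. -/
lemma exists_zpow_sub {A : Psi D} (hA : Monic 1 A) {N k : ℕ} (hN : 0 < N) (hk : 0 < k) :
    ∃ B : Psi D, B * A = A * B ∧ B * A ^ (N - 1) = A ^ (k - 1) ∧ B * A ^ N = A ^ k ∧
      A ^ N * B = A ^ k ∧ Monic (k - N) B ∧ (k = N → B = 1) := by
  obtain ⟨U, hU, h1, h2⟩ := hA.exists_inv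
  let a : (Psi D)ˣ := ⟨A, U, h1, h2⟩
  have hpow : ∀ n : ℕ, A ^ n = ((a ^ (n : ℤ) : (Psi D)ˣ) : Psi D) := fun n => by
    rw [zpow_natCast, Units.val_pow_eq_pow_val]
  have hA1 : A = ((a ^ (1 : ℤ) : (Psi D)ˣ) : Psi D) := by rw [zpow_one]
  refine ⟨((a ^ ((k : ℤ) - N) : (Psi D)ˣ) : Psi D), ?_, ?_, ?_, ?_, ?_, ?_⟩
  · conv_lhs => rw [hA1]
    conv_rhs => rw [hA1]
    rw [← Units.val_mul, ← Units.val_mul, ← zpow_add, ← zpow_add, add_comm]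
  · rw [hpow, hpow, ← Units.val_mul, ← zpow_add]
    congr 2
    omega
  · rw [hpow, hpow, ← Units.val_mul, ← zpow_add, sub_add_cancel]
  · rw [hpow, hpow, ← Units.val_mul, ← zpow_add, add_sub_cancel]
  · rcases le_total N k with h | h
    · obtain ⟨m, rfl⟩ := Nat.exists_eq_add_of_le h
      have := hA.pow m
      rw [mul_one] at this
      rw [show ((N + m : ℕ) : ℤ) - N = m by push_cast; ring, ← hpow]
      exact this
    · obtain ⟨m, rfl⟩ := Nat.exists_eq_add_of_le h
      have := hU.pow m
      rw [show (k : ℤ) - (k + m : ℕ) = -(m : ℤ) by push_cast; ring, zpow_neg, zpow_natCast,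
        ← inv_pow, Units.val_pow_eq_pow_val]
      rw [show (m : ℤ) * -1 = -(m : ℤ) by ring] at this
      exact this
  · rintro rfl
    rw [sub_self, zpow_zero, Units.val_one]

/-- The action of `(N / k) res A^k` for a bracket of Adler type. -/
lemma reduced_adler [CharZero F] (Br : TwoFoldLambdaBracket D) {A B : Psi D} {N k : ℕ}
    (hN : 0 < N) (hk : 0 < k) (hA : Monic 1 A) (hAB : B * A = A * B)
    (hBA : B * A ^ (N - 1) = A ^ (k - 1)) {ι : Type*} (s : Finset ι) (P Q : ι → Psi D)
    (hP : ∀ i ∈ s, OrdLE N (sym (P i))) (hQ : ∀ i ∈ s, OrdLE N (sym (Q i))) (n : ℤ) (g : V)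
    (hbr : ∀ m, Br.br (sym (A ^ N) m) g = ∑ i ∈ s, adlerCoeff D N (sym (P i)) (sym (Q i)) m n) :
    Br.reduced (((N : F) / (k : F)) • sym (A ^ k) (-1)) g
      = sym (∑ i ∈ s, (plus (P i * B) * Q i - P i * plus (B * Q i))) n := by
  obtain ⟨e, hB⟩ := B.bdd
  have hL := (hA.pow N).ord
  rw [mul_one] at hL
  rw [reduced_res_pow Br hN hk hAB hBA hL hB (lo := min (-e - 1) 0) (by omega) g, map_sum,
    Finset.sum_apply]
  -- The top term m = N drops out, because the Adler expression vanishes there.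
  have h1 : ∀ m ∈ Finset.Icc (min (-e - 1) 0) (N : ℤ), m ∉ Finset.Ico (min (-e - 1) 0) (N : ℤ) →
      evAt D (leftRes B m) (Br.br (sym (A ^ N) m) g) = 0 := by
    intro m hm hm'
    rw [hbr, Finset.sum_eq_zero, map_zero]
    intro i _
    refine adlerCoeff_of_le_left _ _ ?_ n
    simp only [Finset.mem_Icc, Finset.mem_Ico, not_and, not_lt] at hm hm'
    omega
  rw [← Finset.sum_subset Finset.Ico_subset_Icc_self h1]
  simp only [hbr, map_sum]
  rw [Finset.sum_comm]
  refine Finset.sum_congr rfl fun i hi => ?_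
  rw [sum_evAt_adlerCoeff (hP i hi) hB (hQ i hi) (by omega)]

/-- The zero curvature equation. -/
lemma zero_curvature {P Q : Psi D} (h : P * Q = Q * P) :
    plus (plus P * Q - Q * plus P) - plus (plus Q * P - P * plus Q)
      = plus P * plus Q - plus Q * plus P := by
  set p := plus P with hp
  set q := plus Q with hq
  have hm : ∀ X Y : Psi D, plus ((X - plus X) * (Y - plus Y)) = 0 := fun X Y =>
    plus_eq_zero (ord_mul (ord_sub_plus X) (ord_sub_plus Y)) (by norm_num)
  have hd : ∀ X Y : Psi D, plus (plus X * plus Y) = plus X * plus Y := fun X Y =>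
    ((isDiff_plus X).mul (isDiff_plus Y)).plus_eq
  -- Split P and Q into differential and negative parts: the product of the negative parts has order
  -- at most -2, so its differential part vanishes.
  have e : (p * Q - Q * p) - (q * P - P * q)
      = (p * q - q * p) - ((P - p) * (Q - q) - (Q - q) * (P - p)) + (P * Q - Q * P) := by
    noncomm_ring
  rw [← map_sub, e, h, sub_self, add_zero, map_sub, map_sub, map_sub, hp, hq, hm, hm, hd, hd,
    sub_zero, sub_zero]

end Psi

/-! ### Lax flows as derivations of the ring of operators, and conservation of residues. -/

section Flows

variable {F V : Type*} [Field F] [Ring V] [Algebra F V] {D : NCDerivation F V}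

open Psi

/-- The Lax equation for `L = A^N` implies the Lax equations for the powers of `A`. -/
lemma mapDer_pow_of_lax [CharZero F] {X : V →ₗ[F] V} (hX : ∀ a b, X (a * b) = X a * b + a * X b)
    (hXD : ∀ a, X (D.toLinearMap a) = D.toLinearMap (X a)) {A S : Psi D} (hA : Monic 1 A) {N : ℕ}
    (hN : 0 < N) (hL : mapDer X (A ^ N) = S * A ^ N - A ^ N * S) (l : ℕ) :
    mapDer X (A ^ l) = S * A ^ l - A ^ l * S := by
  -- The derivation X - ad S kills A^N, hence A by `derivation_root`, hence every power of A.
  let Θ : Psi D →+ Psi D := mapDer X - (AddMonoidHom.mulLeft S - AddMonoidHom.mulRight S)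
  have hΘ : ∀ Y, Θ Y = mapDer X Y - (S * Y - Y * S) := fun _ => rfl
  have hder : ∀ Y Z, Θ (Y * Z) = Θ Y * Z + Y * Θ Z := fun Y Z => by
    rw [hΘ, hΘ, hΘ, mapDer_mul hX hXD]
    noncomm_ring
  have h0 : Θ A = 0 := derivation_root hN hA Θ hder (by rw [hΘ, hL, sub_self])
  have h1 : Θ (A ^ l) = 0 := by
    induction l with
    | zero => simpa using hder 1 1
    | succ l ih => rw [pow_succ, hder, ih, h0, zero_mul, mul_zero, add_zero]
  rw [hΘ] at h1
  exact sub_eq_zero.1 h1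

lemma integ_mul_comm (a b : V) : integ D (a * b) = integ D (b * a) := by
  rw [← sub_eq_zero, ← map_sub]
  exact (Submodule.Quotient.mk_eq_zero _).2 (comm_mem D a b)

lemma integ_D (a : V) : integ D (D.toLinearMap a) = 0 :=
  (Submodule.Quotient.mk_eq_zero _).2 (D_mem D a)

/-- Residues of powers of `A` are conserved by Lax flows. -/
lemma integ_flow_eq_zero {X : V →ₗ[F] V} {A S : Psi D} {l : ℕ}
    (h : mapDer X (A ^ l) = S * A ^ l - A ^ l * S) (c : F) :
    integ D (X (c • sym (A ^ l) (-1))) = 0 := by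
  rw [map_smul, map_smul, ← sym_mapDer, h, sym_sub_apply, map_sub]
  have := trace_res_comm (integ D).toAddMonoidHom integ_mul_comm integ_D S (A ^ l)
  rw [LinearMap.toAddMonoidHom_coe] at this
  rw [this, sub_self, smul_zero]

end Flows

/-! ### Flows of the Hamiltonians on the generic operator. -/

section Final

variable {F : Type*} [Field F] {N : ℕ} {I : Set ℤ}

/-- A derivation that commutes with `∂` is determined by its values on the `u_i`. -/
lemma derivation_ext (hI : I ⊆ Set.Ici (-(N : ℤ))) {X Y : DiffPoly F I →ₗ[F] DiffPoly F I}
    (hX : ∀ a b, X (a * b) = X a * b + a * X b) (hY : ∀ a b, Y (a * b) = Y a * b + a * Y b)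
    (hXD : ∀ a, X ((del F I).toLinearMap a) = (del F I).toLinearMap (X a))
    (hYD : ∀ a, Y ((del F I).toLinearMap a) = (del F I).toLinearMap (Y a))
    (h : ∀ n, X (genericL F N I n) = Y (genericL F N I n)) (u : DiffPoly F I) : X u = Y u := by
  have hX1 : X 1 = 0 := by simpa using hX 1 1
  have hY1 : Y 1 = 0 := by simpa using hY 1 1
  have hgen : ∀ (i : I) (n : ℕ), X (gen F I i n) = Y (gen F I i n) := by
    intro i n
    induction n with
    | zero =>
      have hi : -(N : ℤ) ≤ i := hI i.2
      have hmem : -(-(i : ℤ) - 1) - 1 ∈ I := by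
        rw [show -(-(i : ℤ) - 1) - 1 = i by ring]
        exact i.2
      -- The bound i ≥ -N keeps the degree -i - 1 of u_i below N, away from the leading coefficient
      -- 1.
      have h1 := genericL_mem (F := F) (N := N) (n := -(i : ℤ) - 1) (by omega) hmem
      have h2 : (⟨-(-(i : ℤ) - 1) - 1, hmem⟩ : I) = i := Subtype.ext (by dsimp only; ring)
      rw [h2] at h1
      rw [← h1, h]
    | succ n ih => rw [← del_gen, hXD, hYD, ih]
  induction u using FreeAlgebra.induction with
  | grade0 c => rw [Algebra.algebraMap_eq_smul_one, map_smul, map_smul, hX1, hY1]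
  | grade1 x => exact hgen x.1 x.2
  | mul f g hf hg => rw [hX, hY, hf, hg]
  | add f g hf hg => rw [map_add, map_add, hf, hg]

open Psi

/-- The action of the Hamiltonians for `H` is given by the Lax equations. -/
lemma reducedH_hamiltonian [CharZero F] (hN : 0 < N)
    (hI : I = Set.Ici (-(N : ℤ)) ∨ I = Set.Ico (-(N : ℤ)) 0) {A : Psi (del F I)} (hA : Monic 1 A)
    (hAN : sym (A ^ N) = genericL F N I) {k : ℕ} (hk : 0 < k) (n : ℤ) :
    (bracketH F N I).reduced (((N : F) / (k : F)) • sym (A ^ k) (-1)) (genericL F N I n)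
      = sym (plus (A ^ k) * A ^ N - A ^ N * plus (A ^ k)) n := by
  have hL := ordLE_genericL (F := F) hI
  rw [← hAN] at hL
  obtain ⟨B, h1, h2, h3, h4, -, -⟩ := exists_zpow_sub hA hN hk
  rw [reduced_adler (bracketH F N I) hN hk hA h1 h2 {()} (fun _ => A ^ N) (fun _ => A ^ N)
    (fun _ _ => hL) (fun _ _ => hL) n _ fun m => by
      rw [hAN, bracketH_genericL hI, Finset.sum_singleton]; rfl]
  rw [Finset.sum_singleton, h3, h4]

/-- The two values of `Bool` index the pairs (L, 1) and (1, L). Their Adler maps add up to (LB)_+ -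
L B_+ + B_+ L - (BL)_+, and the outer terms cancel because B commutes with L. The operator B is kept
as an argument: it is A^{k-N}, which may have negative order. -/
lemma reducedK_hamiltonian [CharZero F] (hN : 0 < N)
    (hI : I = Set.Ici (-(N : ℤ)) ∨ I = Set.Ico (-(N : ℤ)) 0) {A B : Psi (del F I)} (hA : Monic 1 A)
    (hAN : sym (A ^ N) = genericL F N I) {k : ℕ} (hk : 0 < k) (hAB : B * A = A * B)
    (hBA : B * A ^ (N - 1) = A ^ (k - 1)) (n : ℤ) :
    (bracketK F N I).reduced (((N : F) / (k : F)) • sym (A ^ k) (-1)) (genericL F N I n)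
      = sym (plus B * A ^ N - A ^ N * plus B) n := by
  have hL := ordLE_genericL (F := F) hI
  rw [← hAN] at hL
  have ho : OrdLE N (sym (1 : Psi (del F I))) := ordLE_symOne N
  have hcomm : A ^ N * B = B * A ^ N := (Commute.pow_right (show Commute B A from hAB) N).eq.symm
  rw [reduced_adler (bracketK F N I) hN hk hA hAB hBA Finset.univ
    (fun b : Bool => if b then A ^ N else 1) (fun b : Bool => if b then 1 else A ^ N)
    (fun b _ => by cases b <;> assumption) (fun b _ => by cases b <;> assumption) n _ fun m => by
      rw [hAN, bracketK_genericL hI, Fintype.sum_bool]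
      simp only [if_true, Bool.false_eq_true, if_false, hAN]
      rfl]
  rw [Fintype.sum_bool]
  simp only [if_true, Bool.false_eq_true, if_false, mul_one, one_mul, hcomm]
  refine congrArg (fun X => sym X n) ?_
  abel

end Final

end NCPoisson

/-! ### Assembly of the statements. -/

theorem mainTheorem6 {F : Type*} [Field F] [CharZero F] (N : ℕ) (hN : 0 < N) (I : Set ℤ)
    (hI : I = Set.Ici (-(N : ℤ)) ∨ I = Set.Ico (-(N : ℤ)) 0) :
    -- `H` and `K` satisfy their defining identities, as series in `z` and `w`
    (∀ m n : ℤ, (bracketH F N I).br (genericL F N I m) (genericL F N I n) = rhsH F N I m n ∧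
      (bracketK F N I).br (genericL F N I m) (genericL F N I n) = rhsK F N I m n) ∧
    -- the operator `L^{1/N}` exists and is unique
    (∃! A : ℤ → DiffPoly F I, IsRootOfL F N I A) ∧
    ∀ A : ℤ → DiffPoly F I, IsRootOfL F N I A →
      -- `{∫ h_ε, u}_K = 0` for `1 ≤ ε ≤ N`
      (∀ ε : ℕ, 1 ≤ ε → ε ≤ N → ∀ u : DiffPoly F I,
        (bracketK F N I).act (integ (del F I) (hamiltonian N A ε)) u = 0) ∧
      -- the Lenard–Magri recursion
      (∀ k : ℕ, 1 ≤ k → ∀ u : DiffPoly F I,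
        (bracketH F N I).act (integ (del F I) (hamiltonian N A k)) u
          = (bracketK F N I).act (integ (del F I) (hamiltonian N A (k + N))) u) ∧
      -- integrability: the Hamiltonian flows are the Lax flows `dL/dt_k = [(L^{k/N})_+, L]`,
      (∀ k : ℕ, 1 ≤ k → ∀ n : ℤ,
        (bracketH F N I).act (integ (del F I) (hamiltonian N A k)) (genericL F N I n)
          = symMul (del F I) (symPlus (symPow (del F I) A k)) (genericL F N I) n
            - symMul (del F I) (genericL F N I) (symPlus (symPow (del F I) A k)) n) ∧
      -- the functionals `∫ h_k` are in involution for both brackets,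
      (∀ k l : ℕ, 1 ≤ k → 1 ≤ l →
        (bracketH F N I).pairing (integ (del F I) (hamiltonian N A k))
            (integ (del F I) (hamiltonian N A l)) = 0 ∧
        (bracketK F N I).pairing (integ (del F I) (hamiltonian N A k))
            (integ (del F I) (hamiltonian N A l)) = 0) ∧
      -- and the Hamiltonian flows commute
      (∀ k l : ℕ, 1 ≤ k → 1 ≤ l → ∀ u : DiffPoly F I,
        (bracketH F N I).act (integ (del F I) (hamiltonian N A k))
            ((bracketH F N I).act (integ (del F I) (hamiltonian N A l)) u)
          = (bracketH F N I).act (integ (del F I) (hamiltonian N A l))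
            ((bracketH F N I).act (integ (del F I) (hamiltonian N A k)) u)) := by
  have hIs : I ⊆ Set.Ici (-(N : ℤ)) := by
    rcases hI with rfl | rfl
    · exact le_rfl
    · exact Set.Ico_subset_Ici_self
  have hroot : ∀ A : ℤ → DiffPoly F I, IsRootOfL F N I A ↔
      ∃ a : Psi (del F I), Psi.sym a = A ∧ Psi.Monic 1 a ∧ Psi.sym (a ^ N) = genericL F N I := by
    intro A
    constructor
    · rintro ⟨h1, h2⟩
      refine ⟨Psi.mk A h1.2, rfl, h1, ?_⟩
      rw [Psi.sym_pow]
      exact h2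
    · rintro ⟨a, rfl, h1, h2⟩
      refine ⟨h1, ?_⟩
      rw [← Psi.sym_pow]
      exact h2
  refine ⟨fun m n => ⟨bracketH_genericL hI m n, bracketK_genericL hI m n⟩, ?_, ?_⟩
  · have hLm := monic_genericL (F := F) hI
    obtain ⟨a, ha, haN⟩ := Psi.Monic.exists_root hN (L := Psi.mk (D := del F I) _ hLm.2) hLm
    refine ⟨Psi.sym a, (hroot _).2 ⟨a, rfl, ha, by rw [haN]; rfl⟩, fun B hB => ?_⟩
    obtain ⟨b, rfl, hb, hbN⟩ := (hroot B).1 hB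
    rw [Psi.Monic.root_unique hN hb ha]
    rw [haN]
    exact Psi.ext fun n => congrFun hbN n
  intro A hA
  obtain ⟨a, rfl, ha, haN⟩ := (hroot A).1 hA
  have hham : ∀ k : ℕ, hamiltonian N (Psi.sym a) k = ((N : F) / (k : F)) • Psi.sym (a ^ k) (-1) := fun k => by
    rw [hamiltonian, Psi.sym_pow]
  set Hf : ℕ → DiffPoly F I →ₗ[F] DiffPoly F I := fun k =>
    (bracketH F N I).reduced (hamiltonian N (Psi.sym a) k)
  set Kf : ℕ → DiffPoly F I →ₗ[F] DiffPoly F I := fun k =>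
    (bracketK F N I).reduced (hamiltonian N (Psi.sym a) k)
  have lax : ∀ k, 1 ≤ k → ∀ n, Hf k (genericL F N I n)
      = Psi.sym (Psi.plus (a ^ k) * a ^ N - a ^ N * Psi.plus (a ^ k)) n := fun k hk n => by
    change (bracketH F N I).reduced (hamiltonian N (Psi.sym a) k) _ = _
    rw [hham k]
    exact reducedH_hamiltonian hN hI ha haN hk n
  have hHm : ∀ k x y, Hf k (x * y) = Hf k x * y + x * Hf k y := fun k =>
    reduced_mul_right _ _
  have hKm : ∀ k x y, Kf k (x * y) = Kf k x * y + x * Kf k y := fun k =>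
    reduced_mul_right _ _
  have hHD : ∀ k x, Hf k ((del F I).toLinearMap x) = (del F I).toLinearMap (Hf k x) := fun k =>
    reduced_D_right _ _
  have hKD : ∀ k x, Kf k ((del F I).toLinearMap x) = (del F I).toLinearMap (Kf k x) := fun k =>
    reduced_D_right _ _
  have hK0 : ∀ ε, 1 ≤ ε → ε ≤ N → ∀ u, Kf ε u = 0 := by
    intro ε h1 h2
    refine derivation_ext hIs (Y := 0) (hKm ε) (fun _ _ => by simp) (hKD ε) (fun _ => by simp)
      fun n => ?_
    obtain ⟨B, b1, b2, -, -, b5, b6⟩ := Psi.exists_zpow_sub ha hN h1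
    -- B = A^{ε-N} has negative order for ε < N, and equals 1 for ε = N.
    have hz : Psi.plus B * a ^ N - a ^ N * Psi.plus B = 0 := by
      rcases h2.lt_or_eq with h | h
      · rw [Psi.plus_eq_zero b5.ord (by omega), zero_mul, mul_zero, sub_zero]
      · rw [b6 h, Psi.plus_one, one_mul, mul_one, sub_self]
    change (bracketK F N I).reduced (hamiltonian N (Psi.sym a) ε) _ = _
    rw [hham ε, reducedK_hamiltonian hN hI ha haN h1 b1 b2 n, hz, Psi.sym_zero_apply]
    rfl
  have hHK : ∀ k, 1 ≤ k → ∀ u, Hf k u = Kf (k + N) u := by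
    intro k hk
    refine derivation_ext hIs (hHm k) (hKm (k + N)) (hHD k) (hKD (k + N)) fun n => ?_
    rw [lax k hk]
    change _ = (bracketK F N I).reduced (hamiltonian N (Psi.sym a) (k + N)) _
    -- For the Hamiltonian of index k + N the operator B is A^k, so K gives the Lax equation already
    -- found for H.
    rw [hham (k + N), reducedK_hamiltonian hN hI ha haN (by omega) (pow_mul_comm' a k)
      (by rw [← pow_add]; congr 1; omega) n]
  have hlaxL : ∀ k, 1 ≤ k → Psi.mapDer (Hf k) (a ^ N) = Psi.plus (a ^ k) * a ^ N - a ^ N * Psi.plus (a ^ k) :=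
    fun k hk => Psi.ext fun n => by rw [Psi.sym_mapDer, haN, lax k hk]
  have hlaxP : ∀ k, 1 ≤ k → ∀ l, Psi.mapDer (Hf k) (a ^ l)
      = Psi.plus (a ^ k) * a ^ l - a ^ l * Psi.plus (a ^ k) := fun k hk =>
    mapDer_pow_of_lax (hHm k) (hHD k) ha hN (hlaxL k hk)
  have hinv : ∀ k l, 1 ≤ k → integ (del F I) (Hf k (hamiltonian N (Psi.sym a) l)) = 0 := fun k l hk => by
    rw [hham l]
    exact integ_flow_eq_zero (hlaxP k hk l) _
  refine ⟨hK0, hHK, ?_, ?_, ?_⟩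
  · intro k hk n
    refine (lax k hk n).trans ?_
    rw [Psi.sym_sub_apply, Psi.sym_mul, Psi.sym_mul, Psi.sym_plus, haN, Psi.sym_pow]
  · intro k l hk hl
    refine ⟨hinv k l hk, ?_⟩
    change integ (del F I) (Kf k (hamiltonian N (Psi.sym a) l)) = 0
    rcases le_or_gt k N with h | h
    · rw [hK0 k hk h, map_zero]
    · obtain ⟨j, rfl⟩ := Nat.exists_eq_add_of_lt h
      have := hHK (j + 1) (by omega) (hamiltonian N (Psi.sym a) l)
      rw [show N + j + 1 = j + 1 + N by ring, ← this]
      exact hinv (j + 1) l (by omega)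
  · intro k l hk hl
    have hZ : ∀ x, (Hf k ∘ₗ Hf l - Hf l ∘ₗ Hf k) x = Hf k (Hf l x) - Hf l (Hf k x) := fun _ => rfl
    -- By the Lax equations for powers, the two commutators in the zero curvature equation are the
    -- derivatives of A^l and A^k along the k-th and l-th flows.
    have hcurv := Psi.zero_curvature (((Commute.refl a).pow_pow k l).eq)
    rw [← hlaxP k hk l, ← hlaxP l hl k] at hcurv
    have hL2 : ∀ i j, 1 ≤ i → 1 ≤ j → Psi.mapDer (Hf i) (Psi.mapDer (Hf j) (a ^ N))
        = Psi.plus (Psi.mapDer (Hf i) (a ^ j)) * a ^ N - a ^ N * Psi.plus (Psi.mapDer (Hf i) (a ^ j))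
          + (Psi.plus (a ^ j) * (Psi.plus (a ^ i) * a ^ N - a ^ N * Psi.plus (a ^ i))
            - (Psi.plus (a ^ i) * a ^ N - a ^ N * Psi.plus (a ^ i)) * Psi.plus (a ^ j)) := by
      intro i j hi hj
      rw [hlaxL j hj, map_sub, Psi.mapDer_mul (hHm i) (hHD i), Psi.mapDer_mul (hHm i) (hHD i),
        Psi.mapDer_plus, hlaxL i hi]
      abel
    have hcomm : Psi.mapDer (Hf k) (Psi.mapDer (Hf l) (a ^ N)) - Psi.mapDer (Hf l) (Psi.mapDer (Hf k) (a ^ N))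
        -- Zero curvature replaces the difference of the differentiated (A^l)_+ and (A^k)_+ by
        -- [(A^k)_+, (A^l)_+]; what remains is the Jacobi identity for commutators in `Psi`.
        = 0 := by
      rw [hL2 k l hk hl, hL2 l k hl hk, sub_eq_iff_eq_add.1 hcurv]
      noncomm_ring
    -- The commutator of the two flows is again a derivation commuting with ∂, so its vanishing on
    -- the coefficients of L suffices.
    have hzero : ∀ v, (Hf k ∘ₗ Hf l - Hf l ∘ₗ Hf k) v = 0 := by
      refine derivation_ext hIs (Y := 0) (fun x y => ?_) (fun _ _ => by simp) (fun x => ?_)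
        (fun _ => by simp) fun n => ?_
      · simp only [hZ, hHm, map_add]
        noncomm_ring
      · simp only [hZ, hHD, map_sub]
      · have h := congrArg (fun X => Psi.sym X n) hcomm
        rw [Psi.sym_sub_apply, Psi.sym_zero_apply, Psi.sym_mapDer, Psi.sym_mapDer, Psi.sym_mapDer, Psi.sym_mapDer, haN] at h
        rw [hZ, h]
        rfl
    exact fun u => sub_eq_zero.1 (hzero u)
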